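/- \textbf{Setting.} A relational signature $\sigma$ is a finite set of relation symbols of positive arity; structures are finite and non-empty (except in the convention for $k=0$ below). A numerical predicate collection $\mathbb P$ is a countable set of predicate names $P$ (numbered by natural numbers), each with an arity $\mathrm{ar}(P)\ge 1$ and a semantics $[\![P]\!]\subseteq\mathbb Z^{\mathrm{ar}(P)}$. Formulas and counting terms of $\mathrm{FOCN}(\mathbb P)[\sigma]$ are built, over structure variables (ranging over the universe $A$) and number variables (ranging over $\mathbb Z$), as follows: $x=y$ and $R(\bar x)$ are formulas; formulas are closed under $\neg,\vee$, under $\exists y$ for structure variables $y$, and under $\exists\kappa$ for number variables $\kappa$ (where $\kappa$ ranges over $\{0,\dots,|A|\}$); $P(t_1,\dots,t_m)$ is a formula for counting terms $t_i$ and $P\in\mathbb P$ of arity $m$; integers, number variables, sums and products of counting terms, and $\#(y_1,\dots,y_n).\varphi$ ($n\ge1$, the $y_i$ pairwise distinct; the number of tuples in $A^n$ satisfying $\varphi$) are counting terms. The binding rank $\mathrm{br}(\varphi)$ is the nesting depth of the constructs $\exists y$ and $\#\bar y$ binding structure variables; the binding width $\mathrm{bw}(\varphi)$ is the maximal number of structure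 variables bound by one such construct ($0$ if there is none). A structure is $d$-bounded if every vertex of its Gaifman graph has at most $d$ neighbours. The $r$-sphere $\mathcal N_r^{\mathcal A}(\bar a)$ of $\bar a\in A^k$ is the substructure induced on the elements at Gaifman distance at most $r$ from some entry of $\bar a$, together with the centres $\bar a$. An $r$-type with $k$ centres is a finite structure with $k$ distinguished elements (its centres) in which every element has distance at most $r$ from some centre; for $k=0$, by convention, the empty structure is the only such type and also the $r$-sphere of the empty tuple. Let $T_r^{\sigma,d}(k)$ be lists, computable from $\sigma,d,r,k$, that contain exactly one representative of every isomorphism class of $d$-bounded $r$-types with $k$ centres over $\sigma$. For $\tau\in T_r^{\sigma,d}(1)$ let $n_\tau(\mathcal A)$ be the number of $a\in A$ with $\mathcal N_r^{\mathcal A}(a)\cong\tau$, and let $\mathrm{HT}_r^d(\mathcal A)=(n_\tau(\mathcal A))_{\tau\in T_r^{\sigma,d}(1)}$. Let $\mathcal Z_{\mathbb P}=(\mathbb Z,+,\cdot,\le,(i)_{i\in\mathbb Z},([\![P]\!])_{P\in\mathbb P\cup\{P_\exists\}})$ be integer arithmetic with a constant symbol for every integer, where $[\![P_\exists]\!]=\{1,2,3,\dots\}$.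 A first-order formula over this signature with free variables among $\bar v=(v_1,\dots,v_\ell)$ is bounded if every quantification in it is of the form $\exists w\,(0\le w\le v_1+\dots+v_\ell\,\wedge\,\chi)$ with a variable $w\notin\{v_1,\dots,v_\ell\}$. \textbf{Theorem.} Computable lists $T_r^{\sigma,d}(k)$ as above exist. Let any such lists be fixed and let $\mathbb P$ be a numerical predicate collection. There is an algorithm which receives as input $d\in\mathbb N$, a relational signature $\sigma$, a formula $\varphi(\bar x)$ of $\mathrm{FOCN}(\mathbb P)[\sigma]$ without free number variables whose free structure variables are among the $k\ge0$ pairwise distinct variables $\bar x=(x_1,\dots,x_k)$, and a type $\rho\in T_r^{\sigma,d}(k)$ for $r=(2\,\mathrm{bw}(\varphi)+1)^{\mathrm{br}(\varphi)}-1$, and constructs a bounded first-order formula $\Psi_\rho$ over the signature of $\mathcal Z_{\mathbb P}$ with free variables among $(v_\tau)_{\tau\in T_r^{\sigma,d}(1)}$, such that for all $d$-bounded $\sigma$-structures $\mathcal A$ and all $\bar a\in A^k$ with $\mathcal N_r^{\mathcal A}(\bar a)\cong\rho$: \[ \mathcal A\models\varphi[\bar a]\iff \mathcal Z_{\mathbb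 P}\models\Psi_\rho[\mathrm{HT}_r^d(\mathcal A)]. \] -/

import Mathlib

namespace FOCN

universe u v

/-! ### Signatures, structures, Gaifman graphs, spheres and types -/

/-- A finite relational signature, given by the list of the arities (all positive) of its relation
symbols; the symbols are the positions in this list. -/
structure Signature where
  arities : List ℕ
  arities_pos : ∀ m ∈ arities, 1 ≤ m

/-- The relation symbols of `σ`. -/
abbrev Signature.Sym (σ : Signature) : Type := Fin σ.arities.length

/-- The arity of a relation symbol. -/
abbrev Signature.ar (σ : Signature) (R : σ.Sym) : ℕ := σ.arities.get R

/-- A `σ`-structure with universe `A`. Finiteness and non-emptiness of `A` are separate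
assumptions. -/
structure Struc (σ : Signature) (A : Type u) where
  rel : (R : σ.Sym) → Set (Fin (σ.ar R) → A)

section

variable {σ : Signature} {A : Type u} {B : Type v} {k : ℕ}

/-- The Gaifman graph of a structure. -/
def Struc.gaifman (S : Struc σ A) : SimpleGraph A where
  Adj a b := a ≠ b ∧ ∃ R, ∃ t ∈ S.rel R, a ∈ Set.range t ∧ b ∈ Set.range t
  symm := ⟨fun _ _ h => ⟨h.1.symm, by
    obtain ⟨R, t, ht, ha, hb⟩ := h.2
    exact ⟨R, t, ht, hb, ha⟩⟩⟩
  loopless := ⟨fun _ h => h.1 rfl⟩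

/-- A (finite) structure is `d`-bounded if every vertex of its Gaifman graph has at most `d`
neighbours. -/
def Struc.DBounded (S : Struc σ A) (d : ℕ) : Prop :=
  ∀ a, (S.gaifman.neighborSet a).ncard ≤ d

/-- The `r`-neighbourhood of a tuple: all elements at distance at most `r` (in the Gaifman graph)
from some entry of the tuple. -/
def Struc.nbhd (S : Struc σ A) (r : ℕ) (a : Fin k → A) : Set A :=
  {b | ∃ j, S.gaifman.edist (a j) b ≤ (r : ℕ∞)}

theorem Struc.mem_nbhd (S : Struc σ A) (r : ℕ) (a : Fin k → A) (j : Fin k) :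
    a j ∈ S.nbhd r a :=
  ⟨j, by simp⟩

/-- The induced substructure on a set of elements. -/
def Struc.induce (S : Struc σ A) (X : Set A) : Struc σ X where
  rel R := {t | (fun j => (t j : A)) ∈ S.rel R}

/-- Isomorphism of structures with `k` distinguished elements. -/
def Iso (S : Struc σ A) (a : Fin k → A) (S' : Struc σ B) (b : Fin k → B) : Prop :=
  ∃ e : A ≃ B, (∀ R t, t ∈ S.rel R ↔ (fun j => e (t j)) ∈ S'.rel R) ∧ ∀ j, e (a j) = b j

/-- A concrete finite `σ`-structure with universe `{0, …, size - 1}` and `k` centres. Every finite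
`σ`-structure with `k` distinguished elements is isomorphic to one of these. -/
structure PStruc (σ : Signature) (k : ℕ) where
  size : ℕ
  str : Struc σ (Fin size)
  centre : Fin k → Fin size

/-- `τ` is a `d`-bounded `r`-type with `k` centres: every element is within distance `r` of some
centre. (For `k = 0` this forces the universe to be empty.) -/
def PStruc.IsType (τ : PStruc σ k) (r d : ℕ) : Prop :=
  τ.str.nbhd r τ.centre = Set.univ ∧ τ.str.DBounded d

/-- The tuple `a` is of type `τ` in `S`: the `r`-sphere of `a` in `S`, that is, the substructure
induced on the `r`-neighbourhood of `a`, with centres `a`, is isomorphic to `τ`. -/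
def Struc.Realises (S : Struc σ A) (r : ℕ) (a : Fin k → A) (τ : PStruc σ k) : Prop :=
  Iso (S.induce (S.nbhd r a)) (fun j => ⟨a j, S.mem_nbhd r a j⟩) τ.str τ.centre

/-- The number of realisations in `S` of a type with one centre. -/
noncomputable def Struc.numReal (S : Struc σ A) (r : ℕ) (τ : PStruc σ 1) : ℕ :=
  {a : A | S.Realises r (fun _ => a) τ}.ncard

open Classical in
/-- The finite description of a concrete structure with centres: the size of the universe, for each
relation symbol the bit table of its relation, and the list of centres. -/
noncomputable def PStruc.code (τ : PStruc σ k) : ℕ × List (List Bool) × List ℕ :=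
  (τ.size,
    List.ofFn fun R : σ.Sym => List.ofFn fun i : Fin (τ.size ^ σ.ar R) =>
      decide (finFunctionFinEquiv.symm i ∈ τ.str.rel R),
    List.ofFn fun j => (τ.centre j : ℕ))

end

/-- `T σ d r k` is, for all `σ`, `d`, `r`, `k`, a list of `d`-bounded `r`-types with `k` centres
over `σ` that contains exactly one representative of each isomorphism class of such types, and the
list can be computed from `σ`, `d`, `r` and `k`. -/
def IsTypeLists (T : (σ : Signature) → (d r k : ℕ) → List (PStruc σ k)) : Prop :=
  (∃ g : List ℕ × ℕ × ℕ × ℕ →. List (ℕ × List (List Bool) × List ℕ), Partrec g ∧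
    ∀ σ d r k, (T σ d r k).map PStruc.code ∈ g (σ.arities, d, r, k)) ∧
  ∀ σ d r k,
    (∀ τ ∈ T σ d r k, τ.IsType r d) ∧
    ∀ τ : PStruc σ k, τ.IsType r d →
      ∃! i : Fin (T σ d r k).length,
        Iso τ.str τ.centre ((T σ d r k).get i).str ((T σ d r k).get i).centre

/-! ### The logic FOCN -/

/-- A numerical predicate collection with set of predicate names `Name`. -/
structure NumPreds (Name : Type u) where
  ar : Name → ℕ
  ar_pos : ∀ P, 1 ≤ ar P
  sem : (P : Name) → Set (Fin (ar P) → ℤ)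

/-- The two kinds of expressions. -/
inductive Kind
  | formula
  | term

/-- Expressions of `FOCN(Ps)[σ]`. Structure variables and number variables are both named by natural
numbers, in two separate name spaces. -/
inductive Expr (σ : Signature) {Name : Type u} (Ps : NumPreds Name) : Kind → Type u
  /-- `x = y` -/
  | eq (x y : ℕ) : Expr σ Ps .formula
  /-- `R(x₁, …, xₘ)` -/
  | rel (R : σ.Sym) (x : Fin (σ.ar R) → ℕ) : Expr σ Ps .formula
  | neg (φ : Expr σ Ps .formula) : Expr σ Ps .formula
  | or (φ ψ : Expr σ Ps .formula) : Expr σ Ps .formula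
  /-- `∃ y φ` for a structure variable `y` -/
  | ex (y : ℕ) (φ : Expr σ Ps .formula) : Expr σ Ps .formula
  /-- `P(t₁, …, tₘ)` -/
  | pred (P : Name) (t : Fin (Ps.ar P) → Expr σ Ps .term) : Expr σ Ps .formula
  /-- `∃ κ φ` for a number variable `κ` -/
  | exNum (κ : ℕ) (φ : Expr σ Ps .formula) : Expr σ Ps .formula
  /-- `#(y₁, …, yₙ).φ` for `n ≥ 1` pairwise distinct structure variables -/
  | count (n : ℕ) (hn : 1 ≤ n) (y : Fin n → ℕ) (hy : Function.Injective y)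
      (φ : Expr σ Ps .formula) : Expr σ Ps .term
  | int (i : ℤ) : Expr σ Ps .term
  | add (s t : Expr σ Ps .term) : Expr σ Ps .term
  | mul (s t : Expr σ Ps .term) : Expr σ Ps .term
  /-- a number variable -/
  | num (κ : ℕ) : Expr σ Ps .term

/-- Formulas of `FOCN(Ps)[σ]`. -/
abbrev Formula (σ : Signature) {Name : Type u} (Ps : NumPreds Name) : Type u :=
  Expr σ Ps .formula

/-- Formulas take truth values, counting terms take integer values. -/
abbrev Kind.Val : Kind → Type
  | .formula => Prop
  | .term => ℤ

section

variable {σ : Signature} {Name : Type u} {Ps : NumPreds Name}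

/-- The semantics of expressions in the structure `S` (with finite universe `A`) under the
assignment `β` of the structure variables and `ν` of the number variables. -/
noncomputable def Expr.sem {A : Type v} (S : Struc σ A) :
    {c : Kind} → Expr σ Ps c → (ℕ → A) → (ℕ → ℤ) → c.Val
  | _, .eq x y, β, _ => β x = β y
  | _, .rel R x, β, _ => (fun j => β (x j)) ∈ S.rel R
  | _, .neg φ, β, ν => ¬ φ.sem S β ν
  | _, .or φ ψ, β, ν => φ.sem S β ν ∨ ψ.sem S β ν
  | _, .ex y φ, β, ν => ∃ a : A, φ.sem S (Function.update β y a) ν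
  | _, .pred P t, β, ν => (fun j => (t j).sem S β ν) ∈ Ps.sem P
  | _, .exNum κ φ, β, ν => ∃ m : ℕ, m ≤ Nat.card A ∧ φ.sem S β (Function.update ν κ (m : ℤ))
  | _, .count n _ y _ φ, β, ν =>
      (({a : Fin n → A | φ.sem S (Function.extend y a β) ν}.ncard : ℕ) : ℤ)
  | _, .int i, _, _ => i
  | _, .add s t, β, ν => HAdd.hAdd (α := ℤ) (s.sem S β ν) (t.sem S β ν)
  | _, .mul s t, β, ν => HMul.hMul (α := ℤ) (s.sem S β ν) (t.sem S β ν)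
  | _, .num κ, _, ν => ν κ

/-- The free structure variables. -/
def Expr.freeVar : {c : Kind} → Expr σ Ps c → Finset ℕ
  | _, .eq x y => {x, y}
  | _, .rel _ x => Finset.univ.image x
  | _, .neg φ => φ.freeVar
  | _, .or φ ψ => φ.freeVar ∪ ψ.freeVar
  | _, .ex y φ => φ.freeVar \ {y}
  | _, .pred _ t => Finset.univ.biUnion fun j => (t j).freeVar
  | _, .exNum _ φ => φ.freeVar
  | _, .count _ _ y _ φ => φ.freeVar \ Finset.univ.image y
  | _, .int _ => ∅
  | _, .add s t => s.freeVar ∪ t.freeVar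
  | _, .mul s t => s.freeVar ∪ t.freeVar
  | _, .num _ => ∅

/-- The free number variables. -/
def Expr.freeNum : {c : Kind} → Expr σ Ps c → Finset ℕ
  | _, .eq _ _ => ∅
  | _, .rel _ _ => ∅
  | _, .neg φ => φ.freeNum
  | _, .or φ ψ => φ.freeNum ∪ ψ.freeNum
  | _, .ex _ φ => φ.freeNum
  | _, .pred _ t => Finset.univ.biUnion fun j => (t j).freeNum
  | _, .exNum κ φ => φ.freeNum \ {κ}
  | _, .count _ _ _ _ φ => φ.freeNum
  | _, .int _ => ∅
  | _, .add s t => s.freeNum ∪ t.freeNum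
  | _, .mul s t => s.freeNum ∪ t.freeNum
  | _, .num κ => {κ}

/-- The binding rank: the nesting depth of the constructs `∃ y` and `#ȳ` that bind structure
variables. -/
def Expr.br : {c : Kind} → Expr σ Ps c → ℕ
  | _, .eq _ _ => 0
  | _, .rel _ _ => 0
  | _, .neg φ => φ.br
  | _, .or φ ψ => max φ.br ψ.br
  | _, .ex _ φ => φ.br + 1
  | _, .pred _ t => Finset.univ.sup fun j => (t j).br
  | _, .exNum _ φ => φ.br
  | _, .count _ _ _ _ φ => φ.br + 1
  | _, .int _ => 0
  | _, .add s t => max s.br t.br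
  | _, .mul s t => max s.br t.br
  | _, .num _ => 0

/-- The binding width: the maximal number of structure variables bound by one construct. -/
def Expr.bw : {c : Kind} → Expr σ Ps c → ℕ
  | _, .eq _ _ => 0
  | _, .rel _ _ => 0
  | _, .neg φ => φ.bw
  | _, .or φ ψ => max φ.bw ψ.bw
  | _, .ex _ φ => max φ.bw 1
  | _, .pred _ t => Finset.univ.sup fun j => (t j).bw
  | _, .exNum _ φ => φ.bw
  | _, .count n _ _ _ φ => max n φ.bw
  | _, .int _ => 0
  | _, .add s t => max s.bw t.bw
  | _, .mul s t => max s.bw t.bw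
  | _, .num _ => 0

/-- The radius `(2 bw(φ) + 1) ^ br(φ) - 1` (the power is at least `1`). -/
def Expr.radius {c : Kind} (φ : Expr σ Ps c) : ℕ := (2 * φ.bw + 1) ^ φ.br - 1

/-- Gödel numbers of expressions, relative to a numbering of the predicate names. -/
def Expr.code [Encodable Name] : {c : Kind} → Expr σ Ps c → ℕ
  | _, .eq x y => Nat.pair 0 (Nat.pair x y)
  | _, .rel R x => Nat.pair 1 (Nat.pair (R : ℕ) (Encodable.encode (List.ofFn x)))
  | _, .neg φ => Nat.pair 2 φ.code
  | _, .or φ ψ => Nat.pair 3 (Nat.pair φ.code ψ.code)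
  | _, .ex y φ => Nat.pair 4 (Nat.pair y φ.code)
  | _, .pred P t => Nat.pair 5
      (Nat.pair (Encodable.encode P) (Encodable.encode (List.ofFn fun j => (t j).code)))
  | _, .exNum κ φ => Nat.pair 6 (Nat.pair κ φ.code)
  | _, .count _ _ y _ φ => Nat.pair 7 (Nat.pair (Encodable.encode (List.ofFn y)) φ.code)
  | _, .int i => Nat.pair 8 (Encodable.encode i)
  | _, .add s t => Nat.pair 9 (Nat.pair s.code t.code)
  | _, .mul s t => Nat.pair 10 (Nat.pair s.code t.code)
  | _, .num κ => Nat.pair 11 κ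

/-! ### First-order formulas over integer arithmetic -/

/-- The numerical predicate collection extended by the unary predicate `P_∃` (named `none`), whose
semantics is the set of positive integers. -/
def NumPreds.withEx (Ps : NumPreds Name) : NumPreds (Option Name) where
  ar := fun P => P.elim 1 Ps.ar
  ar_pos := fun P => by cases P with
    | none => exact le_rfl
    | some P => exact Ps.ar_pos P
  sem := fun P => match P with
    | none => {t | 1 ≤ t (0 : Fin 1)}
    | some P => Ps.sem P

/-- Terms of integer arithmetic: variables (named by natural numbers), integer constants, sums and
products. -/
inductive ZTerm
  | var (n : ℕ)
  | const (i : ℤ)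
  | add (s t : ZTerm)
  | mul (s t : ZTerm)

/-- The value of a term. -/
def ZTerm.val : ZTerm → (ℕ → ℤ) → ℤ
  | .var n, v => v n
  | .const i, _ => i
  | .add s t, v => s.val v + t.val v
  | .mul s t, v => s.val v * t.val v

/-- The variables of a term. -/
def ZTerm.vars : ZTerm → Finset ℕ
  | .var n => {n}
  | .const _ => ∅
  | .add s t => s.vars ∪ t.vars
  | .mul s t => s.vars ∪ t.vars

/-- Gödel numbers of terms. -/
def ZTerm.code : ZTerm → ℕ
  | .var n => Nat.pair 0 n
  | .const i => Nat.pair 1 (Encodable.encode i)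
  | .add s t => Nat.pair 2 (Nat.pair s.code t.code)
  | .mul s t => Nat.pair 3 (Nat.pair s.code t.code)

/-- The term `v₀ + ⋯ + v_{ℓ-1}`. -/
def ZTerm.sumVars : ℕ → ZTerm
  | 0 => .const 0
  | ℓ + 1 => .add (sumVars ℓ) (.var ℓ)

/-- First-order formulas over the integers with `+`, `·`, integer constants, `≤` and the predicates
from the collection `Ps` together with `P_∃`. -/
inductive ZFormula (Ps : NumPreds Name) : Type u
  | eq (s t : ZTerm) : ZFormula Ps
  | le (s t : ZTerm) : ZFormula Ps
  | pred (P : Option Name) (t : Fin (Ps.withEx.ar P) → ZTerm) : ZFormula Ps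
  | neg (φ : ZFormula Ps) : ZFormula Ps
  | or (φ ψ : ZFormula Ps) : ZFormula Ps
  | ex (n : ℕ) (φ : ZFormula Ps) : ZFormula Ps

/-- Conjunction. -/
def ZFormula.and (φ ψ : ZFormula Ps) : ZFormula Ps := .neg (.or (.neg φ) (.neg ψ))

/-- Satisfaction in the integers under the assignment `v`; quantifiers range over all of `ℤ`. -/
def ZFormula.Sat : ZFormula Ps → (ℕ → ℤ) → Prop
  | .eq s t, v => s.val v = t.val v
  | .le s t, v => s.val v ≤ t.val v
  | .pred P t, v => (fun j => (t j).val v) ∈ Ps.withEx.sem P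
  | .neg φ, v => ¬ φ.Sat v
  | .or φ ψ, v => φ.Sat v ∨ ψ.Sat v
  | .ex n φ, v => ∃ i : ℤ, φ.Sat (Function.update v n i)

/-- The free variables of a formula. -/
def ZFormula.free : ZFormula Ps → Finset ℕ
  | .eq s t => s.vars ∪ t.vars
  | .le s t => s.vars ∪ t.vars
  | .pred _ t => Finset.univ.biUnion fun j => (t j).vars
  | .neg φ => φ.free
  | .or φ ψ => φ.free ∪ ψ.free
  | .ex n φ => φ.free \ {n}

/-- A formula in the free variables `v₀, …, v_{ℓ-1}` is bounded if every quantification in it has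
the form `∃ w (0 ≤ w ≤ v₀ + ⋯ + v_{ℓ-1} ∧ χ)`, where `w` is none of `v₀, …, v_{ℓ-1}`. -/
inductive ZFormula.IsBounded (ℓ : ℕ) : ZFormula Ps → Prop
  | eq (s t : ZTerm) : IsBounded ℓ (.eq s t)
  | le (s t : ZTerm) : IsBounded ℓ (.le s t)
  | pred (P : Option Name) (t : Fin (Ps.withEx.ar P) → ZTerm) : IsBounded ℓ (.pred P t)
  | neg (φ : ZFormula Ps) : IsBounded ℓ φ → IsBounded ℓ (.neg φ)
  | or (φ ψ : ZFormula Ps) : IsBounded ℓ φ → IsBounded ℓ ψ → IsBounded ℓ (.or φ ψ)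
  | ex (w : ℕ) (hw : ℓ ≤ w) (χ : ZFormula Ps) : IsBounded ℓ χ →
      IsBounded ℓ (.ex w (.and
        (.and (.le (.const 0) (.var w)) (.le (.var w) (ZTerm.sumVars ℓ))) χ))

/-- Gödel numbers of formulas, relative to a numbering of the predicate names. -/
def ZFormula.code [Encodable Name] : ZFormula Ps → ℕ
  | .eq s t => Nat.pair 0 (Nat.pair s.code t.code)
  | .le s t => Nat.pair 1 (Nat.pair s.code t.code)
  | .pred P t => Nat.pair 2
      (Nat.pair (Encodable.encode P) (Encodable.encode (List.ofFn fun j => (t j).code)))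
  | .neg φ => Nat.pair 3 φ.code
  | .or φ ψ => Nat.pair 4 (Nat.pair φ.code ψ.code)
  | .ex n φ => Nat.pair 5 (Nat.pair n φ.code)

end

end FOCN

open FOCN

-- A formula is translated relative to a finite "local structure", a list of facts together with a
-- tuple that interprets the free variables. Two facts about this translation `tr` give the theorem.
-- If the local structure is all of 𝒜 and the variables v_τ hold the true counts, the translation
-- has the value of the formula (`tr_correct`). If the local structure is exchanged for one whose
-- tuple has an isomorphic sphere, of the radius that belongs to the remaining binding rank, the
-- value does not change (`tr_invariant`). Hence the translation relative to the type ρ, which no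
-- longer mentions 𝒜, serves as Ψ_ρ (`sat_tr_iff`).
--
-- The hard case is counting; an existential quantifier says that a count is positive. Let b range
-- over n-tuples next to a fixed tuple c, and suppose that the truth of φ at bc depends, for given
-- counts, only on the r-sphere of bc. Join two positions of b, or a position of b and the position
-- 0 that is occupied by all of c, if they have distance at most 2r+1. Let K be this closeness
-- graph. The components of K do not interact, so they may be moved to separate copies of the
-- structure without changing the sphere (`exists_piso_placed`). Write f(H) for the value of φ after
-- the components of a graph H have been moved apart. The wanted value is f(K), but "the closeness
-- graph is exactly K" demands that components stay far apart, and that does not factor over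
-- components. Möbius inversion, f(K) = Σ (-1)^(|E|-|H|) f(H) over H ⊆ E ⊆ K (`sum_signed`), leaves
-- only the condition that the edges of E are short.
--
-- For fixed E and H this condition factors over the components of E. Each component lies within
-- n(2r+1) of its root, its least position, and different roots are chosen independently. What a
-- component contributes depends only on the sphere of its root (`clusterSum_congr`), so roots are
-- grouped by their types, and v_τ of them have type τ. The count thus becomes a signed sum of
-- monomials in the v_τ; each is switched on or off by the truth of φ in a disjoint union of spheres
-- (`placementSum_eq_sum`). These truth values are arithmetic formulas obtained recursively, so a
-- counting term becomes a list of terms guarded by formulas. The radii must satisfy `rad_step`,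
-- which explains (2w+1)^q - 1. Number quantifiers are bounded by |A| = Σ v_τ.
--
-- For computability the translation is repeated on Gödel numbers, where it is primitive recursive
-- (`exists_primrec_tr`); only the call of the given type-list algorithm may fail to be so. Type
-- lists exist because a d-bounded r-type with k centres has at most k(d+1)^r elements, so that the
-- candidates can be enumerated, tested and thinned out up to isomorphism (`exists_isTypeLists`).

attribute [fun_prop] Primrec
attribute [fun_prop] Primrec.id Primrec.const Primrec.comp

namespace FOCN

/-! ### Closure properties of primitive recursive functions, as rules for `fun_prop`. -/

section PrimrecClosure

variable {α β γ δ ε : Type*} [Primcodable α] [Primcodable β] [Primcodable γ] [Primcodable δ]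
  [Primcodable ε]

@[fun_prop] theorem primrec_fst {f : α → β × γ} (hf : Primrec f) : Primrec fun a => (f a).1 :=
  Primrec.fst.comp hf

@[fun_prop] theorem primrec_snd {f : α → β × γ} (hf : Primrec f) : Primrec fun a => (f a).2 :=
  Primrec.snd.comp hf

@[fun_prop] theorem primrec_mk {f : α → β} {g : α → γ} (hf : Primrec f) (hg : Primrec g) :
    Primrec fun a => (f a, g a) := hf.pair hg

@[fun_prop] theorem primrec_map {f : α → List β} {g : α → β → γ} (hf : Primrec f)
    (hg : Primrec fun p : α × β => g p.1 p.2) : Primrec fun a => (f a).map (g a) :=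
  Primrec.list_map hf hg

@[fun_prop] theorem primrec_flatMap {f : α → List β} {g : α → β → List γ} (hf : Primrec f)
    (hg : Primrec fun p : α × β => g p.1 p.2) : Primrec fun a => (f a).flatMap (g a) :=
  Primrec.list_flatMap hf hg

@[fun_prop] theorem primrec_foldr {f : α → List β} {g : α → γ} {h : α → β → γ → γ}
    (hf : Primrec f) (hg : Primrec g)
    (hh : Primrec fun p : α × β × γ => h p.1 p.2.1 p.2.2) :
    Primrec fun a => (f a).foldr (h a) (g a) :=
  Primrec.list_foldr (h := fun a p => h a p.1 p.2) hf hg hh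

@[fun_prop] theorem primrec_range {f : α → ℕ} (hf : Primrec f) :
    Primrec fun a => List.range (f a) := Primrec.list_range.comp hf

@[fun_prop] theorem primrec_length {f : α → List β} (hf : Primrec f) :
    Primrec fun a => (f a).length := Primrec.list_length.comp hf

@[fun_prop] theorem primrec_cons {f : α → β} {g : α → List β} (hf : Primrec f)
    (hg : Primrec g) : Primrec fun a => f a :: g a := Primrec.list_cons.comp hf hg

@[fun_prop] theorem primrec_append {f g : α → List β} (hf : Primrec f)
    (hg : Primrec g) : Primrec fun a => f a ++ g a := Primrec.list_append.comp hf hg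

@[fun_prop] theorem primrec_getD {f : α → List β} {g : α → ℕ} {d : α → β} (hf : Primrec f)
    (hg : Primrec g) (hd : Primrec d) : Primrec fun a => (f a).getD (g a) (d a) := by
  have h := Primrec.option_getD.comp (Primrec.list_getElem?.comp hf hg) hd
  exact h.of_eq fun a => by simp [List.getD_eq_getElem?_getD]

@[fun_prop] theorem primrec_idxOf {f : α → List ℕ} {g : α → ℕ} (hf : Primrec f)
    (hg : Primrec g) : Primrec fun a => (f a).idxOf (g a) :=
  Primrec.list_idxOf.comp hg hf

@[fun_prop] theorem primrec_add {f g : α → ℕ} (hf : Primrec f) (hg : Primrec g) :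
    Primrec fun a => f a + g a := Primrec.nat_add.comp hf hg

@[fun_prop] theorem primrec_sub {f g : α → ℕ} (hf : Primrec f) (hg : Primrec g) :
    Primrec fun a => f a - g a := Primrec.nat_sub.comp hf hg

@[fun_prop] theorem primrec_mul {f g : α → ℕ} (hf : Primrec f) (hg : Primrec g) :
    Primrec fun a => f a * g a := Primrec.nat_mul.comp hf hg

@[fun_prop] theorem primrec_pow {f g : α → ℕ} (hf : Primrec f) (hg : Primrec g) :
    Primrec fun a => f a ^ g a :=
  (Primrec₂.unpaired'.1 Nat.Primrec.pow : Primrec₂ fun a b : ℕ => a ^ b).comp hf hg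

@[fun_prop] theorem primrec_min {f g : α → ℕ} (hf : Primrec f) (hg : Primrec g) :
    Primrec fun a => min (f a) (g a) := Primrec.nat_min.comp hf hg

@[fun_prop] theorem primrec_max {f g : α → ℕ} (hf : Primrec f) (hg : Primrec g) :
    Primrec fun a => max (f a) (g a) := Primrec.nat_max.comp hf hg

@[fun_prop] theorem primrec_natPair {f g : α → ℕ} (hf : Primrec f) (hg : Primrec g) :
    Primrec fun a => Nat.pair (f a) (g a) := Primrec₂.natPair.comp hf hg

@[fun_prop] theorem primrec_unpair {f : α → ℕ} (hf : Primrec f) :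
    Primrec fun a => Nat.unpair (f a) := Primrec.unpair.comp hf

@[fun_prop] theorem primrec_cond {c : α → Bool} {f g : α → β} (hc : Primrec c)
    (hf : Primrec f) (hg : Primrec g) : Primrec fun a => bif c a then f a else g a :=
  Primrec.cond hc hf hg

@[fun_prop] theorem primrec_and {f g : α → Bool} (hf : Primrec f) (hg : Primrec g) :
    Primrec fun a => f a && g a := Primrec.and.comp hf hg

@[fun_prop] theorem primrec_or {f g : α → Bool} (hf : Primrec f) (hg : Primrec g) :
    Primrec fun a => f a || g a := Primrec.or.comp hf hg

@[fun_prop] theorem primrec_not {f : α → Bool} (hf : Primrec f) :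
    Primrec fun a => !f a := Primrec.not.comp hf

@[fun_prop] theorem primrec_beq [DecidableEq β] {f g : α → β} (hf : Primrec f)
    (hg : Primrec g) : Primrec fun a => f a == g a := Primrec.beq.comp hf hg

@[fun_prop] theorem primrec_ble {f g : α → ℕ} (hf : Primrec f) (hg : Primrec g) :
    Primrec fun a => Nat.ble (f a) (g a) := by
  have h : Primrec fun a => decide (f a ≤ g a) := (Primrec.nat_le.decide).comp hf hg
  exact h.of_eq fun a => by
    rw [Bool.eq_iff_iff]; simp

@[fun_prop] theorem primrec_blt {f g : α → ℕ} (hf : Primrec f) (hg : Primrec g) :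
    Primrec fun a => Nat.blt (f a) (g a) := by
  unfold Nat.blt; exact primrec_ble (Primrec.succ.comp hf) hg

@[fun_prop] theorem primrec_encode {f : α → β} (hf : Primrec f) :
    Primrec fun a => Encodable.encode (f a) := Primrec.encode.comp hf

@[fun_prop] theorem primrec_decode {f : α → ℕ} (hf : Primrec f) :
    Primrec fun a => (Encodable.decode (f a) : Option β) := Primrec.decode.comp hf

@[fun_prop] theorem primrec_optionGetD {f : α → Option β} {g : α → β} (hf : Primrec f)
    (hg : Primrec g) : Primrec fun a => (f a).getD (g a) := Primrec.option_getD.comp hf hg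

@[fun_prop] theorem primrec_filter {f : α → List β} {g : α → β → Bool} (hf : Primrec f)
    (hg : Primrec fun p : α × β => g p.1 p.2) : Primrec fun a => (f a).filter (g a) := by
  have h : Primrec fun a => (f a).foldr (fun b l => bif g a b then b :: l else l) [] := by
    fun_prop
  exact h.of_eq fun a => by
    induction f a with
    | nil => rfl
    | cons b l ih => simp only [List.foldr_cons, ih, List.filter_cons]; cases g a b <;> simp

@[fun_prop] theorem primrec_any {f : α → List β} {g : α → β → Bool} (hf : Primrec f)
    (hg : Primrec fun p : α × β => g p.1 p.2) : Primrec fun a => (f a).any (g a) := by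
  have h : Primrec fun a => (f a).foldr (fun b l => g a b || l) false := by
    fun_prop
  exact h.of_eq fun a => by
    induction f a with
    | nil => rfl
    | cons b l ih => simp [ih]

@[fun_prop] theorem primrec_all {f : α → List β} {g : α → β → Bool} (hf : Primrec f)
    (hg : Primrec fun p : α × β => g p.1 p.2) : Primrec fun a => (f a).all (g a) := by
  have h : Primrec fun a => (f a).foldr (fun b l => g a b && l) true := by
    fun_prop
  exact h.of_eq fun a => by
    induction f a with
    | nil => rfl
    | cons b l ih => simp [ih]

@[fun_prop] theorem primrec_natRec {f : α → ℕ} {g : α → β} {h : α → ℕ → β → β}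
    (hf : Primrec f) (hg : Primrec g) (hh : Primrec fun p : α × ℕ × β => h p.1 p.2.1 p.2.2) :
    Primrec fun a => Nat.rec (motive := fun _ => β) (g a) (h a) (f a) :=
  Primrec.nat_rec' (h := fun a p => h a p.1 p.2) hf hg hh

@[fun_prop] theorem primrec_foldl {f : α → List β} {g : α → γ} {h : α → γ → β → γ}
    (hf : Primrec f) (hg : Primrec g)
    (hh : Primrec fun p : α × γ × β => h p.1 p.2.1 p.2.2) :
    Primrec fun a => (f a).foldl (h a) (g a) :=
  Primrec.list_foldl (h := fun a p => h a p.1 p.2) hf hg hh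

@[fun_prop] theorem primrec_zip {f : α → List β} {g : α → List γ} (hf : Primrec f)
    (hg : Primrec g) : Primrec fun a => (f a).zip (g a) := by
  -- The fold carries the pairs found so far, reversed, and the unused rest of the second list;
  -- `take 1` contributes nothing once that rest is empty.
  have h : Primrec fun a => ((f a).foldl (fun s b => ((s.2.map fun c => (b, c)).take 1 ++ s.1,
      s.2.tail)) (([], g a) : List (β × γ) × List γ)).1.reverse := by
    refine Primrec.list_reverse.comp (primrec_fst (primrec_foldl hf (by fun_prop) ?_))
    refine primrec_mk (primrec_append (Primrec.list_take.comp (Primrec.const 1)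
      (by fun_prop)) (by fun_prop)) (Primrec.list_tail.comp (by fun_prop))
  refine h.of_eq fun a => ?_
  have key : ∀ (l : List β) (m : List γ) (acc : List (β × γ)),
      (l.foldl (fun s b => ((s.2.map fun c => (b, c)).take 1 ++ s.1, s.2.tail))
        (acc, m)).1.reverse = acc.reverse ++ l.zip m := by
    intro l
    induction l with
    | nil => intro m acc; simp
    | cons b l ih =>
      intro m acc
      cases m with
      | nil => simp [ih]
      | cons c m => simp [ih]
  simpa using key (f a) (g a) []

end PrimrecClosure

/-- A function satisfying a recursion equation whose recursive calls have smaller measure is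
primitive recursive, and such a function exists. -/
theorem exists_primrec_of_recursion {ι o : Type*} [Primcodable ι] [Primcodable o]
    (m : ι → ℕ) (sub : ι → List ι) (comb : ι → List o → o) (hm : Primrec m) (hs : Primrec sub)
    (hc : Primrec fun p : ι × List o => comb p.1 p.2) (ord : ∀ i, ∀ j ∈ sub i, m j < m i) :
    ∃ f : ι → o, Primrec f ∧ ∀ i, f i = comb i ((sub i).map f) := by
  -- `F n` unfolds the recursion `n` levels deep. Its value at `i` is stable as soon as `n` exceeds
  -- `m i`, so `f` reads it at depth `m i + 1`.
  let F : ℕ → ι → o := fun n => Nat.rec (fun i => comb i [])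
    (fun _ g i => comb i ((sub i).map g)) n
  have hF : ∀ n i, m i < n → ∀ k, m i < k → F n i = F k i := by
    intro n
    induction n with
    | zero => intro i h; omega
    | succ n ih =>
      intro i hi k hk
      obtain ⟨k, rfl⟩ : ∃ k', k = k' + 1 := ⟨k - 1, by omega⟩
      change comb i _ = comb i _
      congr 1
      refine List.map_congr_left fun j hj => ih j (by have := ord i j hj; omega) k
        (by have := ord i j hj; omega)
  let f : ι → o := fun i => F (m i + 1) i
  have hf : ∀ i, f i = comb i ((sub i).map f) := by
    intro i
    change comb i _ = comb i _
    congr 1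
    exact List.map_congr_left fun j hj => hF (m i) j (ord i j hj) (m j + 1) (by omega)
  refine ⟨f, ?_, hf⟩
  refine Primrec.nat_omega_rec' f (m := m) (l := sub) (g := fun i l => some (comb i l)) hm hs
    (Primrec.option_some.comp hc) ord fun i => ?_
  rw [← hf]

end FOCN

namespace FOCN

/-! ### Finite lists of facts and their local isomorphisms -/

/-- A finite list of facts `R(t)`, understood as a structure with universe `ℕ`. -/
abbrev Facts : Type := List (ℕ × List ℕ)

/-- Two elements occur in a common fact. -/
def Facts.Adj (F : Facts) (u v : ℕ) : Prop := ∃ f ∈ F, u ∈ f.2 ∧ v ∈ f.2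

theorem Facts.Adj.symm {F : Facts} {u v : ℕ} (h : F.Adj u v) : F.Adj v u :=
  let ⟨f, hf, hu, hv⟩ := h
  ⟨f, hf, hv, hu⟩

/-- The distance of `u` and `v` is at most `r`. -/
def Within (F : Facts) : ℕ → ℕ → ℕ → Prop
  | 0, u, v => u = v
  | r + 1, u, v => Within F r u v ∨ ∃ m, Within F r u m ∧ F.Adj m v

/-- The distance of `v` and some entry of `c` is at most `r`. -/
def Near (F : Facts) (r : ℕ) (c : List ℕ) (v : ℕ) : Prop := ∃ u ∈ c, Within F r u v

section Within

variable {F : Facts} {u v w : ℕ} {a b r : ℕ}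

theorem within_refl (F : Facts) (r u : ℕ) : Within F r u u := by
  induction r with
  | zero => rfl
  | succ r ih => exact Or.inl ih

theorem within_mono (h : Within F a u v) (hab : a ≤ b) : Within F b u v := by
  induction b, hab using Nat.le_induction with
  | base => exact h
  | succ b _ ih => exact Or.inl ih

theorem within_trans (h : Within F a u v) (h' : Within F b v w) : Within F (a + b) u w := by
  induction b generalizing w with
  | zero => obtain rfl : v = w := h'; exact h
  | succ b ih =>
    rcases h' with h' | ⟨m, h', hm⟩
    · exact Or.inl (ih h')
    · exact Or.inr ⟨m, ih h', hm⟩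

theorem within_of_adj (h : F.Adj u v) : Within F 1 u v := Or.inr ⟨u, rfl, h⟩

theorem within_symm (h : Within F r u v) : Within F r v u := by
  induction r generalizing v with
  | zero => exact Eq.symm h
  | succ r ih =>
    rcases h with h | ⟨m, h, hm⟩
    · exact Or.inl (ih h)
    · rw [Nat.add_comm]
      exact within_trans (within_of_adj hm.symm) (ih h)

theorem within_split (h : Within F (a + b) u w) : ∃ m, Within F a u m ∧ Within F b m w := by
  induction b generalizing w with
  | zero => exact ⟨w, h, rfl⟩
  | succ b ih =>
    rcases h with h | ⟨m, h, hm⟩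
    · obtain ⟨x, h1, h2⟩ := ih h
      exact ⟨x, h1, Or.inl h2⟩
    · obtain ⟨x, h1, h2⟩ := ih h
      exact ⟨x, h1, Or.inr ⟨m, h2, hm⟩⟩

theorem near_of_mem {c : List ℕ} (h : u ∈ c) (r : ℕ) : Near F r c u := ⟨u, h, within_refl F r u⟩

theorem near_mono {c : List ℕ} (h : Near F a c u) (hab : a ≤ b) : Near F b c u :=
  let ⟨x, hx, h⟩ := h
  ⟨x, hx, within_mono h hab⟩

theorem near_within {c : List ℕ} (h : Near F a c u) (h' : Within F b u v) :
    Near F (a + b) c v :=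
  let ⟨x, hx, h⟩ := h
  ⟨x, hx, within_trans h h'⟩

end Within

/-- The elements at distance at most `r` from an entry of `c`. -/
def ball (F : Facts) (c : List ℕ) (r : ℕ) : List ℕ :=
  Nat.rec (motive := fun _ => List ℕ) c (fun _ L =>
    L ++ (F.filter fun f => f.2.any fun u => L.any fun x => x == u).flatMap fun f => f.2) r

theorem mem_ball {F : Facts} {c : List ℕ} {r v : ℕ} : v ∈ ball F c r ↔ Near F r c v := by
  induction r generalizing v with
  | zero => simp [ball, Near, Within]
  | succ r ih =>
    have h : ball F c (r + 1) = ball F c r ++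
      (F.filter fun f => f.2.any fun u => (ball F c r).any fun x => x == u).flatMap fun f => f.2 :=
      rfl
    rw [h, List.mem_append, ih]
    simp only [List.mem_flatMap, List.mem_filter, List.any_eq_true, beq_iff_eq, exists_eq_right,
      ih]
    constructor
    · rintro (⟨x, hx, h⟩ | ⟨f, ⟨hf, u, hu, x, hx, h⟩, hv⟩)
      · exact ⟨x, hx, Or.inl h⟩
      · exact ⟨x, hx, Or.inr ⟨u, h, f, hf, hu, hv⟩⟩
    · rintro ⟨x, hx, h | ⟨u, h, f, hf, hu, hv⟩⟩
      · exact Or.inl ⟨x, hx, h⟩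
      · exact Or.inr ⟨f, ⟨hf, u, hu, x, hx, h⟩, hv⟩

/-- The maps `h` and `h'` are mutually inverse isomorphisms between the `r`-spheres of `c` in `F`
and of `c'` in `F'`. -/
structure PIso (r : ℕ) (F : Facts) (c : List ℕ) (F' : Facts) (c' : List ℕ) (h h' : ℕ → ℕ) :
    Prop where
  maps : ∀ v, Near F r c v → Near F' r c' (h v) ∧ h' (h v) = v
  maps' : ∀ v, Near F' r c' v → Near F r c (h' v) ∧ h (h' v) = v
  facts : ∀ R t, (∀ u ∈ t, Near F r c u) → ((R, t) ∈ F ↔ (R, t.map h) ∈ F')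
  centre : c.map h = c'

namespace PIso

variable {r : ℕ} {F F' : Facts} {c c' : List ℕ} {h h' : ℕ → ℕ}

theorem refl (r : ℕ) (F : Facts) (c : List ℕ) : PIso r F c F c id id :=
  ⟨fun _ hv => ⟨hv, rfl⟩, fun _ hv => ⟨hv, rfl⟩, fun _ _ _ => by simp, by simp⟩

theorem symm (P : PIso r F c F' c' h h') : PIso r F' c' F c h' h := by
  refine ⟨P.maps', P.maps, fun R t ht => ?_, ?_⟩
  · rw [P.facts R (t.map h') (by
      intro u hu
      obtain ⟨x, hx, rfl⟩ := List.mem_map.1 hu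
      exact (P.maps' x (ht x hx)).1), List.map_map]
    rw [List.map_congr_left (f := h ∘ h') (g := id) fun x hx => (P.maps' x (ht x hx)).2,
      List.map_id]
  · rw [← P.centre, List.map_map, List.map_congr_left (f := h' ∘ h) (g := id) fun x hx =>
      (P.maps x (near_of_mem hx r)).2, List.map_id]

/-- All facts used by the walk have their elements within `a + k ≤ r` of the centres, so the
isomorphism of spheres preserves each of them. -/
theorem within (P : PIso r F c F' c' h h') {a k u v : ℕ} (hu : Near F a c u)
    (huv : Within F k u v) (hk : a + k ≤ r) : Within F' k (h u) (h v) := by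
  induction k generalizing v with
  | zero => obtain rfl : u = v := huv; rfl
  | succ k ih =>
    rcases huv with huv | ⟨m, hum, f, hf, hm, hv⟩
    · exact Or.inl (ih huv (by omega))
    · refine Or.inr ⟨h m, ih hum (by omega), (f.1, f.2.map h), ?_, List.mem_map_of_mem hm,
        List.mem_map_of_mem hv⟩
      refine (P.facts f.1 f.2 fun x hx => ?_).1 hf
      have hx' : Within F 1 m x := within_of_adj ⟨f, hf, hm, hx⟩
      exact near_mono (near_within (near_within hu hum) hx') (by omega)

theorem near (P : PIso r F c F' c' h h') {a u : ℕ} (hu : Near F a c u) (ha : a ≤ r) :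
    Near F' a c' (h u) := by
  obtain ⟨x, hx, hxu⟩ := hu
  exact ⟨h x, P.centre ▸ List.mem_map_of_mem hx,
    P.within (a := 0) ⟨x, hx, rfl⟩ hxu (by omega)⟩

/-- Both ends lie within `a` of the centres, so the walk is followed from both sides, `k + 1` steps
from `u` and `k` steps from `v`. This needs only radius `a + k + 1`, not `a + 2k + 1`. -/
theorem within_double (P : PIso r F c F' c' h h') {a k u v : ℕ} (hu : Near F a c u)
    (hv : Near F a c v) (huv : Within F (2 * k + 1) u v) (hk : a + k + 1 ≤ r) :
    Within F' (2 * k + 1) (h u) (h v) := by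
  obtain ⟨m, h1, h2⟩ := within_split (a := k + 1) (b := k)
    (show Within F (k + 1 + k) u v by convert huv using 1; omega)
  have h3 := P.within hu h1 (by omega)
  have h4 := P.within hv (within_symm h2) (by omega)
  convert within_trans h3 (within_symm h4) using 1
  omega

theorem sub (P : PIso r F c F' c' h h') {a k : ℕ} {d : List ℕ} (hd : ∀ x ∈ d, Near F a c x)
    (hk : a + k ≤ r) : PIso k F d F' (d.map h) h h' := by
  have key : ∀ v, Near F k d v → Near F r c v := fun v ⟨x, hx, hv⟩ =>
    near_mono (near_within (hd x hx) hv) hk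
  refine ⟨fun v hv => ⟨?_, (P.maps v (key v hv)).2⟩, fun v hv => ?_,
    fun R t ht => P.facts R t fun u hu => key u (ht u hu), rfl⟩
  · obtain ⟨x, hx, hv⟩ := hv
    exact ⟨h x, List.mem_map_of_mem hx, P.within (hd x hx) hv hk⟩
  · obtain ⟨y, hy, hv⟩ := hv
    obtain ⟨x, hx, rfl⟩ := List.mem_map.1 hy
    have hx' := P.near (hd x hx) (by omega)
    refine ⟨⟨x, hx, ?_⟩, (P.maps' v (near_mono (near_within hx' hv) hk)).2⟩
    have := P.symm.within hx' hv hk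
    rwa [(P.maps x (near_mono (hd x hx) (by omega))).2] at this

theorem mono (P : PIso r F c F' c' h h') {k : ℕ} (hk : k ≤ r) : PIso k F c F' c' h h' := by
  have := P.sub (a := 0) (k := k) (d := c) (fun x hx => near_of_mem hx 0) (by omega)
  rwa [P.centre] at this

end PIso

/-- The disjoint union of `m` lists of facts; the copy of `x` in the `l`-th one is `(l, x)`. -/
def dunion (m : ℕ) (G : ℕ → Facts) : Facts :=
  (List.range m).flatMap fun l => (G l).map fun f => (f.1, f.2.map (Nat.pair l))

/-! ### Local isomorphisms of disjoint unions. -/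

section DisjointUnion

variable {m : ℕ} {G G' : ℕ → Facts}

theorem mem_dunion {R : ℕ} {t : List ℕ} :
    (R, t) ∈ dunion m G ↔ ∃ l < m, ∃ s, (R, s) ∈ G l ∧ t = s.map (Nat.pair l) := by
  simp only [dunion, List.mem_flatMap, List.mem_range, List.mem_map, Prod.mk.injEq]
  constructor
  · rintro ⟨l, hl, ⟨R', s⟩, hf, rfl, rfl⟩
    exact ⟨l, hl, s, hf, rfl⟩
  · rintro ⟨l, hl, s, hf, rfl⟩
    exact ⟨l, hl, (R, s), hf, rfl, rfl⟩

theorem within_of_within_dunion {k z z' : ℕ} (h : Within (dunion m G) k z z') :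
    z'.unpair.1 = z.unpair.1 ∧ Within (G z.unpair.1) k z.unpair.2 z'.unpair.2 := by
  induction k generalizing z' with
  | zero => obtain rfl : z = z' := h; exact ⟨rfl, rfl⟩
  | succ k ih =>
    rcases h with h | ⟨y, h, f, hf, hy, hz⟩
    · exact ⟨(ih h).1, Or.inl (ih h).2⟩
    · obtain ⟨h1, h2⟩ := ih h
      obtain ⟨l, hl, s, hs, hfs⟩ := mem_dunion.1 (show (f.1, f.2) ∈ _ from hf)
      rw [hfs, List.mem_map] at hy hz
      obtain ⟨y, hy, rfl⟩ := hy
      obtain ⟨x, hx, rfl⟩ := hz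
      simp only [Nat.unpair_pair] at h1 h2 ⊢
      subst h1
      exact ⟨rfl, Or.inr ⟨y, h2, (f.1, s), hs, hy, hx⟩⟩

theorem within_dunion {k l x x' : ℕ} (hl : l < m) (h : Within (G l) k x x') :
    Within (dunion m G) k (Nat.pair l x) (Nat.pair l x') := by
  induction k generalizing x' with
  | zero => obtain rfl : x = x' := h; rfl
  | succ k ih =>
    rcases h with h | ⟨y, h, f, hf, hy, hz⟩
    · exact Or.inl (ih h)
    · exact Or.inr ⟨_, ih h, (f.1, f.2.map (Nat.pair l)),
        mem_dunion.2 ⟨l, hl, f.2, hf, rfl⟩, List.mem_map_of_mem hy, List.mem_map_of_mem hz⟩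

/-- Local isomorphisms of the parts of a disjoint union combine. -/
theorem PIso.dunion {r a R : ℕ} {ρ ρ' : ℕ → List ℕ} {h h' : ℕ → ℕ → ℕ}
    (P : ∀ l < m, PIso R (G l) (ρ l) (G' l) (ρ' l) (h l) (h' l)) {C : List ℕ}
    (hC : ∀ z ∈ C, z.unpair.1 < m ∧ Near (G z.unpair.1) a (ρ z.unpair.1) z.unpair.2)
    (hr : a + r ≤ R) :
    PIso r (dunion m G) C (FOCN.dunion m G')
      (C.map fun z => Nat.pair z.unpair.1 (h z.unpair.1 z.unpair.2))
      (fun z => Nat.pair z.unpair.1 (h z.unpair.1 z.unpair.2))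
      (fun z => Nat.pair z.unpair.1 (h' z.unpair.1 z.unpair.2)) := by
  -- An element near `C` lies in the copy of some centre and within `a + r ≤ R` of the roots of this
  -- copy, hence in the domain of the isomorphism given for the copy.
  have key : ∀ z, Near (FOCN.dunion m G) r C z →
      z.unpair.1 < m ∧ Near (G z.unpair.1) R (ρ z.unpair.1) z.unpair.2 := by
    rintro z ⟨y, hy, hz⟩
    obtain ⟨h1, h2⟩ := within_of_within_dunion hz
    obtain ⟨h3, h4⟩ := hC y hy
    rw [h1]
    exact ⟨h3, near_mono (near_within h4 h2) hr⟩
  refine ⟨fun z hz => ⟨?_, ?_⟩, fun z hz => ?_, fun S t ht => ?_, rfl⟩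
  · obtain ⟨y, hy, hz⟩ := hz
    obtain ⟨h1, h2⟩ := within_of_within_dunion hz
    obtain ⟨h3, h4⟩ := hC y hy
    refine ⟨_, List.mem_map_of_mem hy, ?_⟩
    rw [h1]
    exact within_dunion h3 ((P _ h3).within h4 h2 hr)
  · obtain ⟨h1, h2⟩ := key z hz
    simp only [Nat.unpair_pair, ((P _ h1).maps _ h2).2, Nat.pair_unpair]
  · obtain ⟨y, hy, hz⟩ := hz
    obtain ⟨x, hx, rfl⟩ := List.mem_map.1 hy
    obtain ⟨h1, h2⟩ := within_of_within_dunion hz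
    simp only [Nat.unpair_pair] at h1 h2
    obtain ⟨h3, h4⟩ := hC x hx
    have h5 := (P _ h3).near h4 (by omega)
    have h6 := (P _ h3).symm.within h5 h2 hr
    rw [((P _ h3).maps _ (near_mono h4 (by omega))).2] at h6
    constructor
    · refine ⟨x, hx, ?_⟩
      have h7 := within_dunion h3 h6
      rwa [Nat.pair_unpair, ← h1] at h7
    · simp only [Nat.unpair_pair]
      have h7 := ((P _ h3).maps' _ (near_mono (near_within h5 h2) hr)).2
      rw [h1, h7, ← h1, Nat.pair_unpair]
  · constructor
    · intro hm
      obtain ⟨l, hl, s, hs, rfl⟩ := mem_dunion.1 hm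
      refine mem_dunion.2 ⟨l, hl, s.map (h l), ?_, by simp [Function.comp_def]⟩
      refine ((P l hl).facts S s fun u hu => ?_).1 hs
      have := (key _ (ht _ (List.mem_map_of_mem hu))).2
      simpa using this
    · intro hm
      obtain ⟨l, hl, s, hs, hts⟩ := mem_dunion.1 hm
      -- The combined map keeps copy numbers, and a fact of the union lives in one copy; so its
      -- preimage tuple lives in that copy too.
      have h1 : ∀ u ∈ t, u.unpair.1 = l := by
        intro u hu
        have := List.mem_map_of_mem (f := fun z => Nat.pair z.unpair.1
          (h z.unpair.1 z.unpair.2)) hu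
        rw [hts] at this
        obtain ⟨x, -, hx⟩ := List.mem_map.1 this
        have := congrArg (fun z => z.unpair.1) hx
        simpa using this.symm
      have h2 : (t.map fun u => u.unpair.2).map (h l) = s := by
        have := congrArg (List.map fun z => z.unpair.2) hts
        simp only [List.map_map, Function.comp_def, Nat.unpair_pair, List.map_id'] at this
        rw [← this, List.map_map]
        exact List.map_congr_left fun u hu => by simp [h1 u hu]
      refine mem_dunion.2 ⟨l, hl, t.map fun u => u.unpair.2, ?_, ?_⟩
      · refine ((P l hl).facts S _ fun u hu => ?_).2 (h2 ▸ hs)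
        obtain ⟨x, hx, rfl⟩ := List.mem_map.1 hu
        have := (key _ (ht _ hx)).2
        rwa [h1 x hx] at this
      · rw [List.map_map]
        conv_lhs => rw [← List.map_id t]
        exact List.map_congr_left fun u hu => by simp [← h1 u hu]

/-- Far apart clusters may be moved to different copies of the structure. -/
theorem exists_piso_dunion_const {r : ℕ} (F : Facts) (hm : 0 < m) {D : List (ℕ × ℕ)}
    (hD : ∀ p ∈ D, p.1 < m)
    (hfar : ∀ p ∈ D, ∀ p' ∈ D, Within F (2 * r + 1) p.2 p'.2 → p.1 = p'.1) :
    ∃ h h', PIso r F (D.map fun p => p.2) (dunion m fun _ => F)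
      (D.map fun p => Nat.pair p.1 p.2) h h' := by
  classical
  -- The copy number of some centre within `r` of `v`. The choice is immaterial: two such centres
  -- are within `2r` of each other, so `hfar` gives them the same number.
  let lbl : ℕ → ℕ := fun v => if hv : ∃ p ∈ D, Within F r p.2 v then hv.choose.1 else 0
  have hlbl : ∀ p ∈ D, ∀ v, Within F r p.2 v → lbl v = p.1 := by
    intro p hp v hv
    have hex : ∃ p ∈ D, Within F r p.2 v := ⟨p, hp, hv⟩
    have h1 : lbl v = hex.choose.1 := dif_pos hex
    rw [h1]
    exact hfar _ hex.choose_spec.1 p hp (within_mono (within_trans hex.choose_spec.2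
      (within_symm hv)) (by omega))
  have hnear : ∀ v, Near F r (D.map fun p => p.2) v → ∃ p ∈ D, Within F r p.2 v := by
    rintro v ⟨x, hx, hv⟩
    obtain ⟨p, hp, rfl⟩ := List.mem_map.1 hx
    exact ⟨p, hp, hv⟩
  refine ⟨fun v => Nat.pair (lbl v) v, fun z => z.unpair.2, fun v hv => ⟨?_, by simp⟩,
    fun z hz => ?_, fun S t ht => ?_, ?_⟩
  · obtain ⟨p, hp, hv⟩ := hnear v hv
    refine ⟨_, List.mem_map_of_mem hp, ?_⟩
    rw [hlbl p hp v hv]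
    exact within_dunion (G := fun _ => F) (hD p hp) hv
  · obtain ⟨x, hx, hz⟩ := hz
    obtain ⟨p, hp, rfl⟩ := List.mem_map.1 hx
    obtain ⟨h1, h2⟩ := within_of_within_dunion hz
    simp only [Nat.unpair_pair] at h1 h2
    exact ⟨⟨p.2, List.mem_map_of_mem hp, h2⟩, by
      rw [hlbl p hp _ h2, ← h1, Nat.pair_unpair]⟩
  · constructor
    · intro hm'
      rcases t with _ | ⟨u, t⟩
      -- A fact without arguments has no label; it is found in the copy 0, which exists because `0 <
      -- m`.
      · exact mem_dunion.2 ⟨0, hm, [], hm', rfl⟩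
      · obtain ⟨p, hp, hu⟩ := hnear u (ht u (by simp))
        refine mem_dunion.2 ⟨p.1, hD p hp, u :: t, hm', ?_⟩
        refine List.map_congr_left fun x hx => ?_
        obtain ⟨p', hp', hx'⟩ := hnear x (ht x hx)
        -- Two elements of one fact have centres at distance at most `r + 1 + r`. This is why
        -- clusters are separated at `2r + 1` and not at `2r`.
        have h1 : Within F 1 u x := within_of_adj ⟨_, hm', by simp, hx⟩
        have h2 := hfar p hp p' hp' (within_mono (within_trans (within_trans hu h1)
          (within_symm hx')) (by omega))
        rw [hlbl p' hp' x hx', h2]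
    · intro hm'
      obtain ⟨l, hl, s, hs, hts⟩ := mem_dunion.1 hm'
      have := congrArg (List.map fun z => z.unpair.2) hts
      simp only [List.map_map, Function.comp_def, Nat.unpair_pair, List.map_id'] at this
      rwa [this]
  · rw [List.map_map]
    refine List.map_congr_left fun p hp => ?_
    simp only [Function.comp_apply]
    rw [hlbl p hp p.2 (within_refl F r _)]

end DisjointUnion

end FOCN

namespace FOCN

/-! ### Enumerations -/

section Enumerations

variable {α β κ ι : Type*}

/-- All lists whose entries are chosen from the given lists of options. -/
def prodList (Os : List (List α)) : List (List α) :=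
  Os.foldr (fun O acc => O.flatMap fun x => acc.map fun l => x :: l) [[]]

theorem prodList_nil : prodList ([] : List (List α)) = [[]] := rfl

theorem prodList_cons (O : List α) (Os : List (List α)) :
    prodList (O :: Os) = O.flatMap fun x => (prodList Os).map fun l => x :: l := rfl

theorem mem_prodList {Os : List (List α)} {l : List α} :
    l ∈ prodList Os ↔ List.Forall₂ (· ∈ ·) l Os := by
  induction Os generalizing l with
  | nil => simp [prodList_nil]
  | cons O Os ih =>
    simp only [prodList_cons, List.mem_flatMap, List.mem_map, ih]
    cases l with
    | nil => simp
    | cons x l => simp [List.forall₂_cons]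

theorem nodup_prodList {Os : List (List α)} (h : ∀ O ∈ Os, O.Nodup) : (prodList Os).Nodup := by
  induction Os with
  | nil => simp [prodList_nil]
  | cons O Os ih =>
    rw [prodList_cons, List.nodup_flatMap]
    refine ⟨fun x _ => (ih fun O' hO' => h O' (by simp [hO'])).map fun a b hab => by simpa using hab,
      (h O (by simp)).imp ?_⟩
    intro x y hxy l h1 h2
    simp only [List.mem_map] at h1 h2
    obtain ⟨l1, -, rfl⟩ := h1
    obtain ⟨l2, -, h3⟩ := h2
    exact hxy (by simp_all)

theorem getD_map_range (f : ℕ → α) (d : α) {n i : ℕ} (hi : i < n) :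
    ((List.range n).map f).getD i d = f i := by
  simp [List.getD_eq_getElem?_getD, hi]

theorem mem_prodList_range {n : ℕ} {O : ℕ → List α} {l : List α} (d : α) :
    l ∈ prodList ((List.range n).map O) ↔ l.length = n ∧ ∀ i < n, l.getD i d ∈ O i := by
  rw [mem_prodList, List.forall₂_iff_get]
  simp only [List.length_map, List.length_range, List.get_eq_getElem, List.getElem_map,
    List.getElem_range]
  refine and_congr_right fun h => ⟨fun H i hi => ?_, fun H i h1 _ => ?_⟩
  · rw [List.getD_eq_getElem _ _ (h ▸ hi)]
    exact H i (h ▸ hi) hi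
  · have := H i (h ▸ h1)
    rwa [List.getD_eq_getElem _ _ h1] at this

theorem zipWith_range (f : ℕ → α → β) (d : α) {n : ℕ} {l : List α} (hl : l.length = n) :
    List.zipWith f (List.range n) l = (List.range n).map fun i => f i (l.getD i d) := by
  refine List.ext_getElem (by simp [hl]) fun i h1 h2 => ?_
  have h3 : i < l.length := by simp at h1; omega
  simp [List.getElem_zipWith, List.getElem?_eq_getElem h3]

theorem sum_map_flatMap (l : List α) (f : α → List β) (g : β → ℤ) :
    ((l.flatMap f).map g).sum = (l.map fun x => ((f x).map g).sum).sum := by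
  induction l with
  | nil => rfl
  | cons x l ih => simp [ih]

theorem sum_prodList_cons (O : List α) (Os : List (List α)) (g : List α → ℤ) :
    ((prodList (O :: Os)).map g).sum =
      (O.map fun x => ((prodList Os).map fun l => g (x :: l)).sum).sum := by
  rw [prodList_cons, sum_map_flatMap]
  simp [Function.comp_def]

theorem sum_map_congr {l : List α} {f g : α → ℤ} (h : ∀ x ∈ l, f x = g x) :
    (l.map f).sum = (l.map g).sum := by
  rw [List.map_congr_left h]

theorem sum_map_swap (l : List α) (m : List β) (f : α → β → ℤ) :
    (l.map fun x => (m.map fun y => f x y).sum).sum =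
      (m.map fun y => (l.map fun x => f x y).sum).sum := by
  induction l with
  | nil => simp
  | cons x l ih => simp [ih]

/-- Splitting each option list of a product refines the sum over the product. -/
theorem sum_prodList_split (is : List ι) (O : ι → List α) (U : ι → List β)
    (V : ι → β → List α)
    (h : ∀ i ∈ is, ∀ g : α → ℤ,
      ((O i).map g).sum = ((U i).map fun u => ((V i u).map g).sum).sum) (g : List α → ℤ) :
    ((prodList (is.map O)).map g).sum =
      ((prodList (is.map U)).map fun u =>
        ((prodList (List.zipWith V is u)).map g).sum).sum := by
  induction is generalizing g with
  | nil => simp [prodList_nil]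
  | cons i is ih =>
    simp only [List.map_cons, sum_prodList_cons, List.zipWith_cons_cons]
    rw [h i (by simp)]
    refine sum_map_congr fun u _ => ?_
    simp only [ih fun j hj => h j (by simp [hj])]
    rw [sum_map_swap]

/-- Grouping the options of a product by their kind. -/
theorem sum_prodList_weight (is : List ι) (U : ι → List β) (T : ι → List κ) (kind : ι → β → κ)
    (w : ι → κ → ℤ)
    (h : ∀ i ∈ is, ∀ g : κ → ℤ,
      ((U i).map fun u => g (kind i u)).sum = ((T i).map fun t => w i t * g t).sum)
    (g : List κ → ℤ) :
    ((prodList (is.map U)).map fun u => g (List.zipWith kind is u)).sum =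
      ((prodList (is.map T)).map fun t => (List.zipWith w is t).prod * g t).sum := by
  induction is generalizing g with
  | nil => simp [prodList_nil]
  | cons i is ih =>
    simp only [List.map_cons, sum_prodList_cons, List.zipWith_cons_cons, List.prod_cons]
    have h1 := h i (by simp) fun t =>
      ((prodList (is.map U)).map fun l => g (t :: List.zipWith kind is l)).sum
    rw [h1]
    refine sum_map_congr fun t _ => ?_
    rw [ih (fun j hj => h j (by simp [hj])) fun l => g (t :: l), ← List.sum_map_mul_left]
    simp only [mul_assoc]

/-- A weight-preserving bijection between the non-zero parts of two sums. -/
theorem sum_map_bij {l : List α} {m : List β} (hl : l.Nodup) (hm : m.Nodup) {p : α → Prop}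
    {q : β → Prop} [DecidablePred p] [DecidablePred q] {f : α → ℤ} {g : β → ℤ} (i : α → β)
    (j : β → α) (hi : ∀ a ∈ l, p a → i a ∈ m ∧ q (i a) ∧ j (i a) = a ∧ f a = g (i a))
    (hj : ∀ b ∈ m, q b → j b ∈ l ∧ p (j b) ∧ i (j b) = b) :
    (l.map fun a => if p a then f a else 0).sum = (m.map fun b => if q b then g b else 0).sum := by
  classical
  rw [← List.sum_toFinset _ hl, ← List.sum_toFinset _ hm, ← Finset.sum_filter,
    ← Finset.sum_filter]
  refine Finset.sum_bij' (fun a _ => i a) (fun b _ => j b) ?_ ?_ ?_ ?_ ?_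
  · intro a ha
    simp only [Finset.mem_filter, List.mem_toFinset] at ha ⊢
    exact ⟨(hi a ha.1 ha.2).1, (hi a ha.1 ha.2).2.1⟩
  · intro b hb
    simp only [Finset.mem_filter, List.mem_toFinset] at hb ⊢
    exact ⟨(hj b hb.1 hb.2).1, (hj b hb.1 hb.2).2.1⟩
  · intro a ha
    simp only [Finset.mem_filter, List.mem_toFinset] at ha
    exact (hi a ha.1 ha.2).2.2.1
  · intro b hb
    simp only [Finset.mem_filter, List.mem_toFinset] at hb
    exact (hj b hb.1 hb.2).2.2
  · intro a ha
    simp only [Finset.mem_filter, List.mem_toFinset] at ha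
    exact (hi a ha.1 ha.2).2.2.2

/-- The sign denoted by a Boolean. -/
def sgn (b : Bool) : ℤ := bif b then 1 else -1

/-- All pairs `(E, H)` of sublists with `H ⊆ E`, together with the parity of `|E| - |H|`. -/
def signed (l : List α) : List (Bool × List α × List α) :=
  l.foldr (fun p acc => acc.flatMap fun x =>
    [x, (!x.1, p :: x.2.1, x.2.2), (x.1, p :: x.2.1, p :: x.2.2)]) [(true, [], [])]

theorem signed_cons (p : α) (l : List α) :
    signed (p :: l) = (signed l).flatMap fun x =>
      [x, (!x.1, p :: x.2.1, x.2.2), (x.1, p :: x.2.1, p :: x.2.2)] := rfl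

/-- Möbius inversion over subsets: if `K` consists of the entries with property `P`, the sum runs
over H ⊆ E ⊆ K, and the alternating sum over E vanishes unless H = K. An exact condition is thereby
replaced by the monotone conditions E ⊆ K. -/
theorem sum_signed (l : List α) (P : α → Prop) [DecidablePred P] (f : List α → ℤ) :
    ((signed l).map fun x => if ∀ p ∈ x.2.1, P p then sgn x.1 * f x.2.2 else 0).sum =
      f (l.filter fun p => decide (P p)) := by
  induction l generalizing f with
  | nil => simp [signed, sgn]
  | cons p l ih =>
    rw [signed_cons, sum_map_flatMap]
    by_cases hp : P p
    -- "`p` not in E" and "`p` in E only" have the same H and opposite signs; what survives is "`p`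
    -- in both".
    · rw [List.filter_cons_of_pos (by simpa using hp), ← ih fun H => f (p :: H)]
      refine sum_map_congr fun x _ => ?_
      simp only [List.map_cons, List.map_nil, List.sum_cons, List.sum_nil, List.mem_cons,
        forall_eq_or_imp, hp, true_and]
      split_ifs
      · cases x.1 <;> simp [sgn]
      · simp
    · rw [List.filter_cons_of_neg (by simpa using hp), ← ih f]
      refine sum_map_congr fun x _ => ?_
      simp [hp]

theorem signed_subset {l : List α} {x : Bool × List α × List α} (hx : x ∈ signed l) :
    x.2.2 ⊆ x.2.1 ∧ x.2.1 ⊆ l := by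
  induction l generalizing x with
  | nil => simp [signed] at hx; simp [hx]
  | cons p l ih =>
    rw [signed_cons, List.mem_flatMap] at hx
    obtain ⟨y, hy, hx⟩ := hx
    obtain ⟨h1, h2⟩ := ih hy
    simp only [List.mem_cons, List.not_mem_nil, or_false] at hx
    rcases hx with rfl | rfl | rfl
    · exact ⟨h1, List.subset_cons_of_subset _ h2⟩
    · exact ⟨List.subset_cons_of_subset _ h1, List.cons_subset_cons _ h2⟩
    · exact ⟨List.cons_subset_cons _ h1, List.cons_subset_cons _ h2⟩

end Enumerations

/-! ### Connected components of graphs on `{0, …, n}` -/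

/-- Replace the labels `a` and `b` by the smaller one of them. -/
def relabel (a b x : ℕ) : ℕ := bif x == a || x == b then min a b else x

theorem relabel_eq (a b x : ℕ) : relabel a b x = if x = a ∨ x = b then min a b else x := by
  simp [relabel, Bool.cond_eq_ite]

/-- The list that contains at position `i ≤ n` the smallest element of the connected component
of `i` in the graph with edge list `E`. -/
def labs (n : ℕ) (E : List (ℕ × ℕ)) : List ℕ :=
  E.foldr (fun p L => L.map (relabel (L.getD p.1 0) (L.getD p.2 0))) (List.range (n + 1))

/-- The smallest element of the connected component of `k`. -/
def lab (n : ℕ) (E : List (ℕ × ℕ)) (k : ℕ) : ℕ := (labs n E).getD k 0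

section Labels

variable {n : ℕ} {E : List (ℕ × ℕ)}

theorem lab_nil {k : ℕ} (hk : k ≤ n) : lab n [] k = k := by
  have : k < n + 1 := by omega
  simp [lab, labs, this]

theorem lab_cons (p : ℕ × ℕ) (k : ℕ) :
    lab n (p :: E) k = relabel (lab n E p.1) (lab n E p.2) (lab n E k) := by
  -- Relabelling fixes 0, the default value of `getD`, so the equation also holds for positions
  -- beyond the end of the list.
  have h0 : relabel (lab n E p.1) (lab n E p.2) 0 = 0 := by
    rw [relabel_eq]; split_ifs with h
    · rcases h with h | h <;> simp [← h]
    · rfl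
  change ((labs n E).map (relabel (lab n E p.1) (lab n E p.2))).getD k 0 = _
  conv_lhs => rw [← h0]
  rw [List.getD_map]
  rfl

theorem lab_le (k : ℕ) : lab n E k ≤ k := by
  induction E with
  | nil =>
    by_cases hk : k < n + 1
    · rw [lab_nil (by omega)]
    · simp [lab, labs, hk]
  | cons p E ih =>
    rw [lab_cons, relabel_eq]
    split_ifs with h
    · rcases h with h | h
      · exact (min_le_left _ _).trans (h ▸ ih)
      · exact (min_le_right _ _).trans (h ▸ ih)
    · exact ih

theorem lab_zero : lab n E 0 = 0 := Nat.le_zero.1 (lab_le 0)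

theorem lab_edge {p : ℕ × ℕ} (hp : p ∈ E) : lab n E p.1 = lab n E p.2 := by
  induction E with
  | nil => simp at hp
  | cons q E ih =>
    simp only [lab_cons, relabel_eq]
    rcases List.mem_cons.1 hp with rfl | hp
    · simp
    · rw [ih hp]

/-- The label of `k` lies in the component of `k`, and `g` is constant along edges. With `g` the
labelling of a larger graph, this compares the components of two graphs. -/
theorem lab_const {γ : Type*} (g : ℕ → γ) (hE : ∀ p ∈ E, p.1 ≤ n ∧ p.2 ≤ n)
    (hg : ∀ p ∈ E, g p.1 = g p.2) {k : ℕ} (hk : k ≤ n) : g (lab n E k) = g k := by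
  induction E generalizing k with
  | nil => rw [lab_nil hk]
  | cons p E ih =>
    have ih' := fun {k} => ih (k := k) (fun q hq => hE q (by simp [hq]))
      (fun q hq => hg q (by simp [hq]))
    have h1 := ih' (hE p (by simp)).1
    have h2 := ih' (hE p (by simp)).2
    have h3 := hg p (by simp)
    rw [lab_cons, relabel_eq]
    split_ifs with h
    · have h4 : g (lab n E k) = g p.1 := by
        rcases h with h | h
        · rw [h, h1]
        · rw [h, h2, h3]
      rw [← ih' hk, h4]
      rcases min_choice (lab n E p.1) (lab n E p.2) with h | h <;> rw [h]
      · exact h1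
      · rw [h2, h3]
    · exact ih' hk

theorem lab_lab (hE : ∀ p ∈ E, p.1 ≤ n ∧ p.2 ≤ n) {k : ℕ} (hk : k ≤ n) :
    lab n E (lab n E k) = lab n E k :=
  lab_const (lab n E) hE (fun _ hp => lab_edge hp) hk

/-- The edges of a graph as facts. -/
def edgeFacts (E : List (ℕ × ℕ)) : Facts := E.map fun p => (0, [p.1, p.2])

theorem within_edgeFacts_mono {E' : List (ℕ × ℕ)} (h : E ⊆ E') {r i j : ℕ}
    (hij : Within (edgeFacts E) r i j) : Within (edgeFacts E') r i j := by
  induction r generalizing j with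
  | zero => exact hij
  | succ r ih =>
    rcases hij with hij | ⟨m, hij, f, hf, hm⟩
    · exact Or.inl (ih hij)
    · exact Or.inr ⟨m, ih hij, f, List.map_subset _ h hf, hm⟩

/-- A component with m vertices has diameter at most m - 1, and m ≤ n + 1. This bounds the extent of
a cluster by n edges. -/
theorem within_edgeFacts_of_lab_eq {i j : ℕ} (hE : ∀ p ∈ E, p.1 ≤ n ∧ p.2 ≤ n) (hi : i ≤ n)
    (hj : j ≤ n) (hij : lab n E i = lab n E j) : Within (edgeFacts E) n i j := by
  suffices h : Within (edgeFacts E)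
      (((Finset.range (n + 1)).filter fun k => lab n E k = lab n E i).card - 1) i j by
    refine within_mono h ?_
    have := Finset.card_filter_le (Finset.range (n + 1)) fun k => lab n E k = lab n E i
    rw [Finset.card_range] at this
    omega
  induction E generalizing i j with
  | nil =>
    rw [lab_nil hi, lab_nil hj] at hij
    subst hij
    exact within_refl _ _ _
  | cons p E ih =>
    have ih' := fun {i j} => ih (i := i) (j := j) (fun q hq => hE q (by simp [hq]))
    have hp := hE p (by simp)
    have hsub : ∀ {r i j}, Within (edgeFacts E) r i j → Within (edgeFacts (p :: E)) r i j :=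
      fun h => within_edgeFacts_mono (List.subset_cons_self p E) h
    have hedge : Within (edgeFacts (p :: E)) 1 p.1 p.2 :=
      within_of_adj ⟨(0, [p.1, p.2]), by simp [edgeFacts], by simp, by simp⟩
    set C : ℕ → Finset ℕ := fun a => (Finset.range (n + 1)).filter fun k => lab n E k = a with hC
    have hC1 : ∀ k ≤ n, 1 ≤ (C (lab n E k)).card := fun k hk =>
      Finset.card_pos.2 ⟨k, by simp [hC]; omega⟩
    by_cases hx : lab n E i = lab n E j
    · refine within_mono (hsub (ih' hi hj hx)) (Nat.sub_le_sub_right (Finset.card_le_card ?_) 1)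
      intro k
      simp only [Finset.mem_filter, lab_cons]
      exact fun hk => ⟨hk.1, by rw [hk.2]⟩
    · have h1 : lab n (p :: E) i = min (lab n E p.1) (lab n E p.2) ∧
          (lab n E i = lab n E p.1 ∧ lab n E j = lab n E p.2 ∨
            lab n E i = lab n E p.2 ∧ lab n E j = lab n E p.1) := by
        simp only [lab_cons, relabel_eq] at hij ⊢
        rcases min_choice (lab n E p.1) (lab n E p.2) with h | h <;> rw [h] at hij ⊢ <;>
          split_ifs at hij ⊢ <;> omega
      -- The new edge joins two disjoint components. If they have a and b vertices, the path has
      -- length at most (a - 1) + 1 + (b - 1) = (a + b) - 1.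
      have h2 : (C (lab n E p.1)).card + (C (lab n E p.2)).card ≤
          ((Finset.range (n + 1)).filter fun k =>
            lab n (p :: E) k = lab n (p :: E) i).card := by
        rw [← Finset.card_union_of_disjoint]
        · refine Finset.card_le_card fun k hk => ?_
          simp only [hC, Finset.mem_union, Finset.mem_filter] at hk
          rw [h1.1]
          simp only [Finset.mem_filter, lab_cons, relabel_eq]
          rcases hk with hk | hk <;> simp [hk]
        · rw [Finset.disjoint_left]
          intro k hk hk'
          simp only [hC, Finset.mem_filter] at hk hk'
          omega
      have h3 := hC1 p.1 hp.1
      have h4 := hC1 p.2 hp.2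
      rcases h1.2 with ⟨h5, h6⟩ | ⟨h5, h6⟩
      · have h7 := ih' hi hp.1 h5
        have h8 := ih' hp.2 hj h6.symm
        rw [h5] at h7
        exact within_mono (within_trans (within_trans (hsub h7) hedge) (hsub h8))
          (by change (C (lab n E p.1)).card - 1 + 1 + ((C (lab n E p.2)).card - 1) ≤ _; omega)
      · have h7 := ih' hi hp.2 h5
        have h8 := ih' hp.1 hj h6.symm
        rw [h5] at h7
        exact within_mono (within_trans (within_trans (hsub h7) (within_symm hedge)) (hsub h8))
          (by change (C (lab n E p.2)).card - 1 + 1 + ((C (lab n E p.1)).card - 1) ≤ _; omega)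

end Labels

end FOCN

namespace FOCN

/-! ### Sums over clusters -/

/-- The elements at position `i`: position `0` is taken by the tuple `c`, position `i + 1` by the
`i`-th entry of `e`. -/
def posAt (c e : List ℕ) (i : ℕ) : List ℕ := (c :: e.map fun x => [x]).getD i []

theorem posAt_zero (c e : List ℕ) : posAt c e 0 = c := rfl

theorem posAt_succ (c : List ℕ) {e : List ℕ} {i : ℕ} (hi : i < e.length) :
    posAt c e (i + 1) = [e.getD i 0] := by
  simp [posAt, hi]

/-- Some element of `Q` has distance at most `s` from some element of `P`. -/
def closeTo (F : Facts) (s : ℕ) (P Q : List ℕ) : Bool :=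
  Q.any fun v => (ball F P s).any fun u => u == v

theorem closeTo_iff {F : Facts} {s : ℕ} {P Q : List ℕ} :
    closeTo F s P Q = true ↔ ∃ v ∈ Q, Near F s P v := by
  simp [closeTo, mem_ball]

/-- All edges of `E` join positions that are close to each other. -/
def allClose (fams : ℕ → Facts) (n s : ℕ) (E : List (ℕ × ℕ)) (c e : List ℕ) : Bool :=
  E.all fun p => closeTo (fams (lab n E p.1)) s (posAt c e p.1) (posAt c e p.2)

/-- The tuple `e` with its entries moved to the copies given by the components of `H`, followed
by the tuple `c` in the copy number `0`. -/
def placed (n : ℕ) (H : List (ℕ × ℕ)) (c e : List ℕ) : List ℕ :=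
  ((List.range n).map fun i => Nat.pair (lab n H (i + 1)) (e.getD i 0)) ++ c.map (Nat.pair 0)

/-- The options for the `i`-th entry: the root if `i + 1` is the label of its component, and
everything below `B` otherwise. -/
def entryOptions (roots : ℕ → List ℕ) (n B : ℕ) (E : List (ℕ × ℕ)) (i : ℕ) : List ℕ :=
  bif lab n E (i + 1) == i + 1 then roots (i + 1) else List.range B

/-- The disjoint union of the structures chosen for the components of `E`, one copy for every
position. -/
def spread (fams : ℕ → Facts) (n : ℕ) (E : List (ℕ × ℕ)) : Facts :=
  dunion (n + 1) fun l => fams (lab n E l)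

/-- The sum of the values of `γ` over all placements that respect the edges of `E`. -/
def clusterSum (γ : Facts → List ℕ → ℤ) (fams : ℕ → Facts) (roots : ℕ → List ℕ)
    (n s B : ℕ) (E H : List (ℕ × ℕ)) : ℤ :=
  ((prodList ((List.range n).map (entryOptions roots n B E))).map fun e =>
    if allClose fams n s E (roots 0) e then
      γ (spread fams n E) (placed n H (roots 0) e) else 0).sum

/-! ### Cluster sums depend only on the spheres of the roots. -/

section Transfer

variable {fams fams' : ℕ → Facts} {roots roots' : ℕ → List ℕ} {n r R B B' : ℕ}
  {E H : List (ℕ × ℕ)} {h h' : ℕ → ℕ → ℕ}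

/-- The image of a tuple under the local isomorphisms belonging to the components. -/
def transferTuple (n : ℕ) (E : List (ℕ × ℕ)) (h : ℕ → ℕ → ℕ) (e : List ℕ) : List ℕ :=
  (List.range n).map fun i => h (lab n E (i + 1)) (e.getD i 0)

/-- A path of at most `n` edges of `E` leads from the root position to `i`, and each edge spans a
distance of at most `s`. -/
theorem near_root (hE : ∀ p ∈ E, p.1 ≤ n ∧ p.2 ≤ n) {s : ℕ} {e : List ℕ}
    (he : e ∈ prodList ((List.range n).map (entryOptions roots n B E)))
    (hc : allClose fams n s E (roots 0) e = true) {i : ℕ} (hi : i ≤ n) :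
    ∀ x ∈ posAt (roots 0) e i, Near (fams (lab n E i)) (n * s) (roots (lab n E i)) x := by
  rw [mem_prodList_range 0] at he
  obtain ⟨hlen, he⟩ := he
  have hpos : ∀ j ≤ n, j ≠ 0 → posAt (roots 0) e j = [e.getD (j - 1) 0] := by
    intro j hj hj0
    obtain ⟨j, rfl⟩ := Nat.exists_eq_succ_of_ne_zero hj0
    exact posAt_succ _ (by omega)
  have hw := within_edgeFacts_of_lab_eq hE ((lab_le i).trans hi) hi (lab_lab hE hi)
  set l := lab n E i with hl
  have hll : lab n E l = l := lab_lab hE hi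
  have hln : l ≤ n := (lab_le i).trans hi
  suffices hs : ∀ m j, Within (edgeFacts E) m l j →
      lab n E j = l ∧ ∀ x ∈ posAt (roots 0) e j, Near (fams l) (m * s) (roots l) x from
    (hs n i hw).2
  -- The entries of the tuple at position 0 may be far from each other, so a path through position 0
  -- would not bound distances. But in its component this tuple is itself the root, and the distance
  -- restarts at 0.
  have hzero : ∀ m, lab n E 0 = l → ∀ x ∈ posAt (roots 0) e 0, Near (fams l) m (roots l) x := by
    intro m h0 x hx
    rw [lab_zero] at h0
    rw [posAt_zero] at hx
    rw [← h0]
    exact near_of_mem hx m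
  intro m
  induction m with
  | zero =>
    rintro j rfl
    refine ⟨hll, fun x hx => ?_⟩
    by_cases hl0 : l = 0
    · rw [hl0] at hx
      exact hzero _ (by rw [hl0, lab_zero]) x hx
    · rw [hpos l hln hl0, List.mem_singleton] at hx
      have h1 := he (l - 1) (by omega)
      have h2 : l - 1 + 1 = l := by omega
      rw [entryOptions, h2, hll, beq_self_eq_true, cond_true] at h1
      exact near_of_mem (hx ▸ h1) _
  | succ m ih =>
    rintro j (hj | ⟨k, hk, f, hf, hkf, hjf⟩)
    · exact ⟨(ih j hj).1, fun x hx => near_mono ((ih j hj).2 x hx) (by gcongr; omega)⟩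
    · obtain ⟨p, hp, rfl⟩ := List.mem_map.1 hf
      obtain ⟨h1, h2⟩ := ih k hk
      have h3 := lab_edge (n := n) hp
      have h4 := closeTo_iff.1 (List.all_eq_true.1 hc p hp)
      have hpn := hE p hp
      obtain ⟨v, hv, u, hu, huv⟩ := h4
      simp only [List.mem_cons, List.not_mem_nil, or_false] at hkf hjf
      have hlab : lab n E j = l := by
        rcases hkf with rfl | rfl <;> rcases hjf with rfl | rfl <;> omega
      refine ⟨hlab, fun x hx => ?_⟩
      by_cases hj0 : j = 0
      · subst hj0
        exact hzero _ hlab x hx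
      · by_cases hjk : j = k
        · subst hjk
          exact near_mono (h2 x hx) (by gcongr; omega)
        · rw [show (m + 1) * s = m * s + s by ring]
          rcases hkf with rfl | rfl <;> rcases hjf with rfl | rfl
          · exact absurd rfl hjk
          · rw [hpos _ hpn.2 hj0, List.mem_singleton] at hx hv
            rw [h1] at huv
            rw [hx, ← hv]
            exact near_within (h2 u hu) huv
          · rw [hpos _ hpn.1 hj0, List.mem_singleton] at hx hu
            rw [hlab] at huv
            rw [hx, ← hu]
            exact near_within (h2 v hv) (within_symm huv)
          · exact absurd rfl hjk

/-- A cluster extends to `n * (2 * r + 1)` from its root. Another `r` covers the spheres that `γ`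
depends on, and `r + 1` the longer half of a walk of length `2 * r + 1` between close elements.
Within `R`, the isomorphisms of the root spheres therefore preserve closeness and the value of `γ`.
-/
theorem transfer (hE : ∀ p ∈ E, p.1 ≤ n ∧ p.2 ≤ n) (hH : H ⊆ E)
    (hR : n * (2 * r + 1) + r + 1 ≤ R)
    (P : ∀ l ≤ n, lab n E l = l → PIso R (fams l) (roots l) (fams' l) (roots' l) (h l) (h' l))
    (hB : ∀ l ≤ n, lab n E l = l → ∀ v, Near (fams' l) R (roots' l) v → v < B')
    {γ : Facts → List ℕ → ℤ}
    (hγ : ∀ Y c Y' c' g g', PIso r Y c Y' c' g g' → γ Y c = γ Y' c') {e : List ℕ}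
    (he : e ∈ prodList ((List.range n).map (entryOptions roots n B E)))
    (hc : allClose fams n (2 * r + 1) E (roots 0) e = true) :
    transferTuple n E h e ∈ prodList ((List.range n).map (entryOptions roots' n B' E)) ∧
    allClose fams' n (2 * r + 1) E (roots' 0) (transferTuple n E h e) = true ∧
    transferTuple n E h' (transferTuple n E h e) = e ∧
    γ (spread fams n E) (placed n H (roots 0) e) =
      γ (spread fams' n E) (placed n H (roots' 0) (transferTuple n E h e)) := by
  have hnear := fun {i} => near_root (i := i) hE he hc
  rw [mem_prodList_range 0] at he
  obtain ⟨hlen, he⟩ := he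
  have hlabn : ∀ {i}, i ≤ n → lab n E i ≤ n := fun hi => (lab_le _).trans hi
  have P' : ∀ i ≤ n, PIso R (fams (lab n E i)) (roots (lab n E i)) (fams' (lab n E i))
      (roots' (lab n E i)) (h (lab n E i)) (h' (lab n E i)) := fun i hi =>
    P _ (hlabn hi) (lab_lab hE hi)
  have hlen' : (transferTuple n E h e).length = n := by simp [transferTuple]
  have hget : ∀ i < n, (transferTuple n E h e).getD i 0 = h (lab n E (i + 1)) (e.getD i 0) :=
    fun i hi => getD_map_range _ _ hi
  have hroot0 : (roots 0).map (h 0) = roots' 0 := (P 0 (Nat.zero_le _) lab_zero).centre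
  have hpos : ∀ i ≤ n, posAt (roots' 0) (transferTuple n E h e) i =
      (posAt (roots 0) e i).map (h (lab n E i)) := by
    intro i hi
    rcases i with _ | i
    · rw [posAt_zero, posAt_zero, lab_zero, hroot0]
    · rw [posAt_succ _ (by omega), posAt_succ _ (by omega), hget i (by omega)]
      rfl
  have hentry : ∀ i < n, Near (fams (lab n E (i + 1))) (n * (2 * r + 1))
      (roots (lab n E (i + 1))) (e.getD i 0) := by
    intro i hi
    refine hnear (i := i + 1) (by omega) _ ?_
    rw [posAt_succ _ (by omega)]
    simp
  refine ⟨?_, ?_, ?_, ?_⟩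
  · rw [mem_prodList_range 0]
    refine ⟨hlen', fun i hi => ?_⟩
    have h1 := he i hi
    rw [hget i hi]
    unfold entryOptions at h1 ⊢
    by_cases hl : lab n E (i + 1) = i + 1
    · rw [hl, beq_self_eq_true, cond_true] at h1 ⊢
      rw [← (P (i + 1) (by omega) hl).centre]
      exact List.mem_map_of_mem h1
    · rw [beq_eq_false_iff_ne.2 hl, cond_false, List.mem_range]
      refine hB (lab n E (i + 1)) (hlabn (by omega)) (lab_lab hE (by omega)) _ ?_
      exact ((P' (i + 1) (by omega)).maps _ (near_mono (hentry i hi) (by omega))).1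
  · refine List.all_eq_true.2 fun p hp => closeTo_iff.2 ?_
    obtain ⟨v, hv, u, hu, huv⟩ := closeTo_iff.1 (List.all_eq_true.1 hc p hp)
    have hpn := hE p hp
    have h3 := lab_edge (n := n) hp
    rw [hpos _ hpn.1, hpos _ hpn.2, ← h3]
    refine ⟨_, List.mem_map_of_mem hv, _, List.mem_map_of_mem hu, ?_⟩
    refine (P' p.1 hpn.1).within_double (hnear hpn.1 u hu) ?_ huv hR
    rw [h3]
    exact hnear hpn.2 v hv
  · refine List.ext_getElem (by simp [transferTuple, hlen]) fun i h1 h2 => ?_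
    have hi : i < n := by omega
    have h3 : (transferTuple n E h' (transferTuple n E h e)).getD i 0 = e.getD i 0 := by
      rw [transferTuple, getD_map_range _ _ hi, hget i hi]
      exact ((P' (i + 1) (by omega)).maps _ (near_mono (hentry i hi) (by omega))).2
    rwa [List.getD_eq_getElem _ _ h1, List.getD_eq_getElem _ _ h2] at h3
  -- Since `H ⊆ E`, an entry moved to the copy named by its `H`-component still lands in a copy of
  -- the structure of its `E`-component.
  · have hlabH : ∀ i ≤ n, lab n E (lab n H i) = lab n E i := fun i hi =>
      lab_const (lab n E) (fun p hp => hE p (hH hp)) (fun p hp => lab_edge (hH hp)) hi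
    have hC := PIso.dunion (m := n + 1) (r := r) (a := n * (2 * r + 1))
      (fun l hl => P' l (by omega)) (C := placed n H (roots 0) e) ?_ (by omega)
    · have h5 := hγ _ _ _ _ _ _ hC
      unfold spread
      rw [h5]
      congr 1
      simp only [placed, List.map_append, List.map_map, Function.comp_def, Nat.unpair_pair,
        lab_zero]
      congr 1
      · refine List.map_congr_left fun i hi => ?_
        rw [List.mem_range] at hi
        rw [hlabH _ (by omega), hget i hi]
      · rw [← hroot0, List.map_map]
        rfl
    · intro z hz
      rcases List.mem_append.1 hz with hz | hz
      · obtain ⟨i, hi, rfl⟩ := List.mem_map.1 hz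
        rw [List.mem_range] at hi
        simp only [Nat.unpair_pair]
        rw [hlabH _ (by omega)]
        exact ⟨by have := lab_le (n := n) (E := H) (i + 1); omega, hentry i hi⟩
      · obtain ⟨x, hx, rfl⟩ := List.mem_map.1 hz
        simp only [Nat.unpair_pair, lab_zero]
        exact ⟨by omega, near_of_mem hx _⟩

/-- Cluster sums only depend on the spheres of the roots. -/
theorem clusterSum_congr (hE : ∀ p ∈ E, p.1 ≤ n ∧ p.2 ≤ n) (hH : H ⊆ E)
    (hR : n * (2 * r + 1) + r + 1 ≤ R)
    (P : ∀ l ≤ n, lab n E l = l →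
      ∃ h h', PIso R (fams l) (roots l) (fams' l) (roots' l) h h')
    (hB : ∀ l ≤ n, lab n E l = l → ∀ v, Near (fams l) R (roots l) v → v < B)
    (hB' : ∀ l ≤ n, lab n E l = l → ∀ v, Near (fams' l) R (roots' l) v → v < B')
    (hnodup : ∀ l, 1 ≤ l → l ≤ n → lab n E l = l → (roots l).Nodup)
    (hnodup' : ∀ l, 1 ≤ l → l ≤ n → lab n E l = l → (roots' l).Nodup)
    {γ : Facts → List ℕ → ℤ}
    (hγ : ∀ Y c Y' c' g g', PIso r Y c Y' c' g g' → γ Y c = γ Y' c') :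
    clusterSum γ fams roots n (2 * r + 1) B E H =
      clusterSum γ fams' roots' n (2 * r + 1) B' E H := by
  have P1 : ∀ l, ∃ g : (ℕ → ℕ) × (ℕ → ℕ), l ≤ n → lab n E l = l →
      PIso R (fams l) (roots l) (fams' l) (roots' l) g.1 g.2 := by
    intro l
    by_cases hl : l ≤ n ∧ lab n E l = l
    · obtain ⟨g, g', hg⟩ := P l hl.1 hl.2
      exact ⟨(g, g'), fun _ _ => hg⟩
    · exact ⟨(id, id), fun h1 h2 => absurd ⟨h1, h2⟩ hl⟩
  choose g hg using P1
  have hnd : ∀ (roots : ℕ → List ℕ) (B : ℕ),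
      (∀ l, 1 ≤ l → l ≤ n → lab n E l = l → (roots l).Nodup) →
      (prodList ((List.range n).map (entryOptions roots n B E))).Nodup := by
    intro roots B hr
    refine nodup_prodList fun O hO => ?_
    obtain ⟨i, hi, rfl⟩ := List.mem_map.1 hO
    rw [List.mem_range] at hi
    unfold entryOptions
    by_cases hl : lab n E (i + 1) = i + 1
    · rw [hl, beq_self_eq_true, cond_true]
      exact hr _ (by omega) (by omega) hl
    · rw [beq_eq_false_iff_ne.2 hl, cond_false]
      exact List.nodup_range
  refine sum_map_bij (hnd roots B hnodup) (hnd roots' B' hnodup')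
    (transferTuple n E fun l => (g l).1) (transferTuple n E fun l => (g l).2)
    (fun e he hc => ?_) fun e he hc => ?_
  · exact transfer (h' := fun l => (g l).2) hE hH hR hg hB' hγ he hc
  · have := transfer (h := fun l => (g l).2) (h' := fun l => (g l).1) hE hH hR
      (fun l h1 h2 => (hg l h1 h2).symm) hB (γ := γ) hγ he hc
    exact ⟨this.1, this.2.1, this.2.2.1⟩

end Transfer

end FOCN

namespace FOCN

/-! ### Placements of counted tuples -/

/-- The radius that belongs to binding rank `q` and binding width `w`. -/
def rad (w q : ℕ) : ℕ := (2 * w + 1) ^ q - 1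

theorem rad_mono {w q q' : ℕ} (h : q ≤ q') : rad w q ≤ rad w q' :=
  Nat.sub_le_sub_right (Nat.pow_le_pow_right (by omega) h) 1

/-- The recursion that dictates the radius: with k = `rad w q`, one has (2w+1)(k+1) - 1 = w(2k+1) +
k + w, and the last w is at least 1 because 1 ≤ n ≤ w. -/
theorem rad_step {w q n : ℕ} (hn : 1 ≤ n) (hnw : n ≤ w) :
    n * (2 * rad w q + 1) + rad w q + 1 ≤ rad w (q + 1) := by
  unfold rad
  have h1 : 1 ≤ (2 * w + 1) ^ q := Nat.one_le_pow _ _ (by omega)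
  obtain ⟨k, hk⟩ := Nat.exists_eq_add_of_le h1
  rw [pow_succ, hk]
  have h2 : n * (2 * k + 1) ≤ w * (2 * k + 1) := Nat.mul_le_mul_right _ hnw
  have h3 : (1 + k) * (2 * w + 1) = w * (2 * k + 1) + k + w + 1 := by ring
  rw [h3]
  have h4 : 1 + k - 1 = k := by omega
  rw [h4]
  omega

/-- All pairs of positions. -/
def pairs (n : ℕ) : List (ℕ × ℕ) :=
  (List.range (n + 1)).flatMap fun i => (List.range (n + 1)).map fun j => (i, j)

theorem mem_pairs {n : ℕ} {p : ℕ × ℕ} : p ∈ pairs n ↔ p.1 ≤ n ∧ p.2 ≤ n := by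
  rcases p with ⟨i, j⟩
  simp [pairs]

/-- The `i`-th one of the given spheres, with its centre. -/
def sphereAt (taus : List (Facts × ℕ)) (i : ℕ) : Facts × ℕ := taus.getD i ([], 0)

/-- The structure `F` followed by the spheres of the given kinds. -/
def famsAt (F : Facts) (taus : List (Facts × ℕ)) (t : List ℕ) (l : ℕ) : Facts :=
  (F :: t.map fun i => (sphereAt taus i).1).getD l []

/-- The tuple `c` followed by the centres of the spheres of the given kinds. -/
def rootsAt (c : List ℕ) (taus : List (Facts × ℕ)) (t : List ℕ) (l : ℕ) : List ℕ :=
  (c :: t.map fun i => [(sphereAt taus i).2]).getD l []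

/-- A bound for all elements that occur. -/
def elemBound (F : Facts) (c : List ℕ) (taus : List (Facts × ℕ)) : ℕ :=
  ((c ++ F.flatMap fun f => f.2) ++ taus.flatMap fun τ => τ.2 :: τ.1.flatMap fun f => f.2).foldr
    max 0 + 1

/-- The options for the kind of the `i`-th entry. -/
def kindOptions (m n : ℕ) (E : List (ℕ × ℕ)) (i : ℕ) : List ℕ :=
  bif lab n E (i + 1) == i + 1 then List.range m else [0]

/-- The kinds of the roots. -/
def rootKinds (n : ℕ) (E : List (ℕ × ℕ)) (t : List ℕ) : List ℕ :=
  ((List.range n).filter fun i => lab n E (i + 1) == i + 1).map fun i => t.getD i 0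

/-- All placements of `n` elements relative to the tuple `c` in `F`. Each one consists of a signed
monomial and of a structure with a tuple. -/
def placements (w : ℕ) (taus : List (Facts × ℕ)) (q : ℕ) (F : Facts) (c : List ℕ) (n : ℕ) :
    List ((Bool × List ℕ) × Facts × List ℕ) :=
  (signed (pairs n)).flatMap fun x =>
    (prodList ((List.range n).map (kindOptions taus.length n x.2.1))).flatMap fun t =>
      ((prodList ((List.range n).map
          (entryOptions (rootsAt c taus t) n (elemBound F c taus) x.2.1))).filter
        fun e => allClose (famsAt F taus t) n (2 * rad w (q - 1) + 1) x.2.1 c e).map fun e =>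
          ((x.1, rootKinds n x.2.1 t), spread (famsAt F taus t) n x.2.1, placed n x.2.2 c e)

/-- The value of a signed monomial. -/
def monoVal (κ : Bool × List ℕ) (v : ℕ → ℤ) : ℤ := sgn κ.1 * (κ.2.map v).prod

/-- The sum of the values of `γ` over all placements, weighted by the monomials. -/
def placementSum (w : ℕ) (taus : List (Facts × ℕ)) (q : ℕ) (F : Facts) (c : List ℕ) (n : ℕ)
    (γ : Facts → List ℕ → ℤ) (v : ℕ → ℤ) : ℤ :=
  ((placements w taus q F c n).map fun κ => monoVal κ.1 v * γ κ.2.1 κ.2.2).sum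

section Placements

variable {w q n : ℕ} {taus : List (Facts × ℕ)} {F F' : Facts} {c c' : List ℕ}

theorem length_of_mem_placements {κ : (Bool × List ℕ) × Facts × List ℕ}
    (hκ : κ ∈ placements w taus q F c n) : κ.2.2.length = n + c.length := by
  simp only [placements, List.mem_flatMap, List.mem_map] at hκ
  obtain ⟨x, -, t, -, e, -, rfl⟩ := hκ
  simp [placed]

theorem lt_of_mem_placements {κ : (Bool × List ℕ) × Facts × List ℕ}
    (hκ : κ ∈ placements w taus q F c n) : ∀ i ∈ κ.1.2, i < taus.length := by
  simp only [placements, List.mem_flatMap, List.mem_map] at hκ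
  obtain ⟨x, -, t, ht, e, -, rfl⟩ := hκ
  rw [mem_prodList_range 0] at ht
  intro i hi
  simp only [rootKinds, List.mem_map, List.mem_filter, List.mem_range] at hi
  obtain ⟨j, ⟨hj, hl⟩, rfl⟩ := hi
  have := ht.2 j hj
  rwa [kindOptions, hl, cond_true, List.mem_range] at this

theorem rootsAt_zero (t : List ℕ) : rootsAt c taus t 0 = c := rfl

theorem rootsAt_succ {t : List ℕ} {i : ℕ} (hi : i < t.length) :
    rootsAt c taus t (i + 1) = [(sphereAt taus (t.getD i 0)).2] := by
  simp [rootsAt, hi]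

theorem famsAt_succ {t : List ℕ} {i : ℕ} (hi : i < t.length) :
    famsAt F taus t (i + 1) = (sphereAt taus (t.getD i 0)).1 := by
  simp [famsAt, hi]

/-- Regrouping by the signed pair of graphs and by the kinds of the roots, where the filter on
closeness turns into the condition inside `clusterSum`. -/
theorem placementSum_eq (γ : Facts → List ℕ → ℤ) (v : ℕ → ℤ) :
    placementSum w taus q F c n γ v =
      ((signed (pairs n)).map fun x => sgn x.1 *
        ((prodList ((List.range n).map (kindOptions taus.length n x.2.1))).map fun t =>
          ((rootKinds n x.2.1 t).map v).prod *
            clusterSum γ (famsAt F taus t) (rootsAt c taus t) n (2 * rad w (q - 1) + 1)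
              (elemBound F c taus) x.2.1 x.2.2).sum).sum := by
  unfold placementSum placements
  rw [sum_map_flatMap]
  refine sum_map_congr fun x _ => ?_
  rw [sum_map_flatMap, ← List.sum_map_mul_left]
  refine sum_map_congr fun t _ => ?_
  rw [clusterSum, ← mul_assoc, ← List.sum_map_mul_left, List.map_map]
  rw [rootsAt_zero]
  generalize prodList _ = l
  induction l with
  | nil => simp
  | cons e l ih =>
    rw [List.filter_cons]
    split_ifs with h
    · simp only [List.map_cons, List.sum_cons, ih, h, if_true, Function.comp_apply]
      rfl
    · simp only [List.map_cons, List.sum_cons, ih, h, mul_zero, zero_add, Bool.false_eq_true,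
        if_false]

theorem mem_of_near {r v : ℕ} (h : Near F r c v) : v ∈ c ∨ ∃ f ∈ F, v ∈ f.2 := by
  obtain ⟨u, hu, h⟩ := h
  induction r generalizing v with
  | zero => obtain rfl : u = v := h; exact Or.inl hu
  | succ r ih =>
    rcases h with h | ⟨m, -, f, hf, -, hv⟩
    · exact ih h
    · exact Or.inr ⟨f, hf, hv⟩

theorem lt_elemBound {v : ℕ} (h : (v ∈ c ∨ ∃ f ∈ F, v ∈ f.2) ∨
    ∃ τ ∈ taus, v = τ.2 ∨ ∃ f ∈ τ.1, v ∈ f.2) : v < elemBound F c taus := by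
  have key : ∀ l : List ℕ, v ∈ l → v < l.foldr max 0 + 1 := by
    intro l hl
    induction l with
    | nil => simp at hl
    | cons x l ih =>
      rw [List.foldr_cons]
      rcases List.mem_cons.1 hl with rfl | hl
      · omega
      · have := ih hl
        omega
  refine key _ ?_
  simpa only [List.mem_append, List.mem_flatMap, List.mem_cons] using h

theorem near_famsAt_lt {t : List ℕ} (ht : t.length = n) {R l v : ℕ} (hl : l ≤ n)
    (h : Near (famsAt F taus t l) R (rootsAt c taus t l) v) : v < elemBound F c taus := by
  have h1 := mem_of_near h
  rcases l with _ | i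
  · exact lt_elemBound (Or.inl h1)
  · rw [rootsAt_succ (by omega), famsAt_succ (by omega), List.mem_singleton] at h1
    unfold sphereAt at h1
    by_cases hi : t.getD i 0 < taus.length
    · rw [List.getD_eq_getElem _ _ hi] at h1
      exact lt_elemBound (Or.inr ⟨_, List.getElem_mem hi, h1⟩)
    -- A kind out of range denotes the sphere without facts and with centre 0; the bound covers it
    -- because it is positive.
    · rw [List.getD_eq_default _ _ (by omega)] at h1
      rcases h1 with rfl | ⟨f, hf, -⟩
      · exact Nat.succ_pos _
      · simp at hf

/-- The graphs and the kinds of roots are chosen independently of `F` and `c`, so the sums are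
compared term by term: the given isomorphism serves the root at position 0, the identity serves the
spheres at the other roots. -/
theorem placementSum_congr (hn : 1 ≤ n) (hnw : n ≤ w) {h h' : ℕ → ℕ}
    (P : PIso (rad w (q + 1)) F c F' c' h h') {γ : Facts → List ℕ → ℤ}
    (hγ : ∀ Y d Y' d' g g', PIso (rad w q) Y d Y' d' g g' → γ Y d = γ Y' d') (v : ℕ → ℤ) :
    placementSum w taus (q + 1) F c n γ v = placementSum w taus (q + 1) F' c' n γ v := by
  rw [placementSum_eq, placementSum_eq]
  refine sum_map_congr fun x hx => ?_
  congr 1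
  refine sum_map_congr fun t ht => ?_
  congr 1
  have htl := ((mem_prodList_range 0).1 ht).1
  have hE := signed_subset hx
  refine clusterSum_congr (R := rad w (q + 1)) (fun p hp => mem_pairs.1 (hE.2 hp)) hE.1
    (rad_step hn hnw) (fun l hl _ => ?_) (fun l hl _ v hv => near_famsAt_lt htl hl hv)
    (fun l hl _ v hv => near_famsAt_lt htl hl hv) ?_ ?_ hγ
  · rcases l with _ | i
    · exact ⟨h, h', P⟩
    · rw [rootsAt_succ (by omega), rootsAt_succ (by omega), famsAt_succ (by omega),
        famsAt_succ (by omega)]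
      exact ⟨id, id, PIso.refl _ _ _⟩
  all_goals
    intro l h1 hl _
    obtain ⟨i, rfl⟩ : ∃ i, l = i + 1 := ⟨l - 1, by omega⟩
    rw [rootsAt_succ (by omega)]
    exact List.nodup_singleton _

theorem sum_kinds {N m : ℕ} {kind : ℕ → ℕ} (hk : ∀ u < N, kind u < m) {v : ℕ → ℤ}
    (hv : ∀ t < m, v t = ((Finset.range N).filter fun u => kind u = t).card) (g : ℕ → ℤ) :
    ((List.range N).map fun u => g (kind u)).sum = ((List.range m).map fun t => v t * g t).sum := by
  rw [← List.sum_toFinset _ List.nodup_range, ← List.sum_toFinset _ List.nodup_range,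
    List.toFinset_range, List.toFinset_range,
    ← Finset.sum_fiberwise_of_maps_to (t := Finset.range m) (g := kind)
      fun u hu => Finset.mem_range.2 (hk u (Finset.mem_range.1 hu))]
  refine Finset.sum_congr rfl fun t ht => ?_
  rw [hv t (Finset.mem_range.1 ht), Finset.sum_congr rfl fun u hu => by
    rw [(Finset.mem_filter.1 hu).2]]
  simp

theorem prod_filter_map {α : Type*} (l : List α) (p : α → Bool) (f : α → ℤ) :
    ((l.filter p).map f).prod = (l.map fun x => bif p x then f x else 1).prod := by
  induction l with
  | nil => rfl
  | cons x l ih =>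
    rw [List.filter_cons]
    cases h : p x <;> simp [ih, h]

/-- Moving the clusters of a tuple apart does not change its local isomorphism type. -/
theorem exists_piso_placed {r : ℕ} {b : List ℕ} (hb : b.length = n) :
    ∃ h h', PIso r F (b ++ c) (dunion (n + 1) fun _ => F)
      (placed n ((pairs n).filter fun p => decide
        (closeTo F (2 * r + 1) (posAt c b p.1) (posAt c b p.2) = true)) c b) h h' := by
  set K := (pairs n).filter fun p => decide
    (closeTo F (2 * r + 1) (posAt c b p.1) (posAt c b p.2) = true) with hK
  let D : List (ℕ × ℕ) := ((List.range n).map fun i => (lab n K (i + 1), b.getD i 0)) ++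
    c.map fun x => (0, x)
  have hmem : ∀ p ∈ D, ∃ i ≤ n, p.1 = lab n K i ∧ p.2 ∈ posAt c b i := by
    intro p hp
    rcases List.mem_append.1 hp with hp | hp
    · obtain ⟨i, hi, rfl⟩ := List.mem_map.1 hp
      rw [List.mem_range] at hi
      exact ⟨i + 1, by omega, rfl, by rw [posAt_succ _ (by omega)]; simp⟩
    · obtain ⟨x, hx, rfl⟩ := List.mem_map.1 hp
      exact ⟨0, by omega, lab_zero.symm, hx⟩
  have key := exists_piso_dunion_const (m := n + 1) (r := r) F (Nat.succ_pos n) (D := D) ?_ ?_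
  · have h1 : D.map (fun p => p.2) = b ++ c := by
      simp only [D, List.map_append, List.map_map, Function.comp_def, List.map_id']
      congr 1
      refine List.ext_getElem (by simp [hb]) fun i h1 h2 => ?_
      simp [h2]
    have h2 : D.map (fun p => Nat.pair p.1 p.2) = placed n K c b := by
      simp [D, placed, Function.comp_def]
    rwa [h1, h2] at key
  · intro p hp
    obtain ⟨i, hi, h1, -⟩ := hmem p hp
    have := lab_le (n := n) (E := K) i
    omega
  · intro p hp p' hp' hw
    obtain ⟨i, hi, h1, h2⟩ := hmem p hp
    obtain ⟨j, hj, h3, h4⟩ := hmem p' hp'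
    rw [h1, h3]
    -- Elements at distance at most `2 * r + 1` stand at positions joined by an edge of `K`, so they
    -- are sent to the same copy.
    refine lab_edge (p := (i, j)) ?_
    rw [hK, List.mem_filter]
    exact ⟨mem_pairs.2 ⟨hi, hj⟩, by simpa using closeTo_iff.2 ⟨_, h4, _, h2, hw⟩⟩

/-- The weighted sum over all placements evaluates the sum over all tuples of a structure. -/
theorem placementSum_eq_sum (hn : 1 ≤ n) (hnw : n ≤ w) {N R : ℕ} (hR : rad w (q + 1) ≤ R)
    (hF : ∀ f ∈ F, ∀ x ∈ f.2, x < N) (hc : ∀ x ∈ c, x < N) {kind : ℕ → ℕ}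
    (hk : ∀ u < N, kind u < taus.length)
    (hkind : ∀ u < N, ∃ h h', PIso R F [u] (sphereAt taus (kind u)).1
      [(sphereAt taus (kind u)).2] h h') {v : ℕ → ℤ}
    (hv : ∀ t < taus.length, v t = ((Finset.range N).filter fun u => kind u = t).card)
    {γ : Facts → List ℕ → ℤ}
    (hγ : ∀ Y d Y' d' g g', PIso (rad w q) Y d Y' d' g g' → γ Y d = γ Y' d') :
    placementSum w taus (q + 1) F c n γ v =
      ((prodList ((List.range n).map fun _ => List.range N)).map fun b => γ F (b ++ c)).sum := by
  -- For each tuple the clusters are first moved apart along its own closeness graph; Möbius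
  -- inversion then removes the reference to this exact graph.
  have h1 : ∀ b ∈ prodList ((List.range n).map fun _ => List.range N), γ F (b ++ c) =
      ((signed (pairs n)).map fun x => if allClose (fun _ => F) n (2 * rad w q + 1) x.2.1 c b then
        sgn x.1 * γ (dunion (n + 1) fun _ => F) (placed n x.2.2 c b) else 0).sum := by
    intro b hb
    obtain ⟨h, h', P⟩ := exists_piso_placed (F := F) (c := c) (r := rad w q)
      ((mem_prodList_range 0).1 hb).1
    rw [hγ _ _ _ _ _ _ P]
    have := sum_signed (pairs n) (fun p => closeTo F (2 * rad w q + 1) (posAt c b p.1)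
      (posAt c b p.2) = true) fun H => γ (dunion (n + 1) fun _ => F) (placed n H c b)
    rw [← this]
    simp only [allClose, List.all_eq_true]
  rw [sum_map_congr h1, sum_map_swap, placementSum_eq]
  refine sum_map_congr fun x hx => ?_
  have hE := signed_subset hx
  have hE' : ∀ p ∈ x.2.1, p.1 ≤ n ∧ p.2 ≤ n := fun p hp => mem_pairs.1 (hE.2 hp)
  obtain ⟨sg, E, H⟩ := x
  simp only [] at hE hE' ⊢
  have h2 : ∀ b : List ℕ, (if allClose (fun _ => F) n (2 * rad w q + 1) E c b then
      sgn sg * γ (dunion (n + 1) fun _ => F) (placed n H c b) else 0) =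
      sgn sg * (if allClose (fun _ => F) n (2 * rad w q + 1) E c b then
        γ (dunion (n + 1) fun _ => F) (placed n H c b) else 0) := fun b => by
    split_ifs <;> simp
  simp only [h2]
  rw [List.sum_map_mul_left]
  congr 1
  -- The choice of a tuple is made in two stages. At a root position, `U` chooses the element and
  -- `V` merely keeps it; elsewhere `U` makes the dummy choice 0 and `V` runs through all elements.
  -- `kd` is the kind of a chosen root and `wt` the number of roots of a kind.
  let U : ℕ → List ℕ := fun i => bif lab n E (i + 1) == i + 1 then List.range N else [0]
  let V : ℕ → ℕ → List ℕ := fun i u =>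
    bif lab n E (i + 1) == i + 1 then [u] else List.range N
  let kd : ℕ → ℕ → ℕ := fun i u => bif lab n E (i + 1) == i + 1 then kind u else 0
  let wt : ℕ → ℕ → ℤ := fun i t => bif lab n E (i + 1) == i + 1 then v t else 1
  let G : List ℕ → ℤ := fun t => clusterSum γ (famsAt F taus t) (rootsAt c taus t) n
    (2 * rad w q + 1) (elemBound F c taus) E H
  -- Roots of the same kinds yield the same inner sum `G`, so the sum over roots becomes a sum over
  -- kinds, weighted with a monomial in the counts.
  have h3 := sum_prodList_weight (List.range n) U (kindOptions taus.length n E) kd wt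
    (fun i _ g => by
      simp only [U, kd, wt, kindOptions]
      cases lab n E (i + 1) == i + 1
      · simp
      · exact sum_kinds hk hv g) G
  have h4 : ∀ t ∈ prodList ((List.range n).map (kindOptions taus.length n E)),
      (List.zipWith wt (List.range n) t).prod * G t = ((rootKinds n E t).map v).prod * G t := by
    intro t ht
    rw [zipWith_range wt 0 ((mem_prodList_range 0).1 ht).1, rootKinds, List.map_map,
      prod_filter_map]
    rfl
  rw [sum_map_congr h4] at h3
  rw [Nat.add_sub_cancel, ← h3]
  rw [sum_prodList_split (List.range n) (fun _ => List.range N) U V fun i _ g => by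
    simp only [U, V]
    cases lab n E (i + 1) == i + 1
    · simp
    · simp]
  refine sum_map_congr fun u hu => ?_
  obtain ⟨hul, hu⟩ := (mem_prodList_range 0).1 hu
  set t := List.zipWith kd (List.range n) u with ht
  have htl : t.length = n := by simp [ht, hul]
  have htg : ∀ i < n, t.getD i 0 = kd i (u.getD i 0) := by
    intro i hi
    rw [ht, zipWith_range kd 0 hul, getD_map_range _ _ hi]
  let roots : ℕ → List ℕ := fun l => if l = 0 then c else [u.getD (l - 1) 0]
  have hroot : ∀ i < n, lab n E (i + 1) = i + 1 → u.getD i 0 < N ∧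
      t.getD i 0 = kind (u.getD i 0) := by
    intro i hi hl
    have h5 := hu i hi
    rw [htg i hi]
    simp only [U, kd, hl, beq_self_eq_true, cond_true, List.mem_range] at h5 ⊢
    exact ⟨h5, trivial⟩
  -- For fixed roots, the clusters inside the whole structure correspond to clusters inside the
  -- spheres chosen for the kinds of these roots.
  have h5 := clusterSum_congr (γ := γ) (fams := fun _ => F) (fams' := famsAt F taus t)
    (roots := roots) (roots' := rootsAt c taus t) (n := n) (r := rad w q) (R := rad w (q + 1))
    (B := N) (B' := elemBound F c taus) hE' hE.1 (rad_step hn hnw) ?_ ?_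
    (fun l hl _ v hv => near_famsAt_lt htl hl hv) ?_ ?_ hγ
  · refine h5.symm.trans ?_
    rw [clusterSum, zipWith_range V 0 hul]
    have h6 : (List.range n).map (entryOptions roots n N E) =
        (List.range n).map fun i => V i (u.getD i 0) := by
      refine List.map_congr_left fun i _ => ?_
      simp [entryOptions, V, roots]
    rw [h6]
    rfl
  · intro l hl hll
    rcases l with _ | i
    · exact ⟨id, id, PIso.refl _ _ _⟩
    · obtain ⟨h6, h7⟩ := hroot i (by omega) hll
      obtain ⟨h, h', P⟩ := hkind _ h6
      rw [rootsAt_succ (by omega), famsAt_succ (by omega), h7]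
      exact ⟨h, h', P.mono hR⟩
  · intro l hl hll y hy
    rcases mem_of_near hy with hy | ⟨f, hf, hy⟩
    · rcases l with _ | i
      · exact hc y hy
      · simp only [roots, Nat.succ_ne_zero, if_false, Nat.add_sub_cancel,
          List.mem_singleton] at hy
        rw [hy]
        exact (hroot i (by omega) hll).1
    · exact hF f hf y hy
  · intro l h1 hl _
    simp [roots, show l ≠ 0 by omega]
  · intro l h1 hl _
    obtain ⟨i, rfl⟩ : ∃ i, l = i + 1 := ⟨l - 1, by omega⟩
    rw [rootsAt_succ (by omega)]
    exact List.nodup_singleton _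

end Placements

end FOCN

namespace FOCN

universe u v

/-! ### The translation -/

section Translation

variable {σ : Signature} {Name : Type u} {Ps : NumPreds Name}

/-- A true sentence. -/
def ZFormula.top : ZFormula Ps := .eq (.const 0) (.const 0)

/-- A false sentence. -/
def ZFormula.bot : ZFormula Ps := .neg ZFormula.top

/-- The term denoting a signed monomial. -/
def mono (κ : Bool × List ℕ) : ZTerm :=
  κ.2.foldr (fun i t => .mul (.var i) t) (.const (sgn κ.1))

/-- All ways to combine an entry of one list with an entry of another one. -/
def combine {φ α β δ : Type*} (andF : φ → φ → φ) (op : α → β → δ) (L : List (φ × α))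
    (M : List (φ × β)) : List (φ × δ) :=
  L.flatMap fun a => M.map fun b => (andF a.1 b.1, op a.2 b.2)

/-- Guarded terms for the sum of those of the given monomials whose formula holds. -/
def countGl (cs : List ((Bool × List ℕ) × ZFormula Ps)) : List (ZFormula Ps × ZTerm) :=
  cs.foldr (fun κ acc => combine ZFormula.and ZTerm.add
    [(κ.2, mono κ.1), (.neg κ.2, .const 0)] acc) [(ZFormula.top, .const 0)]

/-- The formula stating that a guarded term is positive. -/
def positive (L : List (ZFormula Ps × ZTerm)) : ZFormula Ps :=
  L.foldr (fun p acc => .or (.and p.1 (.le (.const 1) p.2)) acc) ZFormula.bot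

/-- Guarded tuples of terms. -/
def combineAll (Ls : List (List (ZFormula Ps × ZTerm))) : List (ZFormula Ps × List ZTerm) :=
  Ls.foldr (fun L acc => combine ZFormula.and List.cons L acc) [(ZFormula.top, [])]

/-- The formula stating that a predicate holds of a guarded tuple of terms. -/
def holds (P : Name) (L : List (ZFormula Ps × List ZTerm)) : ZFormula Ps :=
  L.foldr (fun p acc => .or (.and p.1 (.pred (some P) fun j => p.2.getD j (.const 0))) acc)
    ZFormula.bot

/-- Formulas are translated into formulas, terms into guarded terms. -/
abbrev Kind.Out (Ps : NumPreds Name) : Kind → Type u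
  | .formula => ZFormula Ps
  | .term => List (ZFormula Ps × ZTerm)

/-- The value of the variable `x`, where the variables `xs` have the values `c`. -/
def look (xs c : List ℕ) (x : ℕ) : ℕ := c.getD (xs.idxOf x) 0

/-- Bounded quantification over the `z`-variable `x`. -/
def boundedEx (ℓ x : ℕ) (χ : ZFormula Ps) : ZFormula Ps :=
  .ex x (.and (.and (.le (.const 0) (.var x)) (.le (.var x) (ZTerm.sumVars ℓ))) χ)

/-- The translation of expressions relative to a local structure `F` in which the variables `xs`
have the values `c`. -/
def tr (w : ℕ) (taus : List (Facts × ℕ)) :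
    {k : Kind} → Expr σ Ps k → ℕ → Facts → List ℕ → List ℕ → k.Out Ps
  | _, .eq x y, _, _, c, xs => if look xs c x = look xs c y then ZFormula.top else ZFormula.bot
  | _, .rel R x, _, F, c, xs =>
      if ((R : ℕ), List.ofFn fun j => look xs c (x j)) ∈ F then ZFormula.top else ZFormula.bot
  | _, .neg φ, q, F, c, xs => ZFormula.neg (tr w taus φ q F c xs)
  | _, .or φ ψ, q, F, c, xs => ZFormula.or (tr w taus φ q F c xs) (tr w taus ψ q F c xs)
  | _, .ex y φ, q, F, c, xs => positive (countGl ((placements w taus q F c 1).map fun κ =>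
      (κ.1, tr w taus φ (q - 1) κ.2.1 κ.2.2 (y :: xs))))
  | _, .pred P t, q, F, c, xs =>
      holds P (combineAll (List.ofFn fun j => tr w taus (t j) q F c xs))
  | _, .exNum κ φ, q, F, c, xs =>
      boundedEx taus.length (taus.length + κ) (tr w taus φ q F c xs)
  | _, .count n _ y _ φ, q, F, c, xs => countGl ((placements w taus q F c n).map fun κ =>
      (κ.1, tr w taus φ (q - 1) κ.2.1 κ.2.2 (List.ofFn y ++ xs)))
  | _, .int i, _, _, _, _ => [(ZFormula.top, .const i)]
  | _, .add s t, q, F, c, xs =>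
      combine ZFormula.and ZTerm.add (tr w taus s q F c xs) (tr w taus t q F c xs)
  | _, .mul s t, q, F, c, xs =>
      combine ZFormula.and ZTerm.mul (tr w taus s q F c xs) (tr w taus t q F c xs)
  | _, .num κ, _, _, _, _ => [(ZFormula.top, .var (taus.length + κ))]

/-! ### Denotations -/

theorem sat_top (v : ℕ → ℤ) : (ZFormula.top : ZFormula Ps).Sat v := rfl

theorem not_sat_bot (v : ℕ → ℤ) : ¬ (ZFormula.bot : ZFormula Ps).Sat v := fun h => h rfl

theorem sat_and {φ ψ : ZFormula Ps} {v : ℕ → ℤ} : (φ.and ψ).Sat v ↔ φ.Sat v ∧ ψ.Sat v := by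
  simp only [ZFormula.and, ZFormula.Sat]
  tauto

/-- The value of a term, as a function of the term. -/
def valAt (v : ℕ → ℤ) (t : ZTerm) : ℤ := t.val v

/-- The guarded expressions in `L` denote `z`. -/
def GDen {α β : Type*} (v : ℕ → ℤ) (f : α → β) (L : List (ZFormula Ps × α)) (z : β) : Prop :=
  (∃ p ∈ L, p.1.Sat v) ∧ ∀ p ∈ L, p.1.Sat v → f p.2 = z

/-- The translation `o` of an expression denotes the given value. -/
def Den (v : ℕ → ℤ) : {k : Kind} → k.Out Ps → k.Val → Prop
  | .formula, (ψ : ZFormula Ps), (P : Prop) => P ↔ ψ.Sat v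
  | .term, (L : List (ZFormula Ps × ZTerm)), (z : ℤ) => GDen v (valAt v) L z

theorem GDen.combine {α β δ α' β' δ' : Type*} {v : ℕ → ℤ} {f : α → α'} {g : β → β'}
    {h : δ → δ'} {op : α → β → δ} {op' : α' → β' → δ'} (hop : ∀ a b, h (op a b) = op' (f a) (g b))
    {L : List (ZFormula Ps × α)} {M : List (ZFormula Ps × β)} {x : α'} {y : β'}
    (hL : GDen v f L x) (hM : GDen v g M y) :
    GDen v h (combine ZFormula.and op L M) (op' x y) := by
  obtain ⟨⟨p, hp, hpv⟩, hL⟩ := hL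
  obtain ⟨⟨p', hp', hpv'⟩, hM⟩ := hM
  constructor
  · exact ⟨_, List.mem_flatMap.2 ⟨p, hp, List.mem_map_of_mem hp'⟩, sat_and.2 ⟨hpv, hpv'⟩⟩
  · intro a ha hav
    obtain ⟨b, hb, ha⟩ := List.mem_flatMap.1 ha
    obtain ⟨d, hd, rfl⟩ := List.mem_map.1 ha
    obtain ⟨h1, h2⟩ := sat_and.1 hav
    rw [hop, hL b hb h1, hM d hd h2]

theorem gden_singleton {α β : Type*} (v : ℕ → ℤ) (f : α → β) (a : α) :
    GDen (Ps := Ps) v f [(ZFormula.top, a)] (f a) :=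
  ⟨⟨_, List.mem_singleton_self _, sat_top v⟩, fun p hp _ => by rw [List.mem_singleton.1 hp]⟩

theorem val_mono (κ : Bool × List ℕ) (v : ℕ → ℤ) : (mono κ).val v = monoVal κ v := by
  obtain ⟨s, l⟩ := κ
  unfold mono monoVal
  induction l with
  | nil => simp [ZTerm.val]
  | cons i l ih =>
    simp only [List.foldr_cons, ZTerm.val, List.map_cons, List.prod_cons] at ih ⊢
    rw [ih]
    ring

-- For each monomial the guards are a formula and its negation, so a true conjunction of guards
-- records exactly which monomials are switched on.
open Classical in
theorem gden_countGl (v : ℕ → ℤ) (cs : List ((Bool × List ℕ) × ZFormula Ps)) :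
    GDen v (valAt v) (countGl cs)
      (cs.map fun κ => monoVal κ.1 v * if κ.2.Sat v then 1 else 0).sum := by
  induction cs with
  | nil => exact gden_singleton v (valAt v) (ZTerm.const 0)
  | cons κ cs ih =>
    rw [List.map_cons, List.sum_cons]
    refine GDen.combine (f := valAt v) (g := valAt v) (op' := fun a b : ℤ => a + b)
      (fun _ _ => rfl) ?_ ih
    constructor
    · by_cases h : κ.2.Sat v
      · exact ⟨_, List.mem_cons_self, h⟩
      · exact ⟨(.neg κ.2, .const 0), by simp, h⟩
    · intro p hp hpv
      simp only [List.mem_cons, List.not_mem_nil, or_false] at hp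
      rcases hp with rfl | rfl
      · rw [if_pos hpv, mul_one, valAt, val_mono]
      · rw [if_neg hpv, mul_zero]
        rfl

theorem sat_positive {v : ℕ → ℤ} {L : List (ZFormula Ps × ZTerm)} {z : ℤ}
    (h : GDen v (valAt v) L z) : (positive L).Sat v ↔ 1 ≤ z := by
  have h1 : (positive L).Sat v ↔ ∃ p ∈ L, p.1.Sat v ∧ 1 ≤ valAt v p.2 := by
    clear h
    induction L with
    | nil => simpa [positive] using not_sat_bot v
    | cons p L ih =>
      change (ZFormula.and p.1 (.le (.const 1) p.2)).Sat v ∨ (positive L).Sat v ↔ _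
      rw [ih, sat_and]
      simp [ZFormula.Sat, ZTerm.val, valAt]
  rw [h1]
  obtain ⟨⟨p, hp, hpv⟩, h⟩ := h
  constructor
  · rintro ⟨p, hp, hpv, h2⟩
    rwa [h p hp hpv] at h2
  · intro hz
    exact ⟨p, hp, hpv, by rwa [h p hp hpv]⟩

theorem gden_combineAll {v : ℕ → ℤ} {Ls : List (List (ZFormula Ps × ZTerm))} {zs : List ℤ}
    (h : List.Forall₂ (fun L z => GDen v (valAt v) L z) Ls zs) :
    GDen v (List.map (valAt v)) (combineAll Ls) zs := by
  induction h with
  | nil => exact gden_singleton v (List.map (valAt v)) ([] : List ZTerm)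
  | cons h _ ih => exact GDen.combine (f := valAt v) (op' := List.cons) (fun _ _ => rfl) h ih

theorem sat_holds {v : ℕ → ℤ} {P : Name} {L : List (ZFormula Ps × List ZTerm)}
    {zs : Fin (Ps.ar P) → ℤ} (h : GDen v (List.map (valAt v)) L (List.ofFn zs)) :
    (holds P L).Sat v ↔ zs ∈ Ps.sem P := by
  have h1 : (holds P L).Sat v ↔ ∃ p ∈ L, p.1.Sat v ∧
      (fun j : Fin (Ps.ar P) => valAt v (p.2.getD j (.const 0))) ∈ Ps.sem P := by
    clear h
    induction L with
    | nil => simpa [holds] using not_sat_bot v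
    | cons p L ih =>
      change (ZFormula.and p.1 (.pred (some P) fun j => p.2.getD j (.const 0))).Sat v ∨
        (holds P L).Sat v ↔ _
      rw [ih, sat_and]
      simp only [List.mem_cons, exists_eq_or_imp]
      rfl
  have h2 : ∀ p ∈ L, p.1.Sat v →
      (fun j : Fin (Ps.ar P) => valAt v (p.2.getD j (.const 0))) = zs := by
    intro p hp hpv
    have h3 := h.2 p hp hpv
    funext j
    have h4 := congrArg (fun l => l.getD (j : ℕ) (valAt v (ZTerm.const 0))) h3
    simp only [List.getD_map] at h4
    rw [h4]
    simp [List.getD_eq_getElem?_getD]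
  rw [h1]
  constructor
  · rintro ⟨p, hp, hpv, h3⟩
    rwa [h2 p hp hpv] at h3
  · intro hz
    obtain ⟨p, hp, hpv⟩ := h.1
    exact ⟨p, hp, hpv, by rwa [h2 p hp hpv]⟩

theorem den_const (v : ℕ → ℤ) (t : ZTerm) :
    Den (Ps := Ps) (k := .term) v [(ZFormula.top, t)] (t.val v) :=
  gden_singleton v (valAt v) t

theorem Den.add {v : ℕ → ℤ} {L M : Kind.Out Ps .term} {x y : ℤ} (hL : Den v L x)
    (hM : Den v M y) : Den (k := .term) v (FOCN.combine ZFormula.and ZTerm.add L M) (x + y) :=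
  GDen.combine (f := valAt v) (g := valAt v) (fun _ _ => rfl) hL hM

theorem Den.mul {v : ℕ → ℤ} {L M : Kind.Out Ps .term} {x y : ℤ} (hL : Den v L x)
    (hM : Den v M y) : Den (k := .term) v (FOCN.combine ZFormula.and ZTerm.mul L M) (x * y) :=
  GDen.combine (f := valAt v) (g := valAt v) (fun _ _ => rfl) hL hM

theorem Den.pred {v : ℕ → ℤ} {P : Name} {L : Fin (Ps.ar P) → Kind.Out Ps .term}
    {z : Fin (Ps.ar P) → ℤ} (h : ∀ j, Den v (L j) (z j)) :
    Den (k := .formula) v (holds P (combineAll (List.ofFn L))) (z ∈ Ps.sem P) := by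
  refine (sat_holds (gden_combineAll ?_)).symm
  rw [List.forall₂_iff_get]
  refine ⟨by simp, fun i _ _ => ?_⟩
  simp only [List.get_eq_getElem, List.getElem_ofFn]
  exact h _

theorem look_mem {xs c : List ℕ} (hl : xs.length = c.length) {x : ℕ} (hx : x ∈ xs) :
    look xs c x ∈ c := by
  have h1 := List.idxOf_lt_length_of_mem hx
  rw [look, List.getD_eq_getElem _ _ (hl ▸ h1)]
  exact List.getElem_mem _

theorem look_map {xs c : List ℕ} (hl : xs.length = c.length) {x : ℕ} (hx : x ∈ xs)
    (h : ℕ → ℕ) : look xs (c.map h) x = h (look xs c x) := by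
  have h1 := hl ▸ List.idxOf_lt_length_of_mem hx
  rw [look, look, List.getD_eq_getElem _ _ h1, List.getD_eq_getElem _ _ (by simpa using h1),
    List.getElem_map]

/-- New variables are put in front and `idxOf` finds the first occurrence, so an inner binding
shadows an outer one. -/
theorem look_append_left {ys xs d c : List ℕ} (hl : ys.length = d.length) {x : ℕ}
    (hx : x ∈ ys) : look (ys ++ xs) (d ++ c) x = look ys d x := by
  have h1 := List.idxOf_lt_length_of_mem hx
  rw [look, look, List.idxOf_append_of_mem hx, List.getD_append _ _ _ _ (hl ▸ h1)]

theorem look_append_right {ys xs d c : List ℕ} (hl : ys.length = d.length) {x : ℕ}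
    (hx : x ∉ ys) : look (ys ++ xs) (d ++ c) x = look xs c x := by
  rw [look, look, List.idxOf_append_of_notMem hx, List.getD_append_right _ _ _ _ (by omega)]
  congr 1
  omega

theorem look_ofFn {n : ℕ} {y : Fin n → ℕ} (hy : Function.Injective y) (a : Fin n → ℕ)
    (j : Fin n) : look (List.ofFn y) (List.ofFn a) (y j) = a j := by
  have h1 : (List.ofFn y).idxOf (y j) = j := by
    have h2 := (List.nodup_ofFn.2 hy).idxOf_getElem (i := j) (by simp)
    simpa using h2
  rw [look, h1]
  simp [List.getD_eq_getElem?_getD]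

theorem sat_ite {P : Prop} [Decidable P] {v : ℕ → ℤ} :
    (if P then ZFormula.top else ZFormula.bot : ZFormula Ps).Sat v ↔ P := by
  split_ifs with h
  · simp [h, sat_top v]
  · simp [h, not_sat_bot v]

theorem sat_boundedEx {v : ℕ → ℤ} {ℓ x : ℕ} {χ : ZFormula Ps} (hx : ℓ ≤ x) :
    (boundedEx ℓ x χ).Sat v ↔ ∃ m : ℕ, (m : ℤ) ≤ (ZTerm.sumVars ℓ).val v ∧
      χ.Sat (Function.update v x m) := by
  -- The quantified variable does not occur in the bound, whose value is therefore unaffected by the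
  -- update.
  have h1 : ∀ (ℓ : ℕ) (_ : ℓ ≤ x) (i : ℤ),
      (ZTerm.sumVars ℓ).val (Function.update v x i) = (ZTerm.sumVars ℓ).val v := by
    intro ℓ hℓ i
    induction ℓ with
    | zero => rfl
    | succ ℓ ih =>
      simp only [ZTerm.sumVars, ZTerm.val]
      rw [ih (by omega), Function.update_of_ne (by omega)]
  change (∃ i : ℤ, _) ↔ _
  simp only [sat_and]
  simp only [ZFormula.Sat, ZTerm.val, Function.update_self, h1 ℓ hx]
  constructor
  · rintro ⟨i, ⟨h2, h3⟩, h4⟩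
    lift i to ℕ using h2
    exact ⟨i, h3, h4⟩
  · rintro ⟨m, h3, h4⟩
    exact ⟨m, ⟨by positivity, h3⟩, h4⟩

/-! ### Invariance of the translation under local isomorphisms -/

open Classical in
/-- The truth value of a formula that depends on a structure and a tuple of length `m`. -/
noncomputable def truthVal (m : ℕ) (ψ : Facts → List ℕ → ZFormula Ps) (v : ℕ → ℤ) (Y : Facts)
    (d : List ℕ) : ℤ :=
  if d.length = m ∧ (ψ Y d).Sat v then 1 else 0

/-- Every placement carries a tuple of length `n + c.length`, so the length test in `truthVal` is
always passed here. Its purpose is to make `truthVal` invariant on all tuples, including those of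
the wrong length. -/
theorem gden_placements {w q n : ℕ} {taus : List (Facts × ℕ)} {F : Facts} {c : List ℕ}
    (ψ : Facts → List ℕ → ZFormula Ps) (v : ℕ → ℤ) :
    GDen v (valAt v)
      (countGl ((placements w taus q F c n).map fun κ => (κ.1, ψ κ.2.1 κ.2.2)))
      (placementSum w taus q F c n (truthVal (n + c.length) ψ v) v) := by
  classical
  have h := gden_countGl v ((placements w taus q F c n).map fun κ => (κ.1, ψ κ.2.1 κ.2.2))
  rw [List.map_map] at h
  convert h using 1
  refine sum_map_congr fun κ hκ => ?_
  simp only [truthVal, length_of_mem_placements hκ, true_and, Function.comp_apply]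

theorem truthVal_congr {r m : ℕ} {ψ : Facts → List ℕ → ZFormula Ps} {v : ℕ → ℤ}
    (h : ∀ Y d Y' d' g g', PIso r Y d Y' d' g g' → d.length = m →
      ((ψ Y d).Sat v ↔ (ψ Y' d').Sat v)) {Y d Y' d' g g'} (P : PIso r Y d Y' d' g g') :
    truthVal m ψ v Y d = truthVal m ψ v Y' d' := by
  have h1 : d'.length = d.length := by rw [← P.centre, List.length_map]
  classical
  have h2 : (d.length = m ∧ (ψ Y d).Sat v) ↔ (d'.length = m ∧ (ψ Y' d').Sat v) := by
    rw [h1]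
    exact and_congr_right fun hd => h _ _ _ _ _ _ P hd
  simp only [truthVal, h2]

/-- The two translations may be different formulas; what agrees is their value under the same
assignment. Atoms only need the centres. At a binder, the induction hypothesis for rank `q - 1` says
that the body depends only on spheres of radius `rad w (q - 1)`, and this is what
`placementSum_congr` asks for. -/
theorem tr_invariant {w : ℕ} {taus : List (Facts × ℕ)} {k : Kind} (φ : Expr σ Ps k)
    {q : ℕ} (hq : φ.br ≤ q) (hw : φ.bw ≤ w) {F F' : Facts} {c c' xs : List ℕ} {h h' : ℕ → ℕ}
    (P : PIso (rad w q) F c F' c' h h') (hx : ∀ x ∈ φ.freeVar, x ∈ xs)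
    (hl : xs.length = c.length) (v : ℕ → ℤ) :
    ∃ val, Den v (tr w taus φ q F c xs) val ∧ Den v (tr w taus φ q F' c' xs) val := by
  induction φ generalizing q F F' c c' xs h h' v with
  | eq x y =>
    simp only [Expr.freeVar, Finset.mem_insert, Finset.mem_singleton, forall_eq_or_imp,
      forall_eq] at hx
    have h1 := (P.maps _ (near_of_mem (look_mem hl hx.1) _)).2
    have h2 := (P.maps _ (near_of_mem (look_mem hl hx.2) _)).2
    have key : look xs c x = look xs c y ↔ look xs c' x = look xs c' y := by
      rw [← P.centre, look_map hl hx.1, look_map hl hx.2]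
      exact ⟨fun h3 => by rw [h3], fun h3 => by rw [← h1, h3, h2]⟩
    exact ⟨_, sat_ite.symm, key.trans sat_ite.symm⟩
  | rel R x =>
    simp only [Expr.freeVar, Finset.mem_image, Finset.mem_univ, true_and, forall_exists_index,
      forall_apply_eq_imp_iff] at hx
    have key : ((R : ℕ), List.ofFn fun j => look xs c (x j)) ∈ F ↔
        ((R : ℕ), List.ofFn fun j => look xs c' (x j)) ∈ F' := by
      rw [← P.centre, P.facts]
      · simp only [List.map_ofFn, Function.comp_def, look_map hl (hx _)]
      · intro u hu
        obtain ⟨j, rfl⟩ := (List.mem_ofFn' _ _).1 hu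
        exact near_of_mem (look_mem hl (hx j)) _
    exact ⟨_, sat_ite.symm, key.trans sat_ite.symm⟩
  | neg φ ih =>
    obtain ⟨p, h1, h2⟩ := ih hq hw P hx hl v
    exact ⟨¬ p, not_congr h1, not_congr h2⟩
  | or φ ψ ih1 ih2 =>
    simp only [Expr.br, Expr.bw, max_le_iff, Expr.freeVar, Finset.mem_union] at hq hw hx
    obtain ⟨p, h1, h2⟩ := ih1 hq.1 hw.1 P (fun x h => hx x (Or.inl h)) hl v
    obtain ⟨p', h3, h4⟩ := ih2 hq.2 hw.2 P (fun x h => hx x (Or.inr h)) hl v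
    exact ⟨p ∨ p', or_congr h1 h3, or_congr h2 h4⟩
  | ex y φ ih =>
    simp only [Expr.br, Expr.bw, max_le_iff, Expr.freeVar, Finset.mem_sdiff,
      Finset.mem_singleton] at hq hw hx
    obtain ⟨q, rfl⟩ : ∃ q', q = q' + 1 := ⟨q - 1, by omega⟩
    refine ⟨_, Iff.rfl, ?_⟩
    have h1 := fun (F : Facts) (c : List ℕ) => gden_placements (w := w) (q := q + 1) (n := 1)
      (taus := taus) (F := F) (c := c) (fun Y d => tr w taus φ q Y d (y :: xs)) v
    have hlen : c'.length = c.length := by rw [← P.centre, List.length_map]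
    have h2 := placementSum_congr (taus := taus) le_rfl hw.2 P
      (γ := truthVal (1 + c.length) (fun Y d => tr w taus φ q Y d (y :: xs)) v)
      (fun Y d Y' d' g g' P' => truthVal_congr (fun Y d Y' d' g g' P' hd => by
        obtain ⟨p, h3, h4⟩ := ih (by omega) hw.1 P' (xs := y :: xs) (fun x h => by
          by_cases hxy : x = y
          · simp [hxy]
          · exact List.mem_cons_of_mem _ (hx x ⟨h, hxy⟩)) (by simp [hd, hl, Nat.add_comm]) v
        exact h3.symm.trans h4) P') v
    have h3 := h1 F c
    have h4 := h1 F' c'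
    rw [hlen, ← h2] at h4
    exact (sat_positive h3).trans (sat_positive h4).symm
  | pred Q t ih =>
    simp only [Expr.br, Expr.bw, Finset.sup_le_iff, Finset.mem_univ, true_imp_iff,
      Expr.freeVar, Finset.mem_biUnion, true_and, forall_exists_index] at hq hw hx
    have h1 := fun j => ih j (hq j) (hw j) P (fun x h => hx x j h) hl v
    choose z h2 h3 using h1
    exact ⟨z ∈ Ps.sem Q, Den.pred h2, Den.pred h3⟩
  | exNum κ φ ih =>
    refine ⟨_, (sat_boundedEx (Nat.le_add_right _ κ)).symm,
      Iff.trans ?_ (sat_boundedEx (Nat.le_add_right _ κ)).symm⟩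
    refine exists_congr fun m => and_congr_right fun _ => ?_
    obtain ⟨p, h1, h2⟩ := ih hq hw P hx hl (Function.update v (taus.length + κ) m)
    exact h1.symm.trans h2
  | count n hn y hy φ ih =>
    simp only [Expr.br, Expr.bw, max_le_iff, Expr.freeVar, Finset.mem_sdiff,
      Finset.mem_image, Finset.mem_univ, true_and] at hq hw hx
    obtain ⟨q, rfl⟩ : ∃ q', q = q' + 1 := ⟨q - 1, by omega⟩
    have h1 := fun (F : Facts) (c : List ℕ) => gden_placements (w := w) (q := q + 1) (n := n)
      (taus := taus) (F := F) (c := c) (fun Y d => tr w taus φ q Y d (List.ofFn y ++ xs)) v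
    have hlen : c'.length = c.length := by rw [← P.centre, List.length_map]
    have h2 := placementSum_congr (taus := taus) hn hw.1 P
      (γ := truthVal (n + c.length) (fun Y d => tr w taus φ q Y d (List.ofFn y ++ xs)) v)
      (fun Y d Y' d' g g' P' => truthVal_congr (fun Y d Y' d' g g' P' hd => by
        obtain ⟨p, h3, h4⟩ := ih (by omega) hw.2 P' (xs := List.ofFn y ++ xs) (fun x h => by
          by_cases hxy : ∃ j, y j = x
          · obtain ⟨j, rfl⟩ := hxy
            simp
          · exact List.mem_append_right _ (hx x ⟨h, hxy⟩)) (by simp [hd, hl]) v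
        exact h3.symm.trans h4) P') v
    have h4 := h1 F' c'
    rw [hlen, ← h2] at h4
    exact ⟨_, h1 F c, h4⟩
  | int i => exact ⟨_, den_const v _, den_const v _⟩
  | add s t ih1 ih2 =>
    simp only [Expr.br, Expr.bw, max_le_iff, Expr.freeVar, Finset.mem_union] at hq hw hx
    obtain ⟨p, h1, h2⟩ := ih1 hq.1 hw.1 P (fun x h => hx x (Or.inl h)) hl v
    obtain ⟨p', h3, h4⟩ := ih2 hq.2 hw.2 P (fun x h => hx x (Or.inr h)) hl v
    exact ⟨_, Den.add h1 h3, Den.add h2 h4⟩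
  | mul s t ih1 ih2 =>
    simp only [Expr.br, Expr.bw, max_le_iff, Expr.freeVar, Finset.mem_union] at hq hw hx
    obtain ⟨p, h1, h2⟩ := ih1 hq.1 hw.1 P (fun x h => hx x (Or.inl h)) hl v
    obtain ⟨p', h3, h4⟩ := ih2 hq.2 hw.2 P (fun x h => hx x (Or.inr h)) hl v
    exact ⟨_, Den.mul h1 h3, Den.mul h2 h4⟩
  | num κ => exact ⟨_, den_const v _, den_const v _⟩

end Translation

end FOCN

namespace FOCN

universe u v

section Correctness

variable {σ : Signature} {Name : Type u} {Ps : NumPreds Name}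

/-! ### Correctness of the translation -/

/-- The list of facts `F` describes the structure `S`, whose elements are numbered by `ι`. -/
structure Represents {A : Type v} (S : Struc σ A) (ι : A → ℕ) (F : Facts) : Prop where
  inj : Function.Injective ι
  facts : ∀ (R : ℕ) (t : List ℕ), (R, t) ∈ F ↔
    ∃ R' : σ.Sym, (R' : ℕ) = R ∧ ∃ s ∈ S.rel R', t = List.ofFn fun j => ι (s j)

theorem Represents.mem_iff {A : Type v} {S : Struc σ A} {ι : A → ℕ} {F : Facts}
    (h : Represents S ι F) (R : σ.Sym) (s : Fin (σ.ar R) → A) :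
    ((R : ℕ), List.ofFn fun j => ι (s j)) ∈ F ↔ s ∈ S.rel R := by
  rw [h.facts]
  constructor
  · rintro ⟨R', hR, s', hs', he⟩
    obtain rfl : R' = R := Fin.ext hR
    have h1 := List.ofFn_injective he
    have h2 : s = s' := funext fun j => h.inj (congrFun h1 j)
    rwa [h2]
  · exact fun hs => ⟨R, rfl, s, hs, rfl⟩

open Classical in
theorem ncard_eq_sum {A : Type v} [Finite A] {ι : A → ℕ} (hι : Function.Injective ι) {N : ℕ}
    (hN : ∀ u, u < N ↔ ∃ a, ι a = u) {n : ℕ} (p : (Fin n → A) → Prop) (f : List ℕ → ℤ)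
    (hf : ∀ a, f (List.ofFn fun j => ι (a j)) = if p a then 1 else 0) :
    (({a | p a}.ncard : ℕ) : ℤ) =
      ((prodList ((List.range n).map fun _ => List.range N)).map f).sum := by
  have := Fintype.ofFinite A
  rw [← List.sum_toFinset _ (nodup_prodList fun O hO => by
    obtain ⟨i, -, rfl⟩ := List.mem_map.1 hO
    exact List.nodup_range)]
  have h1 : (prodList ((List.range n).map fun _ => List.range N)).toFinset =
      Finset.univ.image fun a : Fin n → A => List.ofFn fun j => ι (a j) := by
    ext b
    simp only [List.mem_toFinset, Finset.mem_image, Finset.mem_univ, true_and,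
      mem_prodList_range 0, List.mem_range, hN]
    constructor
    · rintro ⟨hl, hb⟩
      choose a ha using hb
      refine ⟨fun j => a j j.2, List.ext_getElem (by simp [hl]) fun i h1 h2 => ?_⟩
      rw [List.getElem_ofFn, ← List.getD_eq_getElem _ 0 h2]
      exact ha i (by omega)
    · rintro ⟨a, rfl⟩
      refine ⟨by simp, fun i hi => ⟨a ⟨i, hi⟩, ?_⟩⟩
      simp [List.getD_eq_getElem?_getD, hi]
  rw [h1, Finset.sum_image fun a _ a' _ h => funext fun j => hι
    (congrFun (List.ofFn_injective h) j)]
  simp only [hf, Finset.sum_boole]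
  rw [Set.ncard_eq_toFinset_card']
  congr 2
  ext a
  simp

theorem val_sumVars (ℓ : ℕ) (v : ℕ → ℤ) :
    (ZTerm.sumVars ℓ).val v = ((List.range ℓ).map v).sum := by
  induction ℓ with
  | zero => rfl
  | succ ℓ ih => simp [ZTerm.sumVars, ZTerm.val, ih, List.range_succ]

theorem truthVal_tr_congr {w q m : ℕ} {taus : List (Facts × ℕ)} {φ : Formula σ Ps}
    (hq : φ.br ≤ q) (hw : φ.bw ≤ w) {xs : List ℕ} (hx : ∀ x ∈ φ.freeVar, x ∈ xs)
    (hm : xs.length = m) (v : ℕ → ℤ) {Y d Y' d' g g'} (P : PIso (rad w q) Y d Y' d' g g') :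
    truthVal m (fun Y d => tr w taus φ q Y d xs) v Y d =
      truthVal m (fun Y d => tr w taus φ q Y d xs) v Y' d' := by
  refine truthVal_congr (fun Y d Y' d' g g' P' hd => ?_) P
  obtain ⟨p, h3, h4⟩ := tr_invariant (taus := taus) φ hq hw P' hx (hm.trans hd.symm) v
  exact h3.symm.trans h4

/-- The translation of an expression relative to the whole structure denotes its value. -/
theorem tr_correct {A : Type v} [Finite A] {S : Struc σ A} {ι : A → ℕ} {F : Facts}
    (hS : Represents S ι F) {N : ℕ} (hN : ∀ u, u < N ↔ ∃ a, ι a = u)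
    {w R : ℕ} {taus : List (Facts × ℕ)} {kind : ℕ → ℕ} (hk : ∀ u < N, kind u < taus.length)
    (hkind : ∀ u < N, ∃ h h', PIso R F [u] (sphereAt taus (kind u)).1
      [(sphereAt taus (kind u)).2] h h') {k : Kind} (φ : Expr σ Ps k) {q : ℕ} (hq : φ.br ≤ q)
    (hw : φ.bw ≤ w) (hR : rad w q ≤ R) {c xs : List ℕ} (hc : ∀ x ∈ c, x < N)
    (hl : xs.length = c.length) {β : ℕ → A} {ν : ℕ → ℤ} {v : ℕ → ℤ}
    (hβ : ∀ x ∈ φ.freeVar, x ∈ xs ∧ ι (β x) = look xs c x)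
    (hv : ∀ t < taus.length, v t = ((Finset.range N).filter fun u => kind u = t).card)
    (hν : ∀ κ, v (taus.length + κ) = ν κ) :
    Den v (tr w taus φ q F c xs) (φ.sem S β ν) := by
  have hF : ∀ f ∈ F, ∀ x ∈ f.2, x < N := by
    intro f hf x hx
    obtain ⟨R', -, s, -, ht⟩ := (hS.facts f.1 f.2).1 hf
    rw [ht] at hx
    obtain ⟨j, rfl⟩ := (List.mem_ofFn' _ _).1 hx
    exact (hN _).2 ⟨_, rfl⟩
  induction φ generalizing q c xs β ν v with
  | eq x y =>
    simp only [Expr.freeVar, Finset.mem_insert, Finset.mem_singleton, forall_eq_or_imp,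
      forall_eq] at hβ
    refine Iff.trans ?_ sat_ite.symm
    rw [← hβ.1.2, ← hβ.2.2]
    exact hS.inj.eq_iff.symm
  | rel Q x =>
    simp only [Expr.freeVar, Finset.mem_image, Finset.mem_univ, true_and, forall_exists_index,
      forall_apply_eq_imp_iff] at hβ
    refine Iff.trans ?_ sat_ite.symm
    simp only [← (hβ _).2]
    exact (hS.mem_iff Q fun j => β (x j)).symm
  | neg φ ih => exact not_congr (ih hq hw hR hc hl hβ hv hν)
  | or φ ψ ih1 ih2 =>
    simp only [Expr.br, Expr.bw, max_le_iff, Expr.freeVar, Finset.mem_union] at hq hw hβ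
    exact or_congr (ih1 hq.1 hw.1 hR hc hl (fun x h => hβ x (Or.inl h)) hv hν)
      (ih2 hq.2 hw.2 hR hc hl (fun x h => hβ x (Or.inr h)) hv hν)
  | ex y φ ih =>
    classical
    simp only [Expr.br, Expr.bw, max_le_iff, Expr.freeVar, Finset.mem_sdiff,
      Finset.mem_singleton] at hq hw hβ
    obtain ⟨q, rfl⟩ : ∃ q', q = q' + 1 := ⟨q - 1, by omega⟩
    -- The quantifier is treated as the assertion that the number of witnesses is positive.
    have h1 := gden_placements (w := w) (q := q + 1) (n := 1)
      (taus := taus) (F := F) (c := c) (fun Y d => tr w taus φ q Y d (y :: xs)) v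
    rw [placementSum_eq_sum le_rfl hw.2 hR hF hc hk hkind hv (fun Y d Y' d' g g' P' =>
      truthVal_tr_congr (by omega) hw.1 (fun x h => by
        by_cases hxy : x = y
        · simp [hxy]
        · exact List.mem_cons_of_mem _ (hβ x ⟨h, hxy⟩).1) (by simp [hl, Nat.add_comm]) v P'),
      ← ncard_eq_sum hS.inj hN (fun a : Fin 1 → A =>
        φ.sem S (Function.update β y (a 0)) ν) _ ?_] at h1
    · refine Iff.trans ?_ (sat_positive h1).symm
      rw [Nat.one_le_cast, Nat.one_le_iff_ne_zero, ← Nat.pos_iff_ne_zero, Set.ncard_pos]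
      exact ⟨fun ⟨a, ha⟩ => ⟨fun _ => a, ha⟩, fun ⟨a, ha⟩ => ⟨a 0, ha⟩⟩
    · intro a
      have h2 := ih (q := q) (c := ι (a 0) :: c) (xs := y :: xs)
        (β := Function.update β y (a 0)) (by omega) hw.1 ((rad_mono (by omega)).trans hR)
        (by
          intro x hx
          rcases List.mem_cons.1 hx with rfl | hx
          · exact (hN _).2 ⟨_, rfl⟩
          · exact hc x hx) (by simp [hl]) (fun x h => by
          by_cases hxy : x = y
          · subst hxy
            exact ⟨by simp, by simp [look]⟩
          · have h3 := hβ x ⟨h, hxy⟩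
            refine ⟨List.mem_cons_of_mem _ h3.1, ?_⟩
            rw [Function.update_of_ne hxy, h3.2]
            exact (look_append_right (ys := [y]) (d := [ι (a 0)]) rfl (by simpa using hxy)).symm)
        hv hν
      have h3 : List.ofFn (fun j => ι (a j)) ++ c = ι (a 0) :: c := by simp
      simp only [truthVal, h3, List.length_cons, Nat.add_comm 1, true_and]
      exact if_congr h2.symm rfl rfl
  | pred Q t ih =>
    simp only [Expr.br, Expr.bw, Finset.sup_le_iff, Finset.mem_univ, true_imp_iff,
      Expr.freeVar, Finset.mem_biUnion, true_and, forall_exists_index] at hq hw hβ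
    exact Den.pred fun j => ih j (hq j) (hw j) hR hc hl (fun x h => hβ x j h) hv hν
  | exNum κ φ ih =>
    refine Iff.trans ?_ (sat_boundedEx (Nat.le_add_right _ κ)).symm
    have h1 : Nat.card A = N := by
      have h2 : Set.range ι = (Finset.range N : Set ℕ) := by
        ext u
        simp [hN]
      rw [← Nat.card_range_of_injective hS.inj, h2, Nat.card_eq_fintype_card]
      simp
    -- Every element has exactly one kind, so the counts add up to the size of the universe, which
    -- is the required range of the quantifier.
    have h2 : (ZTerm.sumVars taus.length).val v = N := by
      rw [val_sumVars]
      have h3 := sum_kinds hk hv fun _ => 1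
      simp only [mul_one] at h3
      rw [← h3]
      simp
    rw [h2]
    refine exists_congr fun m => and_congr ?_ ?_
    · rw [h1, Nat.cast_le]
    -- Number variables are named past the counts, so that updating one of them leaves the counts
    -- intact.
    · refine ih (v := Function.update v (taus.length + κ) m) hq hw hR hc hl hβ
        (fun t ht => ?_) fun κ' => ?_
      · rw [Function.update_of_ne (by omega)]
        exact hv t ht
      · by_cases hκ : κ' = κ
        · subst hκ
          simp
        · rw [Function.update_of_ne (by omega), Function.update_of_ne hκ]
          exact hν κ'
  | count n hn y hy φ ih =>
    classical
    simp only [Expr.br, Expr.bw, max_le_iff, Expr.freeVar, Finset.mem_sdiff,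
      Finset.mem_image, Finset.mem_univ, true_and] at hq hw hβ
    obtain ⟨q, rfl⟩ : ∃ q', q = q' + 1 := ⟨q - 1, by omega⟩
    have h1 := gden_placements (w := w) (q := q + 1) (n := n)
      (taus := taus) (F := F) (c := c) (fun Y d => tr w taus φ q Y d (List.ofFn y ++ xs)) v
    rw [placementSum_eq_sum hn hw.1 hR hF hc hk hkind hv (fun Y d Y' d' g g' P' =>
      truthVal_tr_congr (by omega) hw.2 (fun x h => by
        by_cases hxy : ∃ j, y j = x
        · obtain ⟨j, rfl⟩ := hxy
          simp
        · exact List.mem_append_right _ (hβ x ⟨h, hxy⟩).1) (by simp [hl]) v P'),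
      ← ncard_eq_sum hS.inj hN (fun a : Fin n → A =>
        φ.sem S (Function.extend y a β) ν) _ ?_] at h1
    · exact h1
    · intro a
      have h2 := ih (q := q) (c := List.ofFn (fun j => ι (a j)) ++ c) (xs := List.ofFn y ++ xs)
        (β := Function.extend y a β) (by omega) hw.2 ((rad_mono (by omega)).trans hR)
        (by
          intro x hx
          rcases List.mem_append.1 hx with hx | hx
          · obtain ⟨j, rfl⟩ := (List.mem_ofFn' _ _).1 hx
            exact (hN _).2 ⟨_, rfl⟩
          · exact hc x hx) (by simp [hl]) (fun x h => by
          by_cases hxy : ∃ j, y j = x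
          · obtain ⟨j, rfl⟩ := hxy
            refine ⟨by simp, ?_⟩
            rw [hy.extend_apply, look_append_left (by simp) (by simp), look_ofFn hy]
          · have h3 := hβ x ⟨h, hxy⟩
            refine ⟨List.mem_append_right _ h3.1, ?_⟩
            rw [Function.extend_apply' _ _ _ hxy, h3.2, look_append_right (by simp)]
            rw [List.mem_ofFn']
            exact hxy)
        hv hν
      have h3 : (List.ofFn (fun j => ι (a j)) ++ c).length = n + c.length := by simp
      simp only [truthVal, h3, true_and]
      exact if_congr h2.symm rfl rfl
  | int i => exact den_const v _
  | add s t ih1 ih2 =>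
    simp only [Expr.br, Expr.bw, max_le_iff, Expr.freeVar, Finset.mem_union] at hq hw hβ
    exact Den.add (ih1 hq.1 hw.1 hR hc hl (fun x h => hβ x (Or.inl h)) hv hν)
      (ih2 hq.2 hw.2 hR hc hl (fun x h => hβ x (Or.inr h)) hv hν)
  | mul s t ih1 ih2 =>
    simp only [Expr.br, Expr.bw, max_le_iff, Expr.freeVar, Finset.mem_union] at hq hw hβ
    exact Den.mul (ih1 hq.1 hw.1 hR hc hl (fun x h => hβ x (Or.inl h)) hv hν)
      (ih2 hq.2 hw.2 hR hc hl (fun x h => hβ x (Or.inr h)) hv hν)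
  | num κ =>
    have h1 := den_const (Ps := Ps) v (.var (taus.length + κ))
    rw [ZTerm.val, hν] at h1
    exact h1

/-! ### Boundedness and free variables of the translation -/

/-- All formulas in a list of guarded expressions are bounded and have only free variables
from `V`, and all expressions have the property `Q`. -/
def GBounded {α : Type*} (ℓ : ℕ) (V : Set ℕ) (Q : α → Prop) (L : List (ZFormula Ps × α)) : Prop :=
  ∀ p ∈ L, (p.1.IsBounded ℓ ∧ (p.1.free : Set ℕ) ⊆ V) ∧ Q p.2

/-- All variables of a term belong to `V`. -/
def VarsIn (V : Set ℕ) (t : ZTerm) : Prop := (t.vars : Set ℕ) ⊆ V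

/-- The formulas of a translation are bounded, and all free variables belong to `V`. -/
def OutBounded (ℓ : ℕ) (V : Set ℕ) : {k : Kind} → k.Out Ps → Prop
  | .formula, (ψ : ZFormula Ps) => ψ.IsBounded ℓ ∧ (ψ.free : Set ℕ) ⊆ V
  | .term, (L : List (ZFormula Ps × ZTerm)) =>
      GBounded ℓ V (VarsIn V) L

variable {ℓ : ℕ} {V : Set ℕ}

theorem top_bounded : OutBounded (Ps := Ps) (k := .formula) ℓ V ZFormula.top :=
  ⟨.eq _ _, by simp [ZFormula.top, ZFormula.free, ZTerm.vars]⟩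

theorem bot_bounded : OutBounded (Ps := Ps) (k := .formula) ℓ V ZFormula.bot :=
  ⟨.neg _ (top_bounded (Ps := Ps) (ℓ := ℓ) (V := V)).1,
    (top_bounded (Ps := Ps) (ℓ := ℓ) (V := V)).2⟩

theorem or_bounded {φ ψ : ZFormula Ps} (hφ : OutBounded (k := .formula) ℓ V φ)
    (hψ : OutBounded (k := .formula) ℓ V ψ) : OutBounded (k := .formula) ℓ V (φ.or ψ) :=
  ⟨.or _ _ hφ.1 hψ.1, by simpa [ZFormula.free] using ⟨hφ.2, hψ.2⟩⟩

theorem and_bounded {φ ψ : ZFormula Ps} (hφ : OutBounded (k := .formula) ℓ V φ)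
    (hψ : OutBounded (k := .formula) ℓ V ψ) : OutBounded (k := .formula) ℓ V (φ.and ψ) :=
  ⟨.neg _ (.or _ _ (.neg _ hφ.1) (.neg _ hψ.1)), by
    simpa [ZFormula.and, ZFormula.free] using ⟨hφ.2, hψ.2⟩⟩

theorem GBounded.combine {α β δ : Type*} {op : α → β → δ} {Q : α → Prop} {Q' : β → Prop}
    {Q'' : δ → Prop} (h : ∀ a b, Q a → Q' b → Q'' (op a b)) {L : List (ZFormula Ps × α)}
    {M : List (ZFormula Ps × β)} (hL : GBounded ℓ V Q L) (hM : GBounded ℓ V Q' M) :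
    GBounded ℓ V Q'' (combine ZFormula.and op L M) := by
  intro p hp
  obtain ⟨a, ha, hp⟩ := List.mem_flatMap.1 hp
  obtain ⟨b, hb, rfl⟩ := List.mem_map.1 hp
  exact ⟨and_bounded (hL a ha).1 (hM b hb).1, h _ _ (hL a ha).2 (hM b hb).2⟩

theorem gbounded_singleton {α : Type*} {Q : α → Prop} {a : α} (h : Q a) :
    GBounded (Ps := Ps) ℓ V Q [(ZFormula.top, a)] := by
  intro p hp
  rw [List.mem_singleton.1 hp]
  exact ⟨top_bounded, h⟩

theorem OutBounded.add {L M : Kind.Out Ps .term} (hL : OutBounded ℓ V L)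
    (hM : OutBounded ℓ V M) :
    OutBounded (k := .term) ℓ V (FOCN.combine ZFormula.and ZTerm.add L M) :=
  GBounded.combine (Q := VarsIn V) (Q' := VarsIn V) (fun a b ha hb => by
    simpa [VarsIn, ZTerm.vars] using ⟨ha, hb⟩) hL hM

theorem OutBounded.mul {L M : Kind.Out Ps .term} (hL : OutBounded ℓ V L)
    (hM : OutBounded ℓ V M) :
    OutBounded (k := .term) ℓ V (FOCN.combine ZFormula.and ZTerm.mul L M) :=
  GBounded.combine (Q := VarsIn V) (Q' := VarsIn V) (fun a b ha hb => by
    simpa [VarsIn, ZTerm.vars] using ⟨ha, hb⟩) hL hM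

theorem const_bounded {t : ZTerm} (h : VarsIn V t) :
    OutBounded (Ps := Ps) (k := .term) ℓ V [(ZFormula.top, t)] :=
  gbounded_singleton h

theorem countGl_bounded (hV : ∀ i < ℓ, i ∈ V) {cs : List ((Bool × List ℕ) × ZFormula Ps)}
    (h : ∀ κ ∈ cs, (∀ i ∈ κ.1.2, i < ℓ) ∧ OutBounded (k := .formula) ℓ V κ.2) :
    OutBounded (Ps := Ps) (k := .term) ℓ V (countGl cs) := by
  induction cs with
  | nil => exact const_bounded (by simp [VarsIn, ZTerm.vars])
  | cons κ cs ih =>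
    refine OutBounded.add ?_ (ih fun κ hκ => h κ (by simp [hκ]))
    have h1 := h κ (by simp)
    intro p hp
    simp only [List.mem_cons, List.not_mem_nil, or_false] at hp
    · rcases hp with rfl | rfl
      · refine ⟨h1.2, ?_⟩
        have h2 := h1.1
        unfold mono VarsIn
        generalize κ.1.2 = l at h2
        induction l with
        | nil => simp [ZTerm.vars]
        | cons i l ih =>
          simp only [List.mem_cons, forall_eq_or_imp] at h2
          simp only [List.foldr_cons, ZTerm.vars, Finset.coe_union, Finset.coe_singleton,
            Set.union_subset_iff, Set.singleton_subset_iff]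
          exact ⟨hV i h2.1, ih h2.2⟩
      · exact ⟨⟨.neg _ h1.2.1, h1.2.2⟩, by simp [VarsIn, ZTerm.vars]⟩

theorem positive_bounded {L : List (ZFormula Ps × ZTerm)}
    (h : OutBounded (Ps := Ps) (k := .term) ℓ V L) :
    OutBounded (k := .formula) ℓ V (positive L) := by
  induction L with
  | nil => exact bot_bounded
  | cons p L ih =>
    refine or_bounded (and_bounded (h p (by simp)).1 ⟨.le _ _, ?_⟩)
      (ih fun p hp => h p (by simp [hp]))
    simpa [ZFormula.free, ZTerm.vars, VarsIn] using (h p (by simp)).2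

theorem combineAll_bounded {Ls : List (List (ZFormula Ps × ZTerm))}
    (h : ∀ L ∈ Ls, OutBounded (Ps := Ps) (k := .term) ℓ V L) :
    GBounded ℓ V (fun l : List ZTerm => ∀ t ∈ l, VarsIn V t) (combineAll Ls) := by
  induction Ls with
  | nil => exact gbounded_singleton (by simp)
  | cons L Ls ih =>
    refine GBounded.combine (Q := VarsIn V) 
      (Q' := fun l : List ZTerm => ∀ t ∈ l, VarsIn V t) (fun a b ha hb => ?_)
      (h L (by simp)) (ih fun L hL => h L (by simp [hL]))
    simpa using ⟨ha, hb⟩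

theorem holds_bounded {P : Name} {L : List (ZFormula Ps × List ZTerm)}
    (h : GBounded ℓ V (fun l : List ZTerm => ∀ t ∈ l, VarsIn V t) L) :
    OutBounded (k := .formula) ℓ V (holds P L) := by
  induction L with
  | nil => exact bot_bounded
  | cons p L ih =>
    refine or_bounded (and_bounded (h p (by simp)).1 ⟨.pred _ _, ?_⟩)
      (ih fun p hp => h p (by simp [hp]))
    simp only [ZFormula.free, Finset.coe_biUnion, Set.iUnion_subset_iff]
    intro j _
    by_cases hj : (j : ℕ) < p.2.length
    · rw [List.getD_eq_getElem _ _ hj]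
      exact (h p (by simp)).2 _ (List.getElem_mem _)
    · rw [List.getD_eq_default _ _ (by omega)]
      simp [ZTerm.vars]

theorem vars_sumVars (ℓ : ℕ) : ∀ i ∈ (ZTerm.sumVars ℓ).vars, i < ℓ := by
  induction ℓ with
  | zero => simp [ZTerm.sumVars, ZTerm.vars]
  | succ ℓ ih =>
    intro i hi
    simp only [ZTerm.sumVars, ZTerm.vars, Finset.mem_union, Finset.mem_singleton] at hi
    rcases hi with hi | rfl
    · exact (ih i hi).trans (Nat.lt_succ_self ℓ)
    · exact Nat.lt_succ_self _

theorem tr_bounded {w : ℕ} {taus : List (Facts × ℕ)} {k : Kind} (φ : Expr σ Ps k) {q : ℕ}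
    {F : Facts} {c xs : List ℕ} {V : Set ℕ} (hV : ∀ i < taus.length, i ∈ V)
    (hφ : ∀ κ ∈ φ.freeNum, taus.length + κ ∈ V) :
    OutBounded taus.length V (tr w taus φ q F c xs) := by
  induction φ generalizing q F c xs V with
  | eq x y =>
    simp only [tr]
    split_ifs
    exacts [top_bounded, bot_bounded]
  | rel R x =>
    simp only [tr]
    split_ifs
    exacts [top_bounded, bot_bounded]
  | neg φ ih => exact ⟨.neg _ (ih hV hφ).1, (ih hV hφ).2⟩
  | or φ ψ ih1 ih2 =>
    simp only [Expr.freeNum, Finset.mem_union] at hφ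
    exact or_bounded (ih1 hV fun κ h => hφ κ (Or.inl h)) (ih2 hV fun κ h => hφ κ (Or.inr h))
  | ex y φ ih =>
    refine positive_bounded (countGl_bounded hV fun κ hκ => ?_)
    obtain ⟨κ', hκ', rfl⟩ := List.mem_map.1 hκ
    exact ⟨lt_of_mem_placements hκ', ih hV hφ⟩
  | pred P t ih =>
    simp only [Expr.freeNum, Finset.mem_biUnion, Finset.mem_univ, true_and,
      forall_exists_index] at hφ
    refine holds_bounded (combineAll_bounded fun L hL => ?_)
    obtain ⟨j, rfl⟩ := (List.mem_ofFn' _ _).1 hL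
    exact ih j hV fun κ h => hφ κ j h
  | exNum κ φ ih =>
    -- The quantified variable may occur in the body, so the induction hypothesis is used with the
    -- larger set; the quantifier removes the variable again.
    have h1 := ih (q := q) (F := F) (c := c) (xs := xs) (V := insert (taus.length + κ) V)
      (fun i hi => Or.inr (hV i hi)) fun κ' h => by
        by_cases hκ : κ' = κ
        · exact Or.inl (by rw [hκ])
        · exact Or.inr (hφ κ' (by simp [Expr.freeNum, h, hκ]))
    refine ⟨.ex _ (Nat.le_add_right _ _) _ h1.1, fun x hx => ?_⟩
    simp only [tr, boundedEx, ZFormula.free, ZFormula.and, ZTerm.vars, Finset.coe_sdiff,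
      Finset.coe_singleton, Set.mem_sdiff,
      Finset.mem_coe, Finset.coe_union, Set.mem_union, Set.mem_singleton_iff, Finset.notMem_empty, false_or] at hx
    rcases hx with ⟨(hx | hx | hx) | hx, hne⟩
    · exact absurd hx hne
    · exact absurd hx hne
    · exact hV x (vars_sumVars _ x hx)
    · exact (h1.2 hx).resolve_left hne
  | count n hn y hy φ ih =>
    refine countGl_bounded hV fun κ hκ => ?_
    obtain ⟨κ', hκ', rfl⟩ := List.mem_map.1 hκ
    exact ⟨lt_of_mem_placements hκ', ih hV hφ⟩
  | int i => exact const_bounded (by simp [VarsIn, ZTerm.vars])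
  | add s t ih1 ih2 =>
    simp only [Expr.freeNum, Finset.mem_union] at hφ
    exact OutBounded.add (ih1 hV fun κ h => hφ κ (Or.inl h)) (ih2 hV fun κ h => hφ κ (Or.inr h))
  | mul s t ih1 ih2 =>
    simp only [Expr.freeNum, Finset.mem_union] at hφ
    exact OutBounded.mul (ih1 hV fun κ h => hφ κ (Or.inl h)) (ih2 hV fun κ h => hφ κ (Or.inr h))
  | num κ => exact const_bounded (by
      simpa [VarsIn, ZTerm.vars] using hφ κ (by simp [Expr.freeNum]))

theorem val_congr {t : ZTerm} {v v' : ℕ → ℤ} (h : ∀ i ∈ t.vars, v i = v' i) :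
    t.val v = t.val v' := by
  induction t with
  | var n => exact h n (by simp [ZTerm.vars])
  | const i => rfl
  | add s t ih1 ih2 | mul s t ih1 ih2 =>
    simp only [ZTerm.vars, Finset.mem_union] at h
    simp only [ZTerm.val, ih1 fun i hi => h i (Or.inl hi), ih2 fun i hi => h i (Or.inr hi)]

theorem sat_congr {ψ : ZFormula Ps} {v v' : ℕ → ℤ} (h : ∀ i ∈ ψ.free, v i = v' i) :
    ψ.Sat v ↔ ψ.Sat v' := by
  induction ψ generalizing v v' with
  | eq s t | le s t =>
    simp only [ZFormula.free, Finset.mem_union] at h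
    simp only [ZFormula.Sat, val_congr fun i hi => h i (Or.inl hi),
      val_congr fun i hi => h i (Or.inr hi)]
  | pred P t =>
    simp only [ZFormula.free, Finset.mem_biUnion, Finset.mem_univ, true_and,
      forall_exists_index] at h
    simp only [ZFormula.Sat, val_congr fun i hi => h i _ hi]
  | neg φ ih => exact not_congr (ih h)
  | or φ ψ ih1 ih2 =>
    simp only [ZFormula.free, Finset.mem_union] at h
    exact or_congr (ih1 fun i hi => h i (Or.inl hi)) (ih2 fun i hi => h i (Or.inr hi))
  | ex n φ ih =>
    refine exists_congr fun m => ih fun i hi => ?_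
    by_cases hin : i = n
    · subst hin
      simp
    · rw [Function.update_of_ne hin, Function.update_of_ne hin]
      exact h i (by simp [ZFormula.free, hi, hin])

end Correctness

end FOCN

namespace FOCN

section PrimrecPlacements

/-! ### The operations on local structures are primitive recursive -/

variable {α β : Type*} [Primcodable α] [Primcodable β]

@[fun_prop] theorem primrec_ball {F : α → Facts} {c : α → List ℕ} {r : α → ℕ} (hF : Primrec F)
    (hc : Primrec c) (hr : Primrec r) : Primrec fun a => ball (F a) (c a) (r a) := by
  unfold ball
  fun_prop

@[fun_prop] theorem primrec_closeTo {F : α → Facts} {s : α → ℕ} {P Q : α → List ℕ}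
    (hF : Primrec F) (hs : Primrec s) (hP : Primrec P) (hQ : Primrec Q) :
    Primrec fun a => closeTo (F a) (s a) (P a) (Q a) := by
  unfold closeTo
  fun_prop

@[fun_prop] theorem primrec_relabel {f g h : α → ℕ} (hf : Primrec f) (hg : Primrec g)
    (hh : Primrec h) : Primrec fun a => relabel (f a) (g a) (h a) := by
  unfold relabel
  fun_prop

@[fun_prop] theorem primrec_lab {n : α → ℕ} {E : α → List (ℕ × ℕ)} {k : α → ℕ}
    (hn : Primrec n) (hE : Primrec E) (hk : Primrec k) :
    Primrec fun a => lab (n a) (E a) (k a) := by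
  unfold lab labs
  fun_prop

@[fun_prop] theorem primrec_posAt {c e : α → List ℕ} {i : α → ℕ} (hc : Primrec c)
    (he : Primrec e) (hi : Primrec i) : Primrec fun a => posAt (c a) (e a) (i a) := by
  unfold posAt
  fun_prop

@[fun_prop] theorem primrec_allClose {fams : α → ℕ → Facts} {n s : α → ℕ}
    {E : α → List (ℕ × ℕ)} {c e : α → List ℕ} (hfams : Primrec fun p : α × ℕ => fams p.1 p.2)
    (hn : Primrec n) (hs : Primrec s) (hE : Primrec E) (hc : Primrec c) (he : Primrec e) :
    Primrec fun a => allClose (fams a) (n a) (s a) (E a) (c a) (e a) := by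
  unfold allClose
  have : Primrec fun p : α × ℕ × ℕ => fams p.1 (lab (n p.1) (E p.1) p.2.1) :=
    hfams.comp (by fun_prop : Primrec fun p : α × ℕ × ℕ => (p.1, lab (n p.1) (E p.1) p.2.1))
  fun_prop

@[fun_prop] theorem primrec_placed {n : α → ℕ} {H : α → List (ℕ × ℕ)} {c e : α → List ℕ}
    (hn : Primrec n) (hH : Primrec H) (hc : Primrec c) (he : Primrec e) :
    Primrec fun a => placed (n a) (H a) (c a) (e a) := by
  unfold placed
  have : Primrec fun p : ℕ × ℕ => Nat.pair p.1 p.2 := by fun_prop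
  have : Primrec fun p : α × ℕ => Nat.pair 0 p.2 := by fun_prop
  fun_prop

@[fun_prop] theorem primrec_prodList {Os : α → List (List β)} (h : Primrec Os) :
    Primrec fun a => prodList (Os a) := by
  unfold prodList
  fun_prop

@[fun_prop] theorem primrec_signed {l : α → List β} (h : Primrec l) :
    Primrec fun a => signed (l a) := by
  unfold signed
  fun_prop

@[fun_prop] theorem primrec_spread {fams : α → ℕ → Facts} {n : α → ℕ} {E : α → List (ℕ × ℕ)}
    (hfams : Primrec fun p : α × ℕ => fams p.1 p.2) (hn : Primrec n) (hE : Primrec E) :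
    Primrec fun a => spread (fams a) (n a) (E a) := by
  unfold spread dunion
  have : Primrec fun p : α × ℕ => fams p.1 (lab (n p.1) (E p.1) p.2) :=
    hfams.comp (by fun_prop : Primrec fun p : α × ℕ => (p.1, lab (n p.1) (E p.1) p.2))
  have : Primrec fun p : ((α × ℕ) × ℕ × List ℕ) × ℕ => Nat.pair p.1.1.2 p.2 := by fun_prop
  fun_prop

@[fun_prop] theorem primrec_famsAt {F : α → Facts} {taus : α → List (Facts × ℕ)}
    {t : α → List ℕ} {l : α → ℕ} (hF : Primrec F) (htaus : Primrec taus) (ht : Primrec t)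
    (hl : Primrec l) : Primrec fun a => famsAt (F a) (taus a) (t a) (l a) := by
  unfold famsAt sphereAt
  fun_prop

@[fun_prop] theorem primrec_rootsAt {c : α → List ℕ} {taus : α → List (Facts × ℕ)}
    {t : α → List ℕ} {l : α → ℕ} (hc : Primrec c) (htaus : Primrec taus) (ht : Primrec t)
    (hl : Primrec l) : Primrec fun a => rootsAt (c a) (taus a) (t a) (l a) := by
  unfold rootsAt sphereAt
  fun_prop

@[fun_prop] theorem primrec_elemBound {F : α → Facts} {c : α → List ℕ}
    {taus : α → List (Facts × ℕ)} (hF : Primrec F) (hc : Primrec c) (htaus : Primrec taus) :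
    Primrec fun a => elemBound (F a) (c a) (taus a) := by
  unfold elemBound
  have : Primrec fun p : α × ℕ × ℕ => max p.2.1 p.2.2 := by fun_prop
  fun_prop

@[fun_prop] theorem primrec_rootKinds {n : α → ℕ} {E : α → List (ℕ × ℕ)} {t : α → List ℕ}
    (hn : Primrec n) (hE : Primrec E) (ht : Primrec t) :
    Primrec fun a => rootKinds (n a) (E a) (t a) := by
  unfold rootKinds
  fun_prop

@[fun_prop] theorem primrec_placements {w : α → ℕ} {taus : α → List (Facts × ℕ)} {q : α → ℕ}
    {F : α → Facts} {c : α → List ℕ} {n : α → ℕ} (hw : Primrec w) (htaus : Primrec taus)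
    (hq : Primrec q) (hF : Primrec F) (hc : Primrec c) (hn : Primrec n) :
    Primrec fun a => placements (w a) (taus a) (q a) (F a) (c a) (n a) := by
  unfold placements pairs
  have h1 : Primrec fun p : (α × Bool × List (ℕ × ℕ) × List (ℕ × ℕ)) × ℕ =>
      kindOptions (taus p.1.1).length (n p.1.1) p.1.2.2.1 p.2 := by
    unfold kindOptions
    fun_prop
  have h2 : Primrec fun p : ((α × Bool × List (ℕ × ℕ) × List (ℕ × ℕ)) × List ℕ) × ℕ =>
      entryOptions (rootsAt (c p.1.1.1) (taus p.1.1.1) p.1.2) (n p.1.1.1)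
        (elemBound (F p.1.1.1) (c p.1.1.1) (taus p.1.1.1)) p.1.1.2.2.1 p.2 := by
    unfold entryOptions
    fun_prop
  have h3 : Primrec fun p : (((α × Bool × List (ℕ × ℕ) × List (ℕ × ℕ)) × List ℕ) × List ℕ) × ℕ =>
      famsAt (F p.1.1.1.1) (taus p.1.1.1.1) p.1.1.2 p.2 := by fun_prop
  have h4 : Primrec fun p : ((α × Bool × List (ℕ × ℕ) × List (ℕ × ℕ)) × List ℕ) × List ℕ =>
      spread (famsAt (F p.1.1.1) (taus p.1.1.1) p.1.2) (n p.1.1.1) p.1.1.2.2.1 := by fun_prop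
  have h5 : Primrec fun p : ((α × Bool × List (ℕ × ℕ) × List (ℕ × ℕ)) × List ℕ) × List ℕ =>
      allClose (famsAt (F p.1.1.1) (taus p.1.1.1) p.1.2) (n p.1.1.1)
        (2 * rad (w p.1.1.1) (q p.1.1.1 - 1) + 1) p.1.1.2.2.1 (c p.1.1.1) p.2 := by
    unfold rad
    fun_prop
  fun_prop

@[fun_prop] theorem primrec_look {xs c : α → List ℕ} {x : α → ℕ} (hxs : Primrec xs)
    (hc : Primrec c) (hx : Primrec x) : Primrec fun a => look (xs a) (c a) (x a) := by
  unfold look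
  fun_prop

end PrimrecPlacements

end FOCN

namespace FOCN

universe u v

/-! ### Computing rank and width -/

section Codes

variable {σ : Signature} {Name : Type u} {Ps : NumPreds Name}

/-- The list with the given code. -/
def listOf (n : ℕ) : List ℕ := (Encodable.decode (α := List ℕ) n).getD []

theorem listOf_encode (l : List ℕ) : listOf (Encodable.encode l) = l := by
  simp [listOf]

@[fun_prop] theorem primrec_listOf {α : Type*} [Primcodable α] {f : α → ℕ} (hf : Primrec f) :
    Primrec fun a => listOf (f a) := by
  unfold listOf
  fun_prop

/-- The codes of the immediate subexpressions. -/
def subCodes (e : ℕ) : List ℕ :=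
  let a := e.unpair.2
  ([[], [], [a], [a.unpair.1, a.unpair.2], [a.unpair.2], listOf a.unpair.2, [a.unpair.2],
    [a.unpair.2], [], [a.unpair.1, a.unpair.2], [a.unpair.1, a.unpair.2], []] :
    List (List ℕ)).getD e.unpair.1 []

/-- The codes of the immediate subexpressions, limited to values below the given code. -/
def subCodesBelow (e : ℕ) : List ℕ := (subCodes e).filter fun a => Nat.blt a e

@[fun_prop] theorem primrec_subCodes {α : Type*} [Primcodable α] {f : α → ℕ} (hf : Primrec f) :
    Primrec fun a => subCodes (f a) := by
  unfold subCodes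
  fun_prop

/-- By t + b ≤ `Nat.pair t b`, a positive tag makes a code exceed everything below its argument. All
constructs with subexpressions have positive tags. -/
theorem lt_pair_of_le {t a b : ℕ} (ht : 1 ≤ t) (h : a ≤ b) : a < Nat.pair t b := by
  refine lt_of_le_of_lt h (lt_of_lt_of_le ?_ (Nat.add_le_pair t b))
  omega

theorem le_encode_of_mem {l : List ℕ} {a : ℕ} (h : a ∈ l) : a ≤ Encodable.encode l := by
  induction l with
  | nil => simp at h
  | cons b l ih =>
    rw [Encodable.encode_list_cons]
    rcases List.mem_cons.1 h with rfl | h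
    · exact (Nat.left_le_pair _ _).trans (Nat.le_succ _)
    · exact (ih h).trans ((Nat.right_le_pair _ _).trans (Nat.le_succ _))

theorem lt_of_mem_subCodes [Encodable Name] {k : Kind} (φ : Expr σ Ps k) :
    ∀ a ∈ subCodes φ.code, a < φ.code := by
  intro a ha
  cases φ <;> simp [subCodes, Expr.code, listOf_encode] at ha ⊢
  case neg φ => exact ha ▸ lt_pair_of_le (by omega) le_rfl
  case or φ ψ =>
    rcases ha with rfl | rfl
    · exact lt_pair_of_le (by omega) (Nat.left_le_pair _ _)
    · exact lt_pair_of_le (by omega) (Nat.right_le_pair _ _)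
  case ex y φ => exact ha ▸ lt_pair_of_le (by omega) (Nat.right_le_pair _ _)
  case pred P t =>
    obtain ⟨j, rfl⟩ := ha
    refine lt_pair_of_le (by omega) (le_trans ?_ (Nat.right_le_pair _ _))
    exact le_encode_of_mem ((List.mem_ofFn' _ _).2 ⟨j, rfl⟩)
  case exNum y φ => exact ha ▸ lt_pair_of_le (by omega) (Nat.right_le_pair _ _)
  case count y hy φ => exact ha ▸ lt_pair_of_le (by omega) (Nat.right_le_pair _ _)
  case add φ ψ =>
    rcases ha with rfl | rfl
    · exact lt_pair_of_le (by omega) (Nat.left_le_pair _ _)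
    · exact lt_pair_of_le (by omega) (Nat.right_le_pair _ _)
  case mul φ ψ =>
    rcases ha with rfl | rfl
    · exact lt_pair_of_le (by omega) (Nat.left_le_pair _ _)
    · exact lt_pair_of_le (by omega) (Nat.right_le_pair _ _)

/-- The filter only makes the recursion terminate on numbers that are not codes of expressions; on
codes it has no effect. -/
theorem subCodesBelow_code [Encodable Name] {k : Kind} (φ : Expr σ Ps k) :
    subCodesBelow φ.code = subCodes φ.code :=
  List.filter_eq_self.2 fun a ha => by
    simpa using lt_of_mem_subCodes φ a ha

theorem foldr_max_ofFn {n : ℕ} (f : Fin n → ℕ) :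
    (List.ofFn f).foldr max 0 = Finset.univ.sup f := by
  induction n with
  | zero => simp
  | succ n ih =>
    rw [List.ofFn_succ, List.foldr_cons, ih, Fin.univ_succ]
    simp [Finset.sup_map, Function.comp_def]

/-- Binding rank and binding width, computed from those of the subexpressions. -/
def rankComb (e : ℕ) (l : List (ℕ × ℕ)) : ℕ × ℕ :=
  ((l.map Prod.fst).foldr max 0 + ([0, 0, 0, 0, 1, 0, 0, 1] : List ℕ).getD e.unpair.1 0,
    max (([0, 0, 0, 0, 1, 0, 0, (listOf e.unpair.2.unpair.1).length] : List ℕ).getD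
      e.unpair.1 0) ((l.map Prod.snd).foldr max 0))

/-- A single function has to serve all signatures, because the signature is part of the input of the
algorithm. -/
theorem exists_primrec_rank : ∃ f : ℕ → ℕ × ℕ, Primrec f ∧
    ∀ {Name : Type u} [Encodable Name] {σ : Signature} {Ps : NumPreds Name} {k : Kind}
      (φ : Expr σ Ps k), f φ.code = (φ.br, φ.bw) := by
  obtain ⟨f, hf, h⟩ := exists_primrec_of_recursion (fun e : ℕ => e) subCodesBelow rankComb
    (by fun_prop) (by unfold subCodesBelow; fun_prop)
    (by
      unfold rankComb
      have : Primrec fun p : (ℕ × List (ℕ × ℕ)) × ℕ × ℕ => max p.2.1 p.2.2 := by fun_prop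
      fun_prop)
    (fun i j hj => by simpa using List.of_mem_filter hj)
  refine ⟨f, hf, fun {Name} _ {σ Ps k} φ => ?_⟩
  replace h : ∀ {k : Kind} (φ : Expr σ Ps k),
      f φ.code = rankComb φ.code ((subCodes φ.code).map f) := fun φ => by
    rw [h, subCodesBelow_code]
  induction φ with
  | pred P t ih =>
    rw [h]
    simp only [subCodes, Expr.code, Nat.unpair_pair, listOf_encode, rankComb,
      List.getD_cons_succ, List.getD_cons_zero, Expr.br, Expr.bw, List.map_ofFn,
      Function.comp_def, ih, foldr_max_ofFn]
    simp
  | _ =>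
    rw [h]
    clear h
    simp [subCodes, rankComb, Expr.code, Expr.br, Expr.bw, listOf_encode, max_comm, *]

end Codes

end FOCN

namespace FOCN

universe u v

/-! ### The translation on the level of codes -/

/-- The code of an integer constant. -/
def cConst (i : ℤ) : ℕ := Nat.pair 1 (Encodable.encode i)

/-- The code of the true sentence. -/
def cTop : ℕ := Nat.pair 0 (Nat.pair (cConst 0) (cConst 0))

/-- The code of a negation. -/
def cNeg (a : ℕ) : ℕ := Nat.pair 3 a

/-- The code of the false sentence. -/
def cBot : ℕ := cNeg cTop

/-- The code of a disjunction. -/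
def cOr (a b : ℕ) : ℕ := Nat.pair 4 (Nat.pair a b)

/-- The code of a conjunction. -/
def cAnd (a b : ℕ) : ℕ := cNeg (cOr (cNeg a) (cNeg b))

/-- The code of a binary expression with the given tag. -/
def cBin (t a b : ℕ) : ℕ := Nat.pair t (Nat.pair a b)

/-- The code of the term for a signed monomial. -/
def cMono (κ : Bool × List ℕ) : ℕ :=
  κ.2.foldr (fun i t => cBin 3 (Nat.pair 0 i) t) (bif κ.1 then cConst 1 else cConst (-1))

/-- `countGl` on the level of codes. -/
def cCountGl (cs : List ((Bool × List ℕ) × ℕ)) : List (ℕ × ℕ) :=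
  cs.foldr (fun κ acc => combine cAnd (cBin 2)
    [(κ.2, cMono κ.1), (cNeg κ.2, cConst 0)] acc) [(cTop, cConst 0)]

/-- `positive` on the level of codes. -/
def cPositive (L : List (ℕ × ℕ)) : ℕ :=
  L.foldr (fun p acc => cOr (cAnd p.1 (cBin 1 (cConst 1) p.2)) acc) cBot

/-- `combineAll` on the level of codes. -/
def cCombineAll (Ls : List (List (ℕ × ℕ))) : List (ℕ × List ℕ) :=
  Ls.foldr (fun L acc => combine cAnd List.cons L acc) [(cTop, [])]

/-- `holds` on the level of codes, for the predicate with number `P` and arity `m`. -/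
def cHolds (P m : ℕ) (L : List (ℕ × List ℕ)) : ℕ :=
  L.foldr (fun p acc => cOr (cAnd p.1 (cBin 2 (P + 1)
    (Encodable.encode ((List.range m).map fun j => p.2.getD j (cConst 0))))) acc) cBot

/-- `ZTerm.sumVars` on the level of codes. -/
def cSumVars (ℓ : ℕ) : ℕ :=
  Nat.rec (motive := fun _ => ℕ) (cConst 0) (fun j t => cBin 2 t (Nat.pair 0 j)) ℓ

/-- `boundedEx` on the level of codes. -/
def cBoundedEx (ℓ x a : ℕ) : ℕ :=
  cBin 5 x (cAnd (cAnd (cBin 1 (cConst 0) (Nat.pair 0 x)) (cBin 1 (Nat.pair 0 x) (cSumVars ℓ))) a)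

section

variable {α : Type*} [Primcodable α]

@[fun_prop] theorem primrec_cNeg {f : α → ℕ} (hf : Primrec f) : Primrec fun a => cNeg (f a) := by
  unfold cNeg
  fun_prop

@[fun_prop] theorem primrec_cOr {f g : α → ℕ} (hf : Primrec f) (hg : Primrec g) :
    Primrec fun a => cOr (f a) (g a) := by
  unfold cOr
  fun_prop

@[fun_prop] theorem primrec_cAnd {f g : α → ℕ} (hf : Primrec f) (hg : Primrec g) :
    Primrec fun a => cAnd (f a) (g a) := by
  unfold cAnd
  fun_prop

@[fun_prop] theorem primrec_cBin {t : ℕ} {f g : α → ℕ} (hf : Primrec f)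
    (hg : Primrec g) : Primrec fun a => cBin t (f a) (g a) := by
  unfold cBin
  fun_prop

@[fun_prop] theorem primrec_cMono {f : α → Bool × List ℕ} (hf : Primrec f) :
    Primrec fun a => cMono (f a) := by
  unfold cMono
  have : Primrec fun p : α × ℕ × ℕ => cBin 3 (Nat.pair 0 p.2.1) p.2.2 := by fun_prop
  fun_prop

theorem primrec_combine {β δ ε : Type*} [Primcodable β] [Primcodable δ] [Primcodable ε]
    {op : β → δ → ε} {L : α → List (ℕ × β)} {M : α → List (ℕ × δ)} (hL : Primrec L)
    (hM : Primrec M) (ho : Primrec fun p : β × δ => op p.1 p.2) :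
    Primrec fun a => combine cAnd op (L a) (M a) := by
  unfold combine
  have : Primrec fun p : (α × ℕ × β) × ℕ × δ => op p.1.2.2 p.2.2 :=
    ho.comp (by fun_prop : Primrec fun p : (α × ℕ × β) × ℕ × δ => (p.1.2.2, p.2.2))
  fun_prop

@[fun_prop] theorem primrec_combine_cBin {t : ℕ} {L M : α → List (ℕ × ℕ)} (hL : Primrec L)
    (hM : Primrec M) : Primrec fun a => combine cAnd (cBin t) (L a) (M a) :=
  primrec_combine hL hM (by fun_prop)

@[fun_prop] theorem primrec_combine_cons {L : α → List (ℕ × ℕ)} {M : α → List (ℕ × List ℕ)}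
    (hL : Primrec L) (hM : Primrec M) : Primrec fun a => combine cAnd List.cons (L a) (M a) :=
  primrec_combine hL hM (by fun_prop)

@[fun_prop] theorem primrec_cCountGl {f : α → List ((Bool × List ℕ) × ℕ)} (hf : Primrec f) :
    Primrec fun a => cCountGl (f a) := by
  unfold cCountGl
  fun_prop

@[fun_prop] theorem primrec_cPositive {f : α → List (ℕ × ℕ)} (hf : Primrec f) :
    Primrec fun a => cPositive (f a) := by
  unfold cPositive
  fun_prop

@[fun_prop] theorem primrec_cCombineAll {f : α → List (List (ℕ × ℕ))} (hf : Primrec f) :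
    Primrec fun a => cCombineAll (f a) := by
  unfold cCombineAll
  fun_prop

@[fun_prop] theorem primrec_cHolds {P m : α → ℕ} {f : α → List (ℕ × List ℕ)} (hP : Primrec P)
    (hm : Primrec m) (hf : Primrec f) : Primrec fun a => cHolds (P a) (m a) (f a) := by
  unfold cHolds
  fun_prop

@[fun_prop] theorem primrec_cSumVars {f : α → ℕ} (hf : Primrec f) :
    Primrec fun a => cSumVars (f a) := by
  unfold cSumVars
  fun_prop

@[fun_prop] theorem primrec_cBoundedEx {ℓ x f : α → ℕ} (hℓ : Primrec ℓ) (hx : Primrec x)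
    (hf : Primrec f) : Primrec fun a => cBoundedEx (ℓ a) (x a) (f a) := by
  unfold cBoundedEx
  fun_prop

end

section

variable {Name : Type u} [Encodable Name] {Ps : NumPreds Name}

theorem code_mono (κ : Bool × List ℕ) : (mono κ).code = cMono κ := by
  obtain ⟨b, l⟩ := κ
  unfold mono cMono
  induction l with
  | nil => cases b <;> rfl
  | cons i l ih =>
    simp only [List.foldr_cons, ZTerm.code, cBin] at ih ⊢
    rw [ih]

/-- Passing to codes commutes with `combine`. All code-level versions of operations on guarded terms
rest on this. -/
theorem map_combine {α β δ α' β' δ' : Type*} {op : α → β → δ} {op' : α' → β' → δ'}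
    {f : α → α'} {g : β → β'} {h : δ → δ'} (hop : ∀ a b, h (op a b) = op' (f a) (g b))
    (L : List (ZFormula Ps × α)) (M : List (ZFormula Ps × β)) :
    (combine ZFormula.and op L M).map (Prod.map ZFormula.code h) =
      combine cAnd op' (L.map (Prod.map ZFormula.code f)) (M.map (Prod.map ZFormula.code g)) := by
  simp [combine, List.map_flatMap, List.flatMap_map, Function.comp_def, hop]
  rfl

/-- The codes of guarded terms. -/
def codes (L : List (ZFormula Ps × ZTerm)) : List (ℕ × ℕ) :=
  L.map (Prod.map ZFormula.code ZTerm.code)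

theorem codes_add (L M : List (ZFormula Ps × ZTerm)) :
    codes (combine ZFormula.and ZTerm.add L M) = combine cAnd (cBin 2) (codes L) (codes M) :=
  map_combine (f := ZTerm.code) (g := ZTerm.code) (h := ZTerm.code) (fun _ _ => rfl) L M

theorem codes_mul (L M : List (ZFormula Ps × ZTerm)) :
    codes (combine ZFormula.and ZTerm.mul L M) = combine cAnd (cBin 3) (codes L) (codes M) :=
  map_combine (f := ZTerm.code) (g := ZTerm.code) (h := ZTerm.code) (fun _ _ => rfl) L M

theorem codes_countGl (cs : List ((Bool × List ℕ) × ZFormula Ps)) :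
    codes (countGl cs) = cCountGl (cs.map fun κ => (κ.1, κ.2.code)) := by
  induction cs with
  | nil => rfl
  | cons κ cs ih =>
    refine (codes_add _ _).trans ?_
    change combine cAnd (cBin 2) _ (codes (countGl cs)) = combine cAnd (cBin 2) _ _
    rw [ih]
    congr 1
    simp only [codes, List.map_cons, List.map_nil, Prod.map, code_mono]
    rfl

theorem code_positive (L : List (ZFormula Ps × ZTerm)) :
    (positive L).code = cPositive (codes L) := by
  induction L with
  | nil => rfl
  | cons p L ih =>
    change cOr _ (positive L).code = cOr _ (cPositive (codes L))
    rw [ih]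
    rfl

theorem map_combineAll (Ls : List (List (ZFormula Ps × ZTerm))) :
    (combineAll Ls).map (Prod.map ZFormula.code (List.map ZTerm.code)) =
      cCombineAll (Ls.map codes) := by
  induction Ls with
  | nil => rfl
  | cons L Ls ih =>
    refine (map_combine (op' := List.cons) (f := ZTerm.code)
      (g := List.map ZTerm.code) (h := List.map ZTerm.code) (fun _ _ => rfl) _ _).trans ?_
    change combine cAnd _ _ (List.map _ (combineAll Ls)) = combine cAnd _ _ _
    rw [ih]
    rfl

theorem code_holds (P : Name) (L : List (ZFormula Ps × List ZTerm)) :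
    (holds P L).code = cHolds (Encodable.encode P) (Ps.ar P)
      (L.map (Prod.map ZFormula.code (List.map ZTerm.code))) := by
  induction L with
  | nil => rfl
  | cons p L ih =>
    have h : (List.ofFn fun j : Fin (Ps.ar P) => (p.2.getD j (.const 0)).code) =
        (List.range (Ps.ar P)).map fun j => (p.2.map ZTerm.code).getD j (cConst 0) := by
      refine List.ext_getElem (by simp) fun i h1 h2 => ?_
      rw [List.getElem_ofFn, List.getElem_map, List.getElem_range]
      exact (List.getD_map (f := ZTerm.code) ..).symm
    -- The predicate is called `some P` in the extended collection, whence the number `encode P + 1`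
    -- in `cHolds`.
    change cOr (cAnd p.1.code (cBin 2 (Encodable.encode (some P)) (Encodable.encode
      (List.ofFn fun j : Fin (Ps.ar P) => (p.2.getD j (.const 0)).code)))) (holds P L).code = _
    rw [ih, h, Encodable.encode_some]
    rfl

theorem code_sumVars (ℓ : ℕ) : (ZTerm.sumVars ℓ).code = cSumVars ℓ := by
  induction ℓ with
  | zero => rfl
  | succ ℓ ih =>
    simp only [ZTerm.sumVars, ZTerm.code, ih]
    rfl

theorem code_boundedEx (ℓ x : ℕ) (χ : ZFormula Ps) :
    (boundedEx ℓ x χ).code = cBoundedEx ℓ x χ.code := by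
  unfold cBoundedEx
  rw [← code_sumVars]
  rfl

end

/-- Input of the translation: the width and the list of spheres, the rank, a structure with a tuple
for the given variables, and the code of an expression. -/
abbrev TrInput : Type := (ℕ × List (Facts × ℕ)) × ℕ × Facts × List ℕ × List ℕ × ℕ

/-- The structure variables bound by the outermost construct of the expression with code `e`. -/
def boundVars (e : ℕ) : List ℕ :=
  ([[], [], [], [], [e.unpair.2.unpair.1], [], [], listOf e.unpair.2.unpair.1] :
    List (List ℕ)).getD e.unpair.1 []

/-- The placements of the variables bound by the outermost construct. -/
def bindings (i : TrInput) : List ((Bool × List ℕ) × Facts × List ℕ) :=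
  placements i.1.1 i.1.2 i.2.1 i.2.2.1 i.2.2.2.1 (boundVars i.2.2.2.2.2).length

/-- The inputs for which the translation of the input `i` is based on the translation. -/
def trSub (i : TrInput) : List TrInput :=
  bif i.2.2.2.2.2.unpair.1 == 4 || i.2.2.2.2.2.unpair.1 == 7 then
    (bindings i).map fun κ => (i.1, i.2.1 - 1, κ.2.1, κ.2.2,
      boundVars i.2.2.2.2.2 ++ i.2.2.2.2.1, i.2.2.2.2.2.unpair.2.unpair.2)
  else (subCodes i.2.2.2.2.2).map fun b => (i.1, i.2.1, i.2.2.1, i.2.2.2.1, i.2.2.2.2.1, b)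

/-- The inputs of `trSub`, limited to expressions of smaller code. -/
def trSubBelow (i : TrInput) : List TrInput :=
  (trSub i).filter fun j => Nat.blt j.2.2.2.2.2 i.2.2.2.2.2

/-- The formula in the `j`-th output. -/
def formulaAt (l : List (List (ℕ × ℕ))) (j : ℕ) : ℕ := ((l.getD j []).getD 0 (0, 0)).1

/-- The guarded terms for the number of tuples. -/
def trCount (i : TrInput) (l : List (List (ℕ × ℕ))) : List (ℕ × ℕ) :=
  cCountGl (((bindings i).zip l).map fun κ => (κ.1.1, (κ.2.getD 0 (0, 0)).1))

/-- The truth value of an atom on the level of codes. -/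
def cTruth (b : Bool) : ℕ := bif b then cTop else cBot

/-- The translation of an expression, given the translations of its immediate subexpressions. -/
def trComb (i : TrInput) (l : List (List (ℕ × ℕ))) : List (ℕ × ℕ) :=
  let a := i.2.2.2.2.2.unpair.2
  let lk := look i.2.2.2.2.1 i.2.2.2.1
  ([[(cTruth (lk a.unpair.1 == lk a.unpair.2), 0)],
    [(cTruth (i.2.2.1.any fun f => f == (a.unpair.1, (listOf a.unpair.2).map lk)), 0)],
    [(cNeg (formulaAt l 0), 0)],
    [(cOr (formulaAt l 0) (formulaAt l 1), 0)],
    [(cPositive (trCount i l), 0)],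
    [(cHolds a.unpair.1 l.length (cCombineAll l), 0)],
    [(cBoundedEx i.1.2.length (i.1.2.length + a.unpair.1) (formulaAt l 0), 0)],
    trCount i l,
    [(cTop, Nat.pair 1 a)],
    combine cAnd (cBin 2) (l.getD 0 []) (l.getD 1 []),
    combine cAnd (cBin 3) (l.getD 0 []) (l.getD 1 []),
    [(cTop, Nat.pair 0 (i.1.2.length + a))]] : List (List (ℕ × ℕ))).getD i.2.2.2.2.2.unpair.1 []

section

variable {α : Type*} [Primcodable α]

theorem primrec_lawfulBeq {β : Type*} [Primcodable β] [BEq β] [LawfulBEq β] {f g : α → β}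
    (hf : Primrec f) (hg : Primrec g) : Primrec fun a => f a == g a := by
  classical
  exact (primrec_beq hf hg).of_eq fun a => by rw [Bool.eq_iff_iff]; simp

@[fun_prop] theorem primrec_boundVars {f : α → ℕ} (hf : Primrec f) :
    Primrec fun a => boundVars (f a) := by
  unfold boundVars
  fun_prop

@[fun_prop] theorem primrec_bindings {f : α → TrInput} (hf : Primrec f) :
    Primrec fun a => bindings (f a) := by
  unfold bindings
  fun_prop

@[fun_prop] theorem primrec_trSubBelow {f : α → TrInput} (hf : Primrec f) :
    Primrec fun a => trSubBelow (f a) := by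
  unfold trSubBelow trSub
  fun_prop

@[fun_prop] theorem primrec_formulaAt {f : α → List (List (ℕ × ℕ))} {g : α → ℕ}
    (hf : Primrec f) (hg : Primrec g) : Primrec fun a => formulaAt (f a) (g a) := by
  unfold formulaAt
  fun_prop

@[fun_prop] theorem primrec_trCount {f : α → TrInput} {g : α → List (List (ℕ × ℕ))}
    (hf : Primrec f) (hg : Primrec g) : Primrec fun a => trCount (f a) (g a) := by
  unfold trCount
  fun_prop

@[fun_prop] theorem primrec_cTruth {f : α → Bool} (hf : Primrec f) :
    Primrec fun a => cTruth (f a) := by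
  unfold cTruth
  fun_prop

@[fun_prop] theorem primrec_trComb {f : α → TrInput} {g : α → List (List (ℕ × ℕ))}
    (hf : Primrec f) (hg : Primrec g) : Primrec fun a => trComb (f a) (g a) := by
  unfold trComb
  dsimp only
  have : Primrec fun p : α × ℕ =>
      look (f p.1).2.2.2.2.1 (f p.1).2.2.2.1 p.2 := by fun_prop
  have : Primrec fun p : α × ℕ × List ℕ => p.2 == ((f p.1).2.2.2.2.2.unpair.2.unpair.1,
      (listOf (f p.1).2.2.2.2.2.unpair.2.unpair.2).map
        (look (f p.1).2.2.2.2.1 (f p.1).2.2.2.1)) := by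
    have : Primrec fun p : α × ℕ × List ℕ => (listOf (f p.1).2.2.2.2.2.unpair.2.unpair.2).map
        (look (f p.1).2.2.2.2.1 (f p.1).2.2.2.1) :=
      primrec_map (f := fun p : α × ℕ × List ℕ => listOf (f p.1).2.2.2.2.2.unpair.2.unpair.2)
        (by fun_prop) (by fun_prop)
    exact primrec_lawfulBeq (by fun_prop) (by fun_prop)
  fun_prop

end

/-! ### Agreement of the translation on codes with `tr`. -/

section

variable {σ : Signature} {Name : Type u} [Encodable Name] {Ps : NumPreds Name}

/-- The code of the output of the translation. -/
def Kind.outCode : {k : Kind} → k.Out Ps → List (ℕ × ℕ)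
  | .formula, (ψ : ZFormula Ps) => [(ψ.code, 0)]
  | .term, (L : List (ZFormula Ps × ZTerm)) => codes L

theorem code_ite {p : Prop} [Decidable p] {b : Bool} (h : b = true ↔ p) :
    (if p then ZFormula.top else ZFormula.bot : ZFormula Ps).code = cTruth b := by
  by_cases hp : p
  · rw [if_pos hp, h.2 hp]
    rfl
  · rw [if_neg hp, Bool.eq_false_iff.2 fun hb => hp (h.1 hb)]
    rfl

theorem trSubBelow_code {k : Kind} (φ : Expr σ Ps k) {W : ℕ × List (Facts × ℕ)} {q : ℕ}
    {F : Facts} {c xs : List ℕ} :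
    trSubBelow (W, q, F, c, xs, φ.code) = trSub (W, q, F, c, xs, φ.code) := by
  refine List.filter_eq_self.2 fun j hj => ?_
  have h1 : j.2.2.2.2.2 ∈ subCodes φ.code := by
    unfold trSub at hj
    rw [Bool.cond_eq_ite] at hj
    split_ifs at hj with h2
    · obtain ⟨κ, -, rfl⟩ := List.mem_map.1 hj
      simp only [Bool.or_eq_true, beq_iff_eq] at h2
      rcases h2 with h2 | h2 <;> simp [subCodes, h2]
    · obtain ⟨b, hb, rfl⟩ := List.mem_map.1 hj
      exact hb
  simpa using lt_of_mem_subCodes φ _ h1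

end

theorem map_zip_map {α β γ : Type*} (l : List α) (g : α → β) (h : α × β → γ) :
    (l.zip (l.map g)).map h = l.map fun x => h (x, g x) := by
  induction l with
  | nil => rfl
  | cons x l ih => simp [ih]

/-- The code of the expression alone is the measure of the recursion. The structure, the tuple and
the list of variables may grow at binders, but they are mere parameters. The placements at a binder
determine the recursive calls; they are computed once more afterwards, to pair their monomials with
the results. -/
theorem exists_primrec_tr : ∃ f : TrInput → List (ℕ × ℕ), Primrec f ∧
    ∀ {Name : Type u} [Encodable Name] {σ : Signature} {Ps : NumPreds Name} {k : Kind}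
      (φ : Expr σ Ps k) (w : ℕ) (taus : List (Facts × ℕ)) (q : ℕ) (F : Facts) (c xs : List ℕ),
      f ((w, taus), q, F, c, xs, φ.code) = Kind.outCode (tr w taus φ q F c xs) := by
  obtain ⟨f, hf, h⟩ := exists_primrec_of_recursion (fun i : TrInput => i.2.2.2.2.2) trSubBelow
    trComb (by fun_prop) (by fun_prop) (by fun_prop)
    (fun i j hj => by simpa using List.of_mem_filter hj)
  refine ⟨f, hf, fun {Name} _ {σ Ps k} φ w taus => ?_⟩
  replace h : ∀ {k : Kind} (φ : Expr σ Ps k) (q F c xs), f ((w, taus), q, F, c, xs, φ.code) =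
      trComb ((w, taus), q, F, c, xs, φ.code)
        ((trSub ((w, taus), q, F, c, xs, φ.code)).map f) := fun φ q F c xs => by
    rw [h, trSubBelow_code]
  induction φ with
  | eq x y =>
    intro q F c xs
    rw [h]
    simp only [trComb, Expr.code, Nat.unpair_pair, List.getD_cons_zero, tr, Kind.outCode]
    rw [code_ite (b := look xs c x == look xs c y) (by simp)]
  | rel R x =>
    intro q F c xs
    rw [h]
    simp only [trComb, Expr.code, Nat.unpair_pair, List.getD_cons_zero, List.getD_cons_succ, tr,
      Kind.outCode, listOf_encode, List.map_ofFn]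
    rw [code_ite (b := F.any fun f => f == ((R : ℕ), List.ofFn fun j => look xs c (x j)))
      (by simp)]
    rfl
  | neg φ ih =>
    intro q F c xs
    rw [h]
    simp [trComb, trSub, subCodes, Expr.code, formulaAt, ih]
    rfl
  | or φ ψ ih1 ih2 =>
    intro q F c xs
    rw [h]
    simp [trComb, trSub, subCodes, Expr.code, formulaAt, ih1, ih2]
    rfl
  | ex y φ ih =>
    intro q F c xs
    rw [h]
    simp [trComb, trSub, Expr.code, map_zip_map, ih, trCount, bindings, boundVars, tr,
      Kind.outCode, code_positive, codes_countGl]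
    rfl
  | pred P t ih =>
    intro q F c xs
    rw [h]
    -- The arity of the predicate is read off as the number of translated arguments, since `Ps.ar`
    -- need not be computable.
    simp [trComb, trSub, subCodes, Expr.code, formulaAt, ih, tr,
      Kind.outCode, code_holds, map_combineAll, listOf_encode]
    simp only [Function.comp_def, ih]
    rfl
  | exNum κ φ ih =>
    intro q F c xs
    rw [h]
    simp [trComb, trSub, subCodes, Expr.code, formulaAt, ih, tr, Kind.outCode, code_boundedEx]
  | count n hn y hy φ ih =>
    intro q F c xs
    rw [h]
    simp [trComb, trSub, Expr.code, map_zip_map, ih, trCount, bindings, boundVars, tr,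
      Kind.outCode, codes_countGl, listOf_encode]
    rfl
  | int i =>
    intro q F c xs
    rw [h]
    simp [trComb, Expr.code]
    rfl
  | add s t ih1 ih2 =>
    intro q F c xs
    rw [h]
    simp [trComb, trSub, subCodes, Expr.code, ih1, ih2, tr]
    exact (codes_add _ _).symm
  | mul s t ih1 ih2 =>
    intro q F c xs
    rw [h]
    simp [trComb, trSub, subCodes, Expr.code, ih1, ih2, tr]
    exact (codes_mul _ _).symm
  | num κ =>
    intro q F c xs
    rw [h]
    simp [trComb, Expr.code]
    rfl

end FOCN

namespace FOCN

universe u v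

/-! ### Lists of facts and structures -/

section Represents

variable {σ : Signature} {A : Type u} {B : Type v} {S : Struc σ A} {ι : A → ℕ} {F : Facts} {k : ℕ}

theorem exists_represents [Finite A] (S : Struc σ A) (hι : Function.Injective ι) :
    ∃ F, Represents S ι F := by
  have h : (⋃ R : σ.Sym, (fun s : Fin (σ.ar R) → A => ((R : ℕ), List.ofFn fun j => ι (s j))) ''
      S.rel R).Finite := Set.finite_iUnion fun R => (Set.toFinite _).image _
  refine ⟨h.toFinset.toList, hι, fun R t => ?_⟩
  simp only [Finset.mem_toList, Set.Finite.mem_toFinset, Set.mem_iUnion, Set.mem_image,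
    Prod.mk.injEq]
  constructor
  · rintro ⟨R', s, hs, rfl, rfl⟩
    exact ⟨R', rfl, s, hs, rfl⟩
  · rintro ⟨R', rfl, s, hs, rfl⟩
    exact ⟨R', s, hs, rfl, rfl⟩

theorem Represents.mem_range (h : Represents S ι F) {f : ℕ × List ℕ} (hf : f ∈ F) {x : ℕ}
    (hx : x ∈ f.2) : ∃ a, ι a = x := by
  obtain ⟨R, -, s, -, ht⟩ := (h.facts f.1 f.2).1 hf
  rw [ht] at hx
  obtain ⟨j, rfl⟩ := (List.mem_ofFn' _ _).1 hx
  exact ⟨_, rfl⟩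

theorem Represents.adj_iff (h : Represents S ι F) {a b : A} :
    S.gaifman.Adj a b ↔ a ≠ b ∧ F.Adj (ι a) (ι b) := by
  refine and_congr_right fun _ => ?_
  constructor
  · rintro ⟨R, t, ht, ⟨i, rfl⟩, j, rfl⟩
    exact ⟨_, (h.mem_iff R t).2 ht, (List.mem_ofFn' _ _).2 ⟨i, rfl⟩,
      (List.mem_ofFn' _ _).2 ⟨j, rfl⟩⟩
  · rintro ⟨f, hf, ha, hb⟩
    obtain ⟨R, -, s, hs, ht⟩ := (h.facts f.1 f.2).1 hf
    rw [ht] at ha hb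
    obtain ⟨i, hi⟩ := (List.mem_ofFn' _ _).1 ha
    obtain ⟨j, hj⟩ := (List.mem_ofFn' _ _).1 hb
    exact ⟨R, s, hs, ⟨i, h.inj hi⟩, j, h.inj hj⟩

theorem edist_le_succ_iff {G : SimpleGraph A} {a b : A} {r : ℕ} :
    G.edist a b ≤ (r + 1 : ℕ) ↔ G.edist a b ≤ r ∨ ∃ m, G.edist a m ≤ r ∧ G.Adj m b := by
  constructor
  · intro h
    obtain ⟨p, hp⟩ := SimpleGraph.exists_walk_of_edist_ne_top
      (ne_top_of_le_ne_top (ENat.natCast_ne_top _) h)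
    rw [← hp, Nat.cast_le] at h
    obtain ⟨p', hp'⟩ : ∃ p' : G.Walk b a, p'.length = p.length := ⟨p.reverse, p.length_reverse⟩
    cases p' with
    | nil => exact Or.inl (by simp)
    | cons hadj p' =>
      refine Or.inr ⟨_, ?_, hadj.symm⟩
      rw [SimpleGraph.edist_comm]
      refine (SimpleGraph.edist_le p').trans (Nat.cast_le.2 ?_)
      rw [SimpleGraph.Walk.length_cons] at hp'
      omega
  · rintro (h | ⟨m, h, hm⟩)
    · exact h.trans (Nat.cast_le.2 (Nat.le_succ r))
    · refine SimpleGraph.edist_triangle.trans ((add_le_add h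
        (SimpleGraph.edist_eq_one_iff_adj.2 hm).le).trans_eq ?_)
      simp

theorem Represents.within_iff (h : Represents S ι F) {a b : A} {r : ℕ} :
    Within F r (ι a) (ι b) ↔ S.gaifman.edist a b ≤ (r : ℕ∞) := by
  induction r generalizing b with
  | zero =>
    rw [Nat.cast_zero, nonpos_iff_eq_zero, SimpleGraph.edist_eq_zero_iff]
    exact h.inj.eq_iff
  | succ r ih =>
    rw [edist_le_succ_iff, ← ih]
    constructor
    · rintro (h1 | ⟨x, h1, h2⟩)
      · exact Or.inl h1
      · obtain ⟨f, hf, hx, hb⟩ := h2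
        obtain ⟨m, rfl⟩ := h.mem_range hf hx
        -- A step inside a fact may stand still, which is not an edge of the Gaifman graph.
        by_cases hmb : m = b
        · subst hmb
          exact Or.inl h1
        · exact Or.inr ⟨m, ih.1 h1, h.adj_iff.2 ⟨hmb, f, hf, hx, hb⟩⟩
    · rintro (h1 | ⟨m, h1, h2⟩)
      · exact Or.inl h1
      · exact Or.inr ⟨ι m, ih.2 h1, (h.adj_iff.1 h2).2⟩

theorem Represents.exists_of_within (h : Represents S ι F) {a : A} {x r : ℕ}
    (hx : Within F r (ι a) x) : ∃ b, ι b = x := by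
  induction r generalizing x with
  | zero => exact ⟨a, hx⟩
  | succ r ih =>
    rcases hx with hx | ⟨m, -, f, hf, -, hx⟩
    · exact ih hx
    · exact h.mem_range hf hx

theorem Represents.mem_nbhd_iff (h : Represents S ι F) {a : Fin k → A} {b : A} {r : ℕ} :
    b ∈ S.nbhd r a ↔ Near F r (List.ofFn fun j => ι (a j)) (ι b) := by
  simp only [Struc.nbhd, Set.mem_ofPred_eq, ← h.within_iff, Near, List.mem_ofFn', Set.mem_range,
    exists_exists_eq_and]

theorem Represents.exists_of_near (h : Represents S ι F) {a : Fin k → A} {x r : ℕ}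
    (hx : Near F r (List.ofFn fun j => ι (a j)) x) : ∃ b ∈ S.nbhd r a, ι b = x := by
  have hx' := hx
  obtain ⟨y, hy, hx⟩ := hx
  obtain ⟨j, rfl⟩ := (List.mem_ofFn' _ _).1 hy
  obtain ⟨b, rfl⟩ := h.exists_of_within hx
  exact ⟨b, h.mem_nbhd_iff.2 hx', rfl⟩

theorem Represents.dbounded_iff (h : Represents S ι F) {d : ℕ} :
    S.DBounded d ↔ ∀ a, {x | x ≠ ι a ∧ F.Adj (ι a) x}.ncard ≤ d := by
  refine forall_congr' fun a => ?_
  rw [← Set.ncard_image_of_injective _ h.inj]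
  refine Eq.to_iff (congrArg (fun s : Set ℕ => s.ncard ≤ d) ?_)
  ext x
  simp only [Set.mem_image, SimpleGraph.mem_neighborSet, Set.mem_ofPred_eq]
  constructor
  · rintro ⟨b, hb, rfl⟩
    have h1 := h.adj_iff.1 hb
    exact ⟨fun h2 => h1.1 (h.inj h2.symm), h1.2⟩
  · rintro ⟨h1, f, hf, ha, hx⟩
    obtain ⟨b, rfl⟩ := h.mem_range hf hx
    exact ⟨b, h.adj_iff.2 ⟨fun h2 => h1 (h2 ▸ rfl), f, hf, ha, hx⟩, rfl⟩

open Classical in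
theorem Represents.induce (h : Represents S ι F) (X : Set A) :
    Represents (S.induce X) (fun x => ι x)
      (F.filter fun f => decide (∀ x ∈ f.2, ∃ b ∈ X, ι b = x)) := by
  refine ⟨fun x y hxy => Subtype.ext (h.inj hxy), fun R t => ?_⟩
  rw [List.mem_filter, h.facts]
  simp only [decide_eq_true_eq]
  constructor
  · rintro ⟨⟨R', rfl, s, hs, rfl⟩, ht⟩
    have hs' : ∀ j, s j ∈ X := fun j => by
      obtain ⟨b, hb, hbj⟩ := ht _ ((List.mem_ofFn' _ _).2 ⟨j, rfl⟩)
      rwa [← h.inj hbj]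
    exact ⟨R', rfl, fun j => ⟨s j, hs' j⟩, hs, rfl⟩
  · rintro ⟨R', rfl, s, hs, rfl⟩
    refine ⟨⟨R', rfl, fun j => s j, hs, rfl⟩, fun x hx => ?_⟩
    obtain ⟨j, rfl⟩ := (List.mem_ofFn' _ _).1 hx
    exact ⟨s j, (s j).2, rfl⟩

/-- The image of a structure under a bijection. -/
def Struc.map (S : Struc σ A) (e : A ≃ B) : Struc σ B where
  rel R := {t | (fun j => e.symm (t j)) ∈ S.rel R}

theorem Represents.map (h : Represents S ι F) (e : A ≃ B) :
    Represents (S.map e) (fun b => ι (e.symm b)) F := by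
  refine ⟨h.inj.comp e.symm.injective, fun R t => ?_⟩
  rw [h.facts]
  refine exists_congr fun R' => and_congr_right fun _ => ?_
  constructor
  · rintro ⟨s, hs, rfl⟩
    refine ⟨fun j => e (s j), ?_, ?_⟩
    · change (fun j => e.symm (e (s j))) ∈ S.rel R'
      simpa using hs
    · simp
  · rintro ⟨s, hs, rfl⟩
    exact ⟨_, hs, rfl⟩

theorem iso_map (S : Struc σ A) (a : Fin k → A) (e : A ≃ B) :
    Iso S a (S.map e) fun j => e (a j) := by
  refine ⟨e, fun R t => ?_, fun _ => rfl⟩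
  simp [Struc.map]

theorem Iso.symm {S' : Struc σ B} {a : Fin k → A} {b : Fin k → B} (h : Iso S a S' b) :
    Iso S' b S a := by
  obtain ⟨e, h1, h2⟩ := h
  refine ⟨e.symm, fun R t => ?_, fun j => by simp [← h2]⟩
  simp [h1]

theorem Iso.trans {C : Type*} {S' : Struc σ B} {S'' : Struc σ C} {a : Fin k → A} {b : Fin k → B}
    {c : Fin k → C} (h : Iso S a S' b) (h' : Iso S' b S'' c) : Iso S a S'' c := by
  obtain ⟨e, h1, h2⟩ := h
  obtain ⟨e', h3, h4⟩ := h'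
  exact ⟨e.trans e', fun R t => by simp [h1, h3], fun j => by simp [h2, h4]⟩

theorem Iso.refl (S : Struc σ A) (a : Fin k → A) : Iso S a S a :=
  ⟨Equiv.refl A, fun _ _ => by simp, fun _ => rfl⟩

/-- A realisation of a type provides a local isomorphism between the lists of facts. -/
theorem exists_piso_of_realises (h : Represents S ι F) {r d : ℕ} {a : Fin k → A}
    {τ : PStruc σ k} (hτ : τ.IsType r d) (ha : S.Realises r a τ) {F' : Facts}
    (hF' : Represents τ.str (fun i => (i : ℕ)) F') :
    ∃ g g', PIso r F (List.ofFn fun j => ι (a j)) F' (List.ofFn fun j => (τ.centre j : ℕ))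
      g g' := by
  classical
  obtain ⟨e, h1, h2⟩ := ha
  let g : ℕ → ℕ := fun x => if hx : ∃ b : S.nbhd r a, ι b = x then e hx.choose else 0
  let g' : ℕ → ℕ := fun y => if hy : y < τ.size then ι (e.symm ⟨y, hy⟩) else 0
  have hg : ∀ b : S.nbhd r a, g (ι b) = e b := by
    intro b
    have hx : ∃ b' : S.nbhd r a, ι b' = ι b := ⟨b, rfl⟩
    have h3 : hx.choose = b := Subtype.ext (h.inj hx.choose_spec)
    simp only [g, dif_pos hx, h3]
  have hg' : ∀ i : Fin τ.size, g' i = ι (e.symm i) := fun i => by simp [g']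
  have hnear : ∀ x, Near F r (List.ofFn fun j => ι (a j)) x → ∃ b : S.nbhd r a, ι b = x :=
    fun x hx => by
      obtain ⟨b, hb, rfl⟩ := h.exists_of_near hx
      exact ⟨⟨b, hb⟩, rfl⟩
  refine ⟨g, g', fun x hx => ?_, fun y hy => ?_, fun R t ht => ?_, ?_⟩
  · obtain ⟨b, rfl⟩ := hnear x hx
    rw [hg, hg', e.symm_apply_apply]
    refine ⟨hF'.mem_nbhd_iff.1 ?_, rfl⟩
    rw [hτ.1]
    trivial
  · obtain ⟨i, -, rfl⟩ := hF'.exists_of_near hy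
    rw [hg', hg, e.apply_symm_apply]
    exact ⟨h.mem_nbhd_iff.1 (e.symm i).2, rfl⟩
  · rw [h.facts, hF'.facts]
    refine exists_congr fun R' => and_congr_right fun _ => ?_
    constructor
    · rintro ⟨s, hs, rfl⟩
      have hs' : ∀ j, s j ∈ S.nbhd r a := fun j =>
        h.mem_nbhd_iff.2 (ht _ ((List.mem_ofFn' _ _).2 ⟨j, rfl⟩))
      refine ⟨fun j => e ⟨s j, hs' j⟩, (h1 R' _).1 hs, ?_⟩
      rw [List.map_ofFn]
      exact congrArg List.ofFn (funext fun j => hg ⟨s j, hs' j⟩)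
    · rintro ⟨s, hs, hts⟩
      refine ⟨fun j => (e.symm (s j) : A), ?_, ?_⟩
      · exact (h1 R' fun j => e.symm (s j)).2 (by simpa using hs)
      · have h3 : t = (t.map g).map g' := by
          rw [List.map_map]
          refine (List.map_id t).symm.trans (List.map_congr_left fun x hx => ?_)
          obtain ⟨b, rfl⟩ := hnear x (ht x hx)
          simp [hg, hg']
        rw [h3, hts, List.map_ofFn]
        exact congrArg List.ofFn (funext fun j => hg' (s j))
  · rw [List.map_ofFn]
    refine congrArg List.ofFn (funext fun j => ?_)
    rw [← h2 j]
    exact hg ⟨a j, S.mem_nbhd r a j⟩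

/-- The sphere of a tuple in a `d`-bounded structure is, up to isomorphism, a type. -/
theorem exists_isType [Finite A] (S : Struc σ A) {d : ℕ} (hS : S.DBounded d) (r : ℕ)
    (a : Fin k → A) : ∃ τ : PStruc σ k, τ.IsType r d ∧ S.Realises r a τ := by
  classical
  obtain ⟨N, ⟨e⟩⟩ := Finite.exists_equiv_fin A
  let ι : A → ℕ := fun x => e x
  have hι : Function.Injective ι := fun x y h => e.injective (Fin.ext h)
  obtain ⟨F, hF⟩ := exists_represents S hι
  obtain ⟨M, ⟨e'⟩⟩ := Finite.exists_equiv_fin (S.nbhd r a)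
  have hX := (hF.induce (S.nbhd r a))
  have hM := hX.map e'
  set F' := F.filter fun f => decide (∀ x ∈ f.2, ∃ b ∈ S.nbhd r a, ι b = x) with hF'
  -- A walk of length at most `r` from a centre, with all facts that it uses, stays inside the
  -- sphere. So the elements of the sphere remain within `r` of the centres in the induced
  -- substructure.
  have hw : ∀ (j : Fin k) (s : ℕ) (x : ℕ), s ≤ r → Within F s (ι (a j)) x →
      Within F' s (ι (a j)) x := by
    intro j s
    induction s with
    | zero => exact fun x _ h => h
    | succ s ih =>
      rintro x hs (h | ⟨m, h, f, hf, hm, hx⟩)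
      · exact Or.inl (ih x (by omega) h)
      · refine Or.inr ⟨m, ih m (by omega) h, f, List.mem_filter.2 ⟨hf, ?_⟩, hm, hx⟩
        rw [decide_eq_true_eq]
        intro y hy
        refine hF.exists_of_near ⟨_, (List.mem_ofFn' _ _).2 ⟨j, rfl⟩, ?_⟩
        exact within_mono (within_trans h (within_of_adj ⟨f, hf, hm, hy⟩)) hs
  refine ⟨⟨M, (S.induce (S.nbhd r a)).map e', fun j => e' ⟨a j, S.mem_nbhd r a j⟩⟩,
    ⟨?_, ?_⟩, iso_map _ _ _⟩
  · refine Set.eq_univ_of_forall fun i => hM.mem_nbhd_iff.2 ?_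
    obtain ⟨y, hy, h1⟩ := hF.mem_nbhd_iff.1 (e'.symm i).2
    obtain ⟨j, rfl⟩ := (List.mem_ofFn' _ _).1 hy
    exact ⟨ι (a j), (List.mem_ofFn' _ _).2 ⟨j, by simp⟩, hw j r _ le_rfl h1⟩
  · rw [hM.dbounded_iff]
    intro i
    refine (Set.ncard_le_ncard ?_ ?_).trans (hF.dbounded_iff.1 hS (e'.symm i))
    · rintro x ⟨h1, f, hf, h2, h3⟩
      exact ⟨h1, f, (List.mem_filter.1 hf).1, h2, h3⟩
    -- Monotonicity of `ncard` requires the larger set of neighbours to be finite.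
    · refine (Set.finite_range ι).subset ?_
      rintro x ⟨-, f, hf, -, hx⟩
      exact hF.mem_range hf hx

end Represents

end FOCN

namespace FOCN

universe u v

/-! ### Lists of facts from codes of structures -/

/-- The position of a tuple in the table of a relation. -/
def tupleIndex (N : ℕ) (t : List ℕ) : ℕ := t.foldr (fun x acc => x + N * acc) 0

/-- Both sides are the number with base-`N` digits `s`, the first entry being the least significant
one. -/
theorem tupleIndex_ofFn {N m : ℕ} (s : Fin m → Fin N) :
    tupleIndex N (List.ofFn fun j => (s j : ℕ)) = finFunctionFinEquiv s := by
  rw [finFunctionFinEquiv_apply]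
  induction m with
  | zero => simp [tupleIndex]
  | succ m ih =>
    have h := ih fun j => s j.succ
    rw [tupleIndex] at h ⊢
    rw [List.ofFn_succ, List.foldr_cons, h, Fin.sum_univ_succ, Finset.mul_sum]
    simp only [Fin.val_zero, pow_zero, mul_one, Fin.val_succ, pow_succ]
    congr 1
    exact Finset.sum_congr rfl fun j _ => by ring

/-- The facts of a structure with the given arities, universe and tables. -/
def factsOf (ar : List ℕ) (N : ℕ) (tabs : List (List Bool)) : Facts :=
  (List.range ar.length).flatMap fun R =>
    ((prodList ((List.range (ar.getD R 0)).map fun _ => List.range N)).filter fun t =>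
      (tabs.getD R []).getD (tupleIndex N t) false).map fun t => (R, t)

/-- The spheres with the given codes. -/
def tausOf (ar : List ℕ) (l : List (ℕ × List (List Bool) × List ℕ)) : List (Facts × ℕ) :=
  l.map fun x => (factsOf ar x.1 x.2.1, x.2.2.getD 0 0)

section

variable {α : Type*} [Primcodable α]

@[fun_prop] theorem primrec_tupleIndex {N : α → ℕ} {t : α → List ℕ} (hN : Primrec N)
    (ht : Primrec t) : Primrec fun a => tupleIndex (N a) (t a) := by
  unfold tupleIndex
  fun_prop

@[fun_prop] theorem primrec_factsOf {ar : α → List ℕ} {N : α → ℕ} {tabs : α → List (List Bool)}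
    (har : Primrec ar) (hN : Primrec N) (htabs : Primrec tabs) :
    Primrec fun a => factsOf (ar a) (N a) (tabs a) := by
  unfold factsOf
  fun_prop

@[fun_prop] theorem primrec_tausOf {ar : α → List ℕ}
    {l : α → List (ℕ × List (List Bool) × List ℕ)} (har : Primrec ar) (hl : Primrec l) :
    Primrec fun a => tausOf (ar a) (l a) := by
  unfold tausOf
  fun_prop

end

section

variable {σ : Signature} {k : ℕ}

theorem tuple_of_forall_lt {N m : ℕ} {t : List ℕ} (hl : t.length = m)
    (h : ∀ i < m, t.getD i 0 < N) : ∃ s : Fin m → Fin N, t = List.ofFn fun j => (s j : ℕ) := by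
  refine ⟨fun j => ⟨t.getD j 0, h j j.2⟩, List.ext_getElem (by simp [hl]) fun i h1 h2 => ?_⟩
  simp [h1]

open Classical in
theorem PStruc.code_tab (τ : PStruc σ k) (R : σ.Sym) (s : Fin (σ.ar R) → Fin τ.size) :
    (τ.code.2.1.getD R []).getD (finFunctionFinEquiv s) false = true ↔ s ∈ τ.str.rel R := by
  have h1 : τ.code.2.1.getD R [] = List.ofFn fun i : Fin (τ.size ^ σ.ar R) =>
      decide (finFunctionFinEquiv.symm i ∈ τ.str.rel R) := by
    simp [PStruc.code, List.getD_eq_getElem?_getD]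
  rw [h1]
  rw [List.getD_eq_getElem _ _ (by rw [List.length_ofFn]; exact (finFunctionFinEquiv s).2), List.getElem_ofFn]
  simp only [decide_eq_true_eq, Fin.eta, Equiv.symm_apply_apply]

theorem PStruc.represents (τ : PStruc σ k) :
    Represents τ.str (fun i => (i : ℕ)) (factsOf σ.arities τ.code.1 τ.code.2.1) := by
  refine ⟨Fin.val_injective, fun R t => ?_⟩
  simp only [factsOf, List.mem_flatMap, List.mem_range, List.mem_map, List.mem_filter,
    Prod.mk.injEq, mem_prodList_range 0]
  constructor
  · rintro ⟨R', hR', t', ⟨⟨hl, ht⟩, h1⟩, rfl, rfl⟩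
    have h2 : σ.arities.getD R' 0 = σ.ar ⟨R', hR'⟩ := by simp [Signature.ar, hR']
    rw [h2] at hl ht
    obtain ⟨s, rfl⟩ := tuple_of_forall_lt hl ht
    refine ⟨⟨R', hR'⟩, rfl, s, ?_, rfl⟩
    rw [tupleIndex_ofFn] at h1
    exact (τ.code_tab ⟨R', hR'⟩ s).1 h1
  · rintro ⟨R', rfl, s, hs, rfl⟩
    have h2 : σ.arities.getD R' 0 = σ.ar R' := by simp [Signature.ar]
    refine ⟨R', R'.2, _, ⟨⟨by simp, fun i hi => ?_⟩, ?_⟩, rfl, rfl⟩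
    · rw [h2] at hi
      simp only [List.getD_eq_getElem?_getD, List.getElem?_ofFn, hi, dif_pos, Option.getD_some]
      exact (s ⟨i, hi⟩).2
    · rw [show τ.code.1 = τ.size from rfl, tupleIndex_ofFn]
      exact (τ.code_tab R' s).2 hs

/-- Every element of a `d`-bounded structure realises exactly one type, whose position in the list
of types is its kind. -/
theorem exists_kind {A : Type v} [Finite A] {S : Struc σ A} {r d : ℕ} (hS : S.DBounded d)
    {T : List (PStruc σ 1)}
    (hT : ∀ τ : PStruc σ 1, τ.IsType r d →
      ∃! i : Fin T.length, Iso τ.str τ.centre (T.get i).str (T.get i).centre) :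
    ∃ kind : A → Fin T.length, ∀ a i, S.Realises r (fun _ => a) (T.get i) ↔ kind a = i := by
  have h : ∀ a : A, ∃! i : Fin T.length, S.Realises r (fun _ => a) (T.get i) := by
    intro a
    obtain ⟨τ, hτ, haτ⟩ := exists_isType S hS r fun _ : Fin 1 => a
    obtain ⟨i, hi, hu⟩ := hT τ hτ
    exact ⟨i, haτ.trans hi, fun j hj => hu j (haτ.symm.trans hj)⟩
  choose kind h1 h2 using h
  exact ⟨kind, fun a i => ⟨fun h => (h2 a i h).symm, fun h => h ▸ h1 a⟩⟩

end

/-! ### The translation computes the truth value -/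

section

variable {σ : Signature} {Name : Type u} {Ps : NumPreds Name}

/-- Correctness holds relative to a list of facts for the whole structure, where each element is
given the position of its type as its kind. The realisation of `ρ` then provides a local isomorphism
along which the structure is exchanged for `ρ`. -/
theorem sat_tr_iff {d k : ℕ} {φ : Formula σ Ps} {x : Fin k → ℕ} (hx : Function.Injective x)
    (hfree : (φ.freeVar : Set ℕ) ⊆ Set.range x) {T : List (PStruc σ 1)}
    (hT : ∀ τ ∈ T, τ.IsType φ.radius d)
    (hT' : ∀ τ : PStruc σ 1, τ.IsType φ.radius d →
      ∃! i : Fin T.length, Iso τ.str τ.centre (T.get i).str (T.get i).centre)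
    {ρ : PStruc σ k} (hρ : ρ.IsType φ.radius d) {A : Type v} [Finite A] {S : Struc σ A}
    (hS : S.DBounded d) {a : Fin k → A} (ha : S.Realises φ.radius a ρ) {β : ℕ → A} {ν : ℕ → ℤ}
    (hβ : ∀ j, β (x j) = a j) {v : ℕ → ℤ}
    (hv : ∀ i : Fin T.length, v i = (S.numReal φ.radius (T.get i) : ℤ))
    (hν : ∀ κ, v (T.length + κ) = ν κ) :
    φ.sem S β ν ↔ ZFormula.Sat (tr φ.bw (tausOf σ.arities (T.map PStruc.code)) φ φ.br
      (factsOf σ.arities ρ.code.1 ρ.code.2.1) ρ.code.2.2 (List.ofFn x)) v := by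
  classical
  obtain ⟨N, ⟨e⟩⟩ := Finite.exists_equiv_fin A
  let ι : A → ℕ := fun y => e y
  have hι : Function.Injective ι := fun y z h => e.injective (Fin.ext h)
  have hN : ∀ u, u < N ↔ ∃ a, ι a = u := fun u =>
    ⟨fun h => ⟨e.symm ⟨u, h⟩, by simp [ι]⟩, fun ⟨b, hb⟩ => hb ▸ (e b).2⟩
  obtain ⟨F, hF⟩ := exists_represents S hι
  obtain ⟨kd, hkd⟩ := exists_kind hS hT'
  set taus := tausOf σ.arities (T.map PStruc.code) with htaus
  have hlen : taus.length = T.length := by simp [htaus, tausOf]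
  let kind : ℕ → ℕ := fun u => if h : u < N then kd (e.symm ⟨u, h⟩) else 0
  have hkind : ∀ b, kind (ι b) = kd b := fun b => by simp [kind, ι]
  have hsph : ∀ i : Fin T.length, sphereAt taus i =
      (factsOf σ.arities (T.get i).code.1 (T.get i).code.2.1, ((T.get i).centre 0 : ℕ)) := by
    intro i
    simp [sphereAt, htaus, tausOf, List.getD_eq_getElem?_getD, PStruc.code]
  have h1 : Den v (tr φ.bw taus φ φ.br F (List.ofFn fun j => ι (a j)) (List.ofFn x))
      (φ.sem S β ν) := by
    refine tr_correct (R := φ.radius) hF hN (kind := kind) (fun u hu => ?_) (fun u hu => ?_) φ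
      le_rfl le_rfl le_rfl (fun y hy => ?_) (by simp) (fun y hy => ?_) (fun t ht => ?_)
      (fun κ => by rw [hlen, hν])
    · obtain ⟨b, rfl⟩ := (hN u).1 hu
      rw [hkind, hlen]
      exact (kd b).2
    · obtain ⟨b, rfl⟩ := (hN u).1 hu
      rw [hkind, hsph]
      have h2 := exists_piso_of_realises hF (hT _ (List.get_mem T (kd b)))
        ((hkd b (kd b)).2 rfl) (T.get (kd b)).represents
      simpa using h2
    · obtain ⟨j, rfl⟩ := (List.mem_ofFn' _ _).1 hy
      exact (hN _).2 ⟨_, rfl⟩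
    · obtain ⟨j, rfl⟩ := hfree hy
      refine ⟨(List.mem_ofFn' _ _).2 ⟨j, rfl⟩, ?_⟩
      rw [look_ofFn hx, hβ]
    · rw [hlen] at ht
      rw [hv ⟨t, ht⟩, Struc.numReal, ← Set.ncard_image_of_injective _ hι,
        ← Set.ncard_coe_finset]
      congr 2
      ext u
      simp only [Set.mem_image, Set.mem_ofPred_eq, hkd, Finset.coe_filter, Finset.mem_range]
      constructor
      · rintro ⟨b, hb, rfl⟩
        exact ⟨(hN _).2 ⟨b, rfl⟩, by rw [hkind, hb]⟩
      · rintro ⟨hu, hut⟩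
        obtain ⟨b, rfl⟩ := (hN u).1 hu
        rw [hkind] at hut
        exact ⟨b, Fin.ext hut, rfl⟩
  obtain ⟨g, g', P⟩ := exists_piso_of_realises hF hρ ha ρ.represents
  obtain ⟨p, h2, h3⟩ := tr_invariant (taus := taus) φ (q := φ.br) le_rfl le_rfl P
    (xs := List.ofFn x) (fun y hy => by
      obtain ⟨j, rfl⟩ := hfree hy
      exact (List.mem_ofFn' _ _).2 ⟨j, rfl⟩) (by simp) v
  exact (Iff.trans h1 (Iff.symm h2)).trans h3

/-- Every computable list of types yields an algorithm that constructs the bounded formulas. -/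
theorem exists_algorithm [Encodable Name] (Ps : NumPreds Name)
    {T : (σ : Signature) → (d r k : ℕ) → List (PStruc σ k)} (hT : IsTypeLists T) :
    ∃ f : ℕ × List ℕ × ℕ × List ℕ × (ℕ × List (List Bool) × List ℕ) →. ℕ, Partrec f ∧
      ∀ (d : ℕ) (σ : Signature) (φ : Formula σ Ps) (k : ℕ) (x : Fin k → ℕ),
        Function.Injective x → (φ.freeVar : Set ℕ) ⊆ Set.range x → φ.freeNum = ∅ →
        ∀ ρ ∈ T σ d φ.radius k,
          ∃ Ψ : ZFormula Ps,
            Ψ.code ∈ f (d, σ.arities, φ.code, List.ofFn x, ρ.code) ∧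
            Ψ.IsBounded (T σ d φ.radius 1).length ∧
            Ψ.free ⊆ Finset.range (T σ d φ.radius 1).length ∧
            ∀ (A : Type v) [Finite A] [Nonempty A] (S : Struc σ A), S.DBounded d →
              ∀ a : Fin k → A, S.Realises φ.radius a ρ →
              ∀ (β : ℕ → A) (ν : ℕ → ℤ), (∀ j, β (x j) = a j) →
              ∀ v : ℕ → ℤ,
                (∀ i : Fin (T σ d φ.radius 1).length,
                  v i = (S.numReal φ.radius ((T σ d φ.radius 1).get i) : ℤ)) →
                (φ.sem S β ν ↔ Ψ.Sat v) := by
  obtain ⟨⟨g, hg, hgT⟩, hT⟩ := hT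
  obtain ⟨rk, hrk, hrk'⟩ := exists_primrec_rank.{u}
  obtain ⟨t, ht, ht'⟩ := exists_primrec_tr.{u}
  let I : Type := ℕ × List ℕ × ℕ × List ℕ × (ℕ × List (List Bool) × List ℕ)
  let h : I → List (ℕ × List (List Bool) × List ℕ) → ℕ := fun i l =>
    ((t (((rk i.2.2.1).2, tausOf i.2.1 l), (rk i.2.2.1).1,
      factsOf i.2.1 i.2.2.2.2.1 i.2.2.2.2.2.1, i.2.2.2.2.2.2, i.2.2.2.1, i.2.2.1)).getD 0
        (0, 0)).1
  have hh : Primrec fun p : I × List (ℕ × List (List Bool) × List ℕ) => h p.1 p.2 := by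
    simp only [h, I]
    fun_prop
  have hin : Primrec fun i : I =>
      (i.2.1, i.1, rad (rk i.2.2.1).2 (rk i.2.2.1).1, 1) := by
    simp only [I]
    unfold rad
    fun_prop
  -- The type lists are requested once, for the radius computed from the code of the formula; all
  -- the rest is primitive recursive.
  refine ⟨fun i => (g (i.2.1, i.1, rad (rk i.2.2.1).2 (rk i.2.2.1).1, 1)).map (h i),
    (hg.comp hin.to_comp).map hh.to_comp.to₂, fun d σ φ k x hx hfree hnum ρ hρ => ?_⟩
  let taus := tausOf σ.arities ((T σ d φ.radius 1).map PStruc.code)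
  have hlen : taus.length = (T σ d φ.radius 1).length := by simp [taus, tausOf]
  have hb : OutBounded taus.length {i | i < taus.length} (tr φ.bw taus φ φ.br
      (factsOf σ.arities ρ.code.1 ρ.code.2.1) ρ.code.2.2 (List.ofFn x)) :=
    tr_bounded φ (fun i hi => hi) (by simp [hnum])
  rw [hlen] at hb
  refine ⟨tr φ.bw taus φ φ.br (factsOf σ.arities ρ.code.1 ρ.code.2.1) ρ.code.2.2 (List.ofFn x),
    ?_, hb.1, fun i hi => Finset.mem_range.2 (hb.2 hi), ?_⟩
  · refine (Part.mem_map_iff _).2 ⟨(T σ d φ.radius 1).map PStruc.code, ?_, ?_⟩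
    · have h1 := hgT σ d φ.radius 1
      simp only [hrk']
      exact h1
    · simp only [h, hrk', ht']
      rfl
  · intro A _ _ S hS a ha β ν hβ v hv
    -- Beyond the counts, `v` need not agree with `ν`. Changing it there is harmless, as no such
    -- variable is free in the translation.
    let v' : ℕ → ℤ := fun n => if n < (T σ d φ.radius 1).length then v n else
      ν (n - (T σ d φ.radius 1).length)
    have h1 := sat_tr_iff hx hfree (hT σ d φ.radius 1).1 (hT σ d φ.radius 1).2
      ((hT σ d φ.radius k).1 ρ hρ) hS ha hβ (v := v') (ν := ν)
      (fun i => by simp only [v', i.2, if_true]; exact hv i) (fun κ => by simp [v'])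
    rw [h1]
    refine sat_congr fun i hi => ?_
    have h2 : i < (T σ d φ.radius 1).length := hb.2 hi
    simp [v', h2]

end

end FOCN

namespace FOCN

/-! ### Computable lists of types -/

section Algorithms

/-- Codes of structures. -/
abbrev Code : Type := ℕ × List (List Bool) × List ℕ

/-- All codes of structures with `k` centres of size at most `B`. -/
def candidates (ar : List ℕ) (B k : ℕ) : List Code :=
  (List.range (B + 1)).flatMap fun N =>
    (prodList (ar.map fun m => prodList ((List.range (N ^ m)).map fun _ =>
      [false, true]))).flatMap fun tabs =>
        (prodList ((List.range k).map fun _ => List.range N)).map fun cs => (N, tabs, cs)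

/-- The facts of the structure with the given code. -/
def codeFacts (ar : List ℕ) (x : Code) : Facts := factsOf ar x.1 x.2.1

/-- Whether the Boolean adjacency relation holds. -/
def adjacent (F : Facts) (u v : ℕ) : Bool :=
  F.any fun f => (f.2.any fun y => y == u) && f.2.any fun y => y == v

/-- The test for being a `d`-bounded `r`-type. -/
def typeTest (ar : List ℕ) (d r : ℕ) (x : Code) : Bool :=
  ((List.range x.1).all fun u => (ball (codeFacts ar x) x.2.2 r).any fun y => y == u) &&
    (List.range x.1).all fun u =>
      Nat.ble ((List.range x.1).filter fun v => !(v == u) && adjacent (codeFacts ar x) u v).length d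

/-- The test whether the list `p` is an isomorphism. -/
def isoTestWith (ar : List ℕ) (x y : Code) (p : List ℕ) : Bool :=
  ((List.range x.1).all fun i => (List.range x.1).any fun j => p.getD j 0 == i) &&
    ((x.2.2.map fun u => p.getD u 0) == y.2.2 &&
      (((codeFacts ar x).all fun f => (codeFacts ar y).any fun f' =>
        (f.1, f.2.map fun u => p.getD u 0) == f') &&
      (codeFacts ar y).all fun f' => (codeFacts ar x).any fun f =>
        (f.1, f.2.map fun u => p.getD u 0) == f'))

/-- The test for isomorphism. -/
def isoTest (ar : List ℕ) (x y : Code) : Bool :=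
  x.1 == y.1 && (prodList ((List.range x.1).map fun _ => List.range x.1)).any (isoTestWith ar x y)

/-- The sublist that contains only the last one of several isomorphic codes. -/
def removeIso (ar : List ℕ) (l : List Code) : List Code :=
  l.foldr (fun x acc => bif acc.any (isoTest ar x) then acc else x :: acc) []

/-- The codes of representatives of all types. -/
def typeCodes (ar : List ℕ) (d r k : ℕ) : List Code :=
  removeIso ar ((candidates ar (k * (d + 1) ^ r) k).filter (typeTest ar d r))

variable {α : Type*} [Primcodable α]

@[fun_prop] theorem primrec_candidates {ar : α → List ℕ} {B k : α → ℕ} (har : Primrec ar)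
    (hB : Primrec B) (hk : Primrec k) : Primrec fun a => candidates (ar a) (B a) (k a) := by
  unfold candidates
  fun_prop

@[fun_prop] theorem primrec_codeFacts {ar : α → List ℕ} {x : α → Code} (har : Primrec ar)
    (hx : Primrec x) : Primrec fun a => codeFacts (ar a) (x a) := by
  unfold codeFacts
  fun_prop

@[fun_prop] theorem primrec_adjacent {F : α → Facts} {u v : α → ℕ} (hF : Primrec F)
    (hu : Primrec u) (hv : Primrec v) : Primrec fun a => adjacent (F a) (u a) (v a) := by
  unfold adjacent
  fun_prop

@[fun_prop] theorem primrec_typeTest {ar : α → List ℕ} {d r : α → ℕ} {x : α → Code}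
    (har : Primrec ar) (hd : Primrec d) (hr : Primrec r) (hx : Primrec x) :
    Primrec fun a => typeTest (ar a) (d a) (r a) (x a) := by
  unfold typeTest
  fun_prop

@[fun_prop] theorem primrec_isoTestWith {ar : α → List ℕ} {x y : α → Code} {p : α → List ℕ}
    (har : Primrec ar) (hx : Primrec x) (hy : Primrec y) (hp : Primrec p) :
    Primrec fun a => isoTestWith (ar a) (x a) (y a) (p a) := by
  unfold isoTestWith
  have h1 : Primrec fun a => ((x a).2.2.map fun u => (p a).getD u 0) == (y a).2.2 :=
    primrec_lawfulBeq (by fun_prop) (by fun_prop)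
  have h2 : Primrec fun q : (α × ℕ × List ℕ) × ℕ × List ℕ =>
      (q.1.2.1, q.1.2.2.map fun u => (p q.1.1).getD u 0) == q.2 :=
    primrec_lawfulBeq (by fun_prop) (by fun_prop)
  have h3 : Primrec fun q : (α × ℕ × List ℕ) × ℕ × List ℕ =>
      (q.2.1, q.2.2.map fun u => (p q.1.1).getD u 0) == q.1.2 :=
    primrec_lawfulBeq (by fun_prop) (by fun_prop)
  fun_prop

@[fun_prop] theorem primrec_isoTest {ar : α → List ℕ} {x y : α → Code}
    (har : Primrec ar) (hx : Primrec x) (hy : Primrec y) :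
    Primrec fun a => isoTest (ar a) (x a) (y a) := by
  unfold isoTest
  fun_prop

@[fun_prop] theorem primrec_removeIso {ar : α → List ℕ} {l : α → List Code} (har : Primrec ar)
    (hl : Primrec l) : Primrec fun a => removeIso (ar a) (l a) := by
  unfold removeIso
  fun_prop

@[fun_prop] theorem primrec_typeCodes {ar : α → List ℕ} {d r k : α → ℕ} (har : Primrec ar)
    (hd : Primrec d) (hr : Primrec r) (hk : Primrec k) :
    Primrec fun a => typeCodes (ar a) (d a) (r a) (k a) := by
  unfold typeCodes
  fun_prop

end Algorithms

/-! ### Correctness of the tests and of the enumeration of types. -/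

section Correctness

variable {σ : Signature} {k : ℕ}

theorem adjacent_iff {F : Facts} {u v : ℕ} : adjacent F u v = true ↔ F.Adj u v := by
  simp [adjacent, Facts.Adj]

theorem PStruc.centre_code (τ : PStruc σ k) :
    τ.code.2.2 = List.ofFn fun j => (τ.centre j : ℕ) := rfl

theorem typeTest_iff {d r : ℕ} (τ : PStruc σ k) :
    typeTest σ.arities d r τ.code = true ↔ τ.IsType r d := by
  have hF := τ.represents
  unfold typeTest PStruc.IsType
  rw [Bool.and_eq_true, hF.dbounded_iff]
  refine and_congr ?_ ?_
  · simp only [List.all_eq_true, List.mem_range, List.any_eq_true, beq_iff_eq, exists_eq_right,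
      mem_ball, Set.eq_univ_iff_forall, hF.mem_nbhd_iff]
    exact ⟨fun h i => h i i.2, fun h u hu => h ⟨u, hu⟩⟩
  · simp only [List.all_eq_true, List.mem_range, Nat.ble_eq]
    have h1 : ∀ u, ((List.range τ.code.1).filter fun v =>
        !(v == u) && adjacent (codeFacts σ.arities τ.code) u v).length =
        {v | v ≠ u ∧ Facts.Adj (factsOf σ.arities τ.code.1 τ.code.2.1) u v}.ncard := by
      intro u
      rw [← List.toFinset_card_of_nodup (List.nodup_range.filter _), ← Set.ncard_coe_finset]
      congr 1
      ext v
      simp only [List.coe_toFinset, List.mem_filter, List.mem_range, Bool.and_eq_true,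
        Bool.not_eq_true', beq_eq_false_iff_ne, adjacent_iff, Set.mem_ofPred_eq, codeFacts]
      -- The test looks for neighbours only below the size of the universe; facts mention no other
      -- numbers, so none is missed.
      refine and_iff_right_of_imp fun h => ?_
      obtain ⟨-, f, hf, -, hv⟩ := h
      obtain ⟨i, rfl⟩ := hF.mem_range hf hv
      exact i.2
    simp only [h1]
    exact ⟨fun h i => h i i.2, fun h u hu => h ⟨u, hu⟩⟩

theorem isoTest_iff (τ τ' : PStruc σ k) :
    isoTest σ.arities τ.code τ'.code = true ↔ Iso τ.str τ.centre τ'.str τ'.centre := by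
  have hF := τ.represents
  have hF' := τ'.represents
  unfold isoTest isoTestWith codeFacts
  simp only [Bool.and_eq_true, List.any_eq_true, List.all_eq_true, beq_iff_eq, List.mem_range,
    mem_prodList_range 0]
  rw [τ.centre_code, τ'.centre_code]
  set F := factsOf σ.arities τ.code.1 τ.code.2.1
  set F' := factsOf σ.arities τ'.code.1 τ'.code.2.1
  constructor
  · rintro ⟨hs, p, ⟨hpl, hp⟩, hsurj, hc, h1, h2⟩
    replace hs : τ.size = τ'.size := hs
    let e : Fin τ.size → Fin τ'.size := fun i => ⟨p.getD i 0, (hp i i.2).trans_eq hs⟩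
    have he : Function.Surjective e := by
      intro i
      obtain ⟨j, hj, hji⟩ := hsurj i (i.2.trans_eq hs.symm)
      exact ⟨⟨j, hj⟩, Fin.ext hji⟩
    have hb : Function.Bijective e :=
      (Fintype.bijective_iff_surjective_and_card e).2 ⟨he, by simp [hs]⟩
    have hmap : ∀ {m : ℕ} (t : Fin m → Fin τ.size),
        (List.ofFn fun j => (t j : ℕ)).map (fun u => p.getD u 0) =
          List.ofFn fun j => (e (t j) : ℕ) := by
      intro m t
      rw [List.map_ofFn]
      rfl
    refine ⟨Equiv.ofBijective e hb, fun R t => ?_, fun j => ?_⟩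
    · rw [← hF.mem_iff, ← hF'.mem_iff]
      simp only [Equiv.ofBijective_apply]
      rw [← hmap]
      constructor
      · intro ht
        obtain ⟨f', hf', he'⟩ := h1 _ ht
        rwa [he']
      · intro ht
        -- The test yields some fact with the right image; injectivity of `e` identifies its tuple
        -- with `t`.
        obtain ⟨f, hf, he'⟩ := h2 _ ht
        obtain ⟨R', hR', s, hs, hfs⟩ := (hF.facts f.1 f.2).1 hf
        rw [Prod.mk.injEq] at he'
        obtain rfl : R' = R := Fin.ext (hR'.trans he'.1)
        rw [hfs, hmap, hmap] at he'
        have h3 : s = t := funext fun j =>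
          hb.1 (Fin.ext (congrFun (List.ofFn_injective he'.2) j))
        rw [← h3]
        exact (hF.mem_iff R' s).2 hs
    · rw [hmap] at hc
      exact Fin.ext (congrFun (List.ofFn_injective hc) j)
  · rintro ⟨e, h1, h2⟩
    have hs : τ.size = τ'.size := by simpa using Fintype.card_congr e
    have hp : ∀ i : Fin τ.size, (List.ofFn fun i => (e i : ℕ)).getD i 0 = e i := by
      intro i
      simp
    have hmap : ∀ {m : ℕ} (t : Fin m → Fin τ.size),
        (List.ofFn fun j => (t j : ℕ)).map
          (fun u => (List.ofFn fun i => (e i : ℕ)).getD u 0) =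
          List.ofFn fun j => (e (t j) : ℕ) := by
      intro m t
      rw [List.map_ofFn]
      exact congrArg List.ofFn (funext fun j => hp (t j))
    refine ⟨hs, List.ofFn fun i => (e i : ℕ), ⟨by simp [PStruc.code], fun i hi => ?_⟩,
      fun i hi => ?_, ?_, ?_, ?_⟩
    · exact (hp ⟨i, hi⟩).trans_lt ((e ⟨i, hi⟩).2.trans_eq hs.symm)
    · have hi' : i < τ'.size := hs ▸ hi
      refine ⟨e.symm ⟨i, hi'⟩, (e.symm ⟨i, hi'⟩).2, ?_⟩
      rw [hp]
      simp
    · rw [hmap]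
      simp only [h2]
    · intro f hf
      obtain ⟨R, hR, s, hs, hfs⟩ := (hF.facts f.1 f.2).1 hf
      refine ⟨_, (hF'.mem_iff R _).2 ((h1 R s).1 hs), ?_⟩
      rw [hfs, hmap, hR]
    · intro f hf
      obtain ⟨R, hR, s, hs, hfs⟩ := (hF'.facts f.1 f.2).1 hf
      refine ⟨_, (hF.mem_iff R fun j => e.symm (s j)).2 ((h1 R _).2 (by simpa using hs)), ?_⟩
      rw [hmap]
      simp only [Equiv.apply_symm_apply, hR, ← hfs]

theorem exists_code_eq {B : ℕ} {x : Code} (hx : x ∈ candidates σ.arities B k) :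
    ∃ τ : PStruc σ k, τ.code = x := by
  simp only [candidates, List.mem_flatMap, List.mem_map, mem_prodList_range 0,
    List.mem_range] at hx
  obtain ⟨N, -, tabs, htabs, cs, ⟨hcl, hcs⟩, rfl⟩ := hx
  rw [mem_prodList, List.forall₂_iff_get] at htabs
  obtain ⟨hl, htabs⟩ := htabs
  rw [List.length_map] at hl
  obtain ⟨c, rfl⟩ := tuple_of_forall_lt hcl hcs
  refine ⟨⟨N, ⟨fun R => {s | (tabs.getD R []).getD (finFunctionFinEquiv s) false = true}⟩, c⟩, ?_⟩
  unfold PStruc.code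
  refine Prod.ext rfl (Prod.ext ?_ rfl)
  refine List.ext_getElem (by simp [hl]) fun i h1 h2 => ?_
  have h3 := htabs i h2 (by simpa [hl] using h2)
  simp only [List.get_eq_getElem, List.getElem_map, mem_prodList_range false] at h3
  rw [List.getElem_ofFn]
  refine List.ext_getElem (by simp [h3.1]) fun j h4 h5 => ?_
  rw [List.getElem_ofFn]
  simp only [Set.mem_ofPred_eq, Equiv.apply_symm_apply, Bool.decide_eq_true]
  rw [List.getD_eq_getElem _ _ h2, List.getD_eq_getElem _ _ h5]

theorem code_mem_candidates {B : ℕ} (τ : PStruc σ k) (h : τ.size ≤ B) :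
    τ.code ∈ candidates σ.arities B k := by
  simp only [candidates, List.mem_flatMap, List.mem_map, mem_prodList_range 0,
    List.mem_range]
  refine ⟨τ.size, by omega, τ.code.2.1, ?_, τ.code.2.2, ⟨by simp [PStruc.code], fun i hi => ?_⟩,
    rfl⟩
  · rw [mem_prodList, List.forall₂_iff_get]
    refine ⟨by simp [PStruc.code], fun i h1 h2 => ?_⟩
    simp only [List.get_eq_getElem, List.getElem_map, mem_prodList_range false]
    refine ⟨by simp [PStruc.code], fun j _ => ?_⟩
    cases (τ.code.2.1[i]).getD j false <;> simp
  · rw [τ.centre_code, List.getD_eq_getElem _ _ (by simpa using hi), List.getElem_ofFn]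
    exact (τ.centre _).2

/-- Enlarging the radius by one multiplies the ball by at most `d + 1`, since each element
contributes itself and at most `d` neighbours. Hence the search for types is finite. -/
theorem PStruc.IsType.size_le {τ : PStruc σ k} {r d : ℕ} (h : τ.IsType r d) :
    τ.size ≤ k * (d + 1) ^ r := by
  classical
  have key : ∀ s, (τ.str.nbhd s τ.centre).ncard ≤ k * (d + 1) ^ s := by
    intro s
    induction s with
    | zero =>
      have h1 : τ.str.nbhd 0 τ.centre = Set.range τ.centre := by
        ext b
        simp [Struc.nbhd]
      rw [h1, pow_zero, mul_one, ← Set.image_univ]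
      refine (Set.ncard_image_le).trans ?_
      simp [Set.ncard_univ]
    | succ s ih =>
      have h1 : τ.str.nbhd (s + 1) τ.centre ⊆ ((τ.str.nbhd s τ.centre).toFinset.biUnion fun b =>
          insert b (τ.str.gaifman.neighborSet b).toFinset : Finset (Fin τ.size)) := by
        rintro b ⟨j, hj⟩
        simp only [Finset.coe_biUnion, Set.mem_iUnion, Finset.mem_coe, Finset.mem_insert,
          Set.mem_toFinset, SimpleGraph.mem_neighborSet, exists_prop]
        rcases edist_le_succ_iff.1 hj with hj | ⟨m, hj, hm⟩
        · exact ⟨b, ⟨j, hj⟩, Or.inl rfl⟩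
        · exact ⟨m, ⟨j, hj⟩, Or.inr hm⟩
      refine (Set.ncard_le_ncard h1 (Finset.finite_toSet _)).trans ?_
      rw [Set.ncard_coe_finset]
      refine (Finset.card_biUnion_le_card_mul _ _ (d + 1) fun b _ => ?_).trans ?_
      · refine (Finset.card_insert_le _ _).trans (Nat.add_le_add_right ?_ 1)
        rw [← Set.ncard_eq_toFinset_card']
        exact h.2 b
      · rw [← Set.ncard_eq_toFinset_card', pow_succ, ← mul_assoc]
        exact Nat.mul_le_mul_right _ ih
  have h1 := key r
  rwa [h.1, Set.ncard_univ, Nat.card_eq_fintype_card, Fintype.card_fin] at h1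

theorem removeIso_subset (ar : List ℕ) (l : List Code) : removeIso ar l ⊆ l := by
  induction l with
  | nil => exact fun _ h => h
  | cons x l ih =>
    intro y hy
    change y ∈ (bif (removeIso ar l).any (isoTest ar x) then removeIso ar l
      else x :: removeIso ar l) at hy
    cases h : (removeIso ar l).any (isoTest ar x) <;> rw [h] at hy
    · rcases List.mem_cons.1 hy with rfl | hy
      · exact List.mem_cons_self
      · exact List.mem_cons_of_mem _ (ih hy)
    · exact List.mem_cons_of_mem _ (ih hy)

theorem exists_mem_removeIso (ar : List ℕ) {l : List Code} {x : Code} (hx : x ∈ l) :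
    ∃ y ∈ removeIso ar l, x = y ∨ isoTest ar x y = true := by
  induction l with
  | nil => simp at hx
  | cons z l ih =>
    change ∃ y ∈ (bif (removeIso ar l).any (isoTest ar z) then removeIso ar l
      else z :: removeIso ar l), _
    cases h : (removeIso ar l).any (isoTest ar z)
    · rcases List.mem_cons.1 hx with rfl | hx
      · exact ⟨x, List.mem_cons_self, Or.inl rfl⟩
      · obtain ⟨y, hy, hxy⟩ := ih hx
        exact ⟨y, List.mem_cons_of_mem _ hy, hxy⟩
    · rcases List.mem_cons.1 hx with rfl | hx
      · obtain ⟨y, hy, hxy⟩ := List.any_eq_true.1 h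
        exact ⟨y, hy, Or.inr hxy⟩
      · exact ih hx

theorem pairwise_removeIso (ar : List ℕ) (l : List Code) :
    (removeIso ar l).Pairwise fun x y => ¬ isoTest ar x y = true := by
  induction l with
  | nil => exact List.Pairwise.nil
  | cons z l ih =>
    change (bif (removeIso ar l).any (isoTest ar z) then removeIso ar l
      else z :: removeIso ar l).Pairwise _
    cases h : (removeIso ar l).any (isoTest ar z)
    · refine List.pairwise_cons.2 ⟨fun y hy hzy => ?_, ih⟩
      rw [List.any_eq_true.2 ⟨y, hy, hzy⟩] at h
      exact Bool.noConfusion h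
    · exact ih

/-- The algorithm handles codes only. Every candidate is the code of a structure, so its output can
be pulled back to a list of structures. -/
theorem exists_map_code_eq (σ : Signature) (d r k : ℕ) :
    ∃ T : List (PStruc σ k), T.map PStruc.code = typeCodes σ.arities d r k := by
  have h : typeCodes σ.arities d r k ∈ Set.range (List.map (PStruc.code (σ := σ) (k := k))) := by
    rw [Set.range_list_map]
    exact fun x hx => exists_code_eq (List.mem_filter.1 (removeIso_subset _ _ hx)).1
  exact h

/-- Computable lists of types exist. -/
theorem exists_isTypeLists : ∃ T : (σ : Signature) → (d r k : ℕ) → List (PStruc σ k),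
    IsTypeLists T := by
  choose T hT using exists_map_code_eq
  refine ⟨T, ⟨fun i => Part.some (typeCodes i.1 i.2.1 i.2.2.1 i.2.2.2), ?_, fun σ d r k => ?_⟩,
    fun σ d r k => ⟨fun τ hτ => ?_, fun τ hτ => ?_⟩⟩
  · exact Primrec.to_comp (by fun_prop)
  · exact Part.mem_some_iff.2 (hT σ d r k)
  · have h1 := List.mem_map_of_mem (f := PStruc.code) hτ
    rw [hT] at h1
    exact (typeTest_iff τ).1 (List.mem_filter.1 (removeIso_subset _ _ h1)).2
  · obtain ⟨y, hy, h1⟩ := exists_mem_removeIso σ.arities (List.mem_filter.2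
      ⟨code_mem_candidates τ hτ.size_le, (typeTest_iff τ).2 hτ⟩)
    change y ∈ typeCodes σ.arities d r k at hy
    rw [← hT] at hy
    obtain ⟨τ', hτ', rfl⟩ := List.mem_map.1 hy
    have h2 : Iso τ.str τ.centre τ'.str τ'.centre := by
      rw [← isoTest_iff]
      rcases h1 with h1 | h1
      · rw [← h1]
        exact (isoTest_iff τ τ).2 (Iso.refl _ _)
      · exact h1
    obtain ⟨i, rfl⟩ := List.mem_iff_get.1 hτ'
    refine ⟨i, h2, fun j hj => ?_⟩
    have h3 : (T σ d r k).Pairwise fun τ τ' => ¬ Iso τ.str τ.centre τ'.str τ'.centre := by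
      have h4 := pairwise_removeIso σ.arities
        ((candidates σ.arities (k * (d + 1) ^ r) k).filter (typeTest σ.arities d r))
      change (typeCodes σ.arities d r k).Pairwise _ at h4
      rw [← hT, List.pairwise_map] at h4
      exact h4.imp fun h5 h6 => h5 ((isoTest_iff _ _).2 h6)
    rw [List.pairwise_iff_get] at h3
    -- Pairwise non-isomorphism is known from earlier to later entries; the symmetry of `Iso`
    -- settles the opposite order.
    rcases lt_trichotomy i j with h4 | h4 | h4
    · exact absurd (h2.symm.trans hj) (h3 i j h4)
    · exact h4.symm
    · exact absurd (hj.symm.trans h2) (h3 j i h4)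

end Correctness

end FOCN

theorem mainTheorem8 {Name : Type*} [Encodable Name] (Ps : NumPreds Name) :
    (∃ T : (σ : Signature) → (d r k : ℕ) → List (PStruc σ k), IsTypeLists T) ∧
    ∀ T : (σ : Signature) → (d r k : ℕ) → List (PStruc σ k), IsTypeLists T →
      ∃ f : ℕ × List ℕ × ℕ × List ℕ × (ℕ × List (List Bool) × List ℕ) →. ℕ, Partrec f ∧
        ∀ (d : ℕ) (σ : Signature) (φ : Formula σ Ps) (k : ℕ) (x : Fin k → ℕ),
          Function.Injective x → (φ.freeVar : Set ℕ) ⊆ Set.range x → φ.freeNum = ∅ →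
          ∀ ρ ∈ T σ d φ.radius k,
            ∃ Ψ : ZFormula Ps,
              Ψ.code ∈ f (d, σ.arities, φ.code, List.ofFn x, ρ.code) ∧
              Ψ.IsBounded (T σ d φ.radius 1).length ∧
              Ψ.free ⊆ Finset.range (T σ d φ.radius 1).length ∧
              ∀ (A : Type*) [Finite A] [Nonempty A] (S : Struc σ A), S.DBounded d →
                ∀ a : Fin k → A, S.Realises φ.radius a ρ →
                ∀ (β : ℕ → A) (ν : ℕ → ℤ), (∀ j, β (x j) = a j) →
                ∀ v : ℕ → ℤ,
                  (∀ i : Fin (T σ d φ.radius 1).length,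
                    v i = (S.numReal φ.radius ((T σ d φ.radius 1).get i) : ℤ)) →
                  (φ.sem S β ν ↔ Ψ.Sat v) := by
  exact ⟨exists_isTypeLists, fun T hT => exists_algorithm Ps hT⟩
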